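/- Let $\varepsilon > 0$, let $N := \lfloor \varepsilon^{-1} \rfloor$, and let $$D_\varepsilon = \begin{bmatrix} 0 & \tanh x - \varepsilon \partial_x \\ \tanh x + \varepsilon \partial_x & 0 \end{bmatrix}$$ be the Dirac operator in $L^2(\mathbb{R};\mathbb{C}^2)$ with domain $H^1(\mathbb{R};\mathbb{C}^2)$. Its square $D_\varepsilon^2$ (on its natural domain) is diagonal; call its two diagonal entries the upper and the lower component. The discrete spectrum $\sigma_{\mathrm{discrete}}$ is the set of isolated points of the spectrum that are eigenvalues of finite multiplicity, and the essential spectrum $\sigma_{\mathrm{ess}}$ is the rest of the spectrum. Put $$\lambda_k^{(+)} = 1 - (1-\varepsilon k)^2, \qquad \lambda_k^{(-)} = 1 - (1-\varepsilon (k+1))^2 .$$ 1. The discrete spectrum of the upper component of $D_\varepsilon^2$ consists of the $\lambda_k^{(+)}$, $k = 0, 1, \dots, N$, and that of the lower component of the $\lambda_k^{(-)}$, $k = 0, 1, \dots, N-1$, where in both cases the value $1$ (which occurs only if $\varepsilon^{-1} \in \mathbb{N}$, as $\lambda_N^{(+)} = \lambda_{N-1}^{(-)} = 1$) is omitted. The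 discrete spectrum of $D_\varepsilon^2$ is that of the upper component, and the discrete spectrum of $D_\varepsilon$ consists of the numbers $\pm\sqrt{\lambda_k^{(+)}}$ with the same $k$. None of these four operators has any other eigenvalues. 2. The spectra interlace: $\lambda_k^{(-)} = \lambda_{k+1}^{(+)}$ for $0 \le k \le N-1$. Moreover $\lambda_k^{(+)} = k\varepsilon(2 - k\varepsilon)$ for $0 \le k \le N$ and $\lambda_k^{(-)} = (k+1)\varepsilon(2-(k+1)\varepsilon)$ for $0 \le k \le N-1$. The eigenvalue $\lambda_0^{(+)} = 0$ of $D_\varepsilon^2$ is simple, and every other discrete eigenvalue of $D_\varepsilon^2$ has multiplicity exactly two. 3. If $\varepsilon^{-1} \notin \mathbb{N}$, then $$\#\sigma_{\mathrm{discrete}}(D_\varepsilon^2) = N+1, \qquad \#\sigma_{\mathrm{discrete}}(D_\varepsilon) = 2N+1 .$$ If $\varepsilon^{-1} \in \mathbb{N}$, then $N = \varepsilon^{-1}$, $\lambda_N^{(+)} = 1$ is the bottom of the essential spectrum of $D_\varepsilon^2$ and not an eigenvalue, and the two numbers are $N$ and $2N-1$. 4. The essential spectra are $$\sigma_{\mathrm{ess}}(D_\varepsilon^2)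 = [1, \infty), \qquad \sigma_{\mathrm{ess}}(D_\varepsilon) = (-\infty, -1] \cup [1, \infty).$$ -/

import Mathlib

open MeasureTheory
open scoped ContDiff Topology

noncomputable section

namespace DiracTanh

/-! ### Spectral theory of unbounded operators on a complex Banach space

An unbounded operator is a linear map on a subspace (its domain), that is, a `LinearPMap`. -/

section Spectral

variable {E : Type*} [NormedAddCommGroup E] [NormedSpace ℂ E]

/-- The square `T ∘ T` on its natural domain `{x ∈ dom T | T x ∈ dom T}`. -/
def sq (T : E →ₗ.[ℂ] E) : E →ₗ.[ℂ] E where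
  domain := (T.domain.comap T.toFun).map T.domain.subtype
  toFun :=
    { toFun := fun x => T ⟨T ⟨x.1, by
          obtain ⟨y, -, hy⟩ := x.2
          exact hy ▸ y.2⟩, by
        obtain ⟨_, y, hy, rfl⟩ := x
        exact hy⟩
      map_add' := by
        rintro ⟨_, x, hx, rfl⟩ ⟨_, y, hy, rfl⟩
        rw [← LinearPMap.map_add]
        congr 1
        apply Subtype.ext
        exact LinearPMap.map_add T x y
      map_smul' := by
        rintro c ⟨_, x, hx, rfl⟩
        rw [RingHom.id_apply, ← LinearPMap.map_smul]
        congr 1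
        apply Subtype.ext
        exact LinearPMap.map_smul T c x }

/-- `z` is in the resolvent set of `T` if `T - z : dom T → E` has a bounded two-sided inverse. -/
def resolventSet (T : E →ₗ.[ℂ] E) : Set ℂ :=
  {z | ∃ R : E →L[ℂ] E,
    (∀ y : E, ∃ h : R y ∈ T.domain, T ⟨R y, h⟩ - z • R y = y) ∧
    (∀ x : T.domain, R (T x - z • (x : E)) = x)}

/-- The spectrum, the complement of the resolvent set. -/
def spectrum (T : E →ₗ.[ℂ] E) : Set ℂ := (resolventSet T)ᶜ

/-- The eigenspace `{x ∈ dom T | T x = z x}`. -/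
def eigenspace (T : E →ₗ.[ℂ] E) (z : ℂ) : Submodule ℂ E :=
  T.graph.comap (LinearMap.id.prod (z • LinearMap.id))

/-- The set of eigenvalues. -/
def eigenvalues (T : E →ₗ.[ℂ] E) : Set ℂ := {z | eigenspace T z ≠ ⊥}

/-- The discrete spectrum of a self-adjoint operator: the eigenvalues of finite multiplicity that
are isolated points of the spectrum. -/
def discreteSpectrum (T : E →ₗ.[ℂ] E) : Set ℂ :=
  {z | z ∈ eigenvalues T ∧ FiniteDimensional ℂ (eigenspace T z) ∧
    ∃ U ∈ 𝓝 z, U ∩ spectrum T = {z}}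

/-- The essential spectrum of a self-adjoint operator: the rest of the spectrum. -/
def essentialSpectrum (T : E →ₗ.[ℂ] E) : Set ℂ := spectrum T \ discreteSpectrum T

end Spectral

/-! ### The Dirac operator -/

/-- The Hilbert space `L²(ℝ; ℂ)`. -/
abbrev L2 : Type := Lp ℂ 2 (volume : Measure ℝ)

/-- The Hilbert space `L²(ℝ; ℂ²) = L²(ℝ; ℂ) ⊕ L²(ℝ; ℂ)` of two-component spinors. -/
abbrev Spinor : Type := WithLp 2 (L2 × L2)

/-- `g` is the weak derivative of `f`. -/
def HasWeakDeriv (f g : L2) : Prop :=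
  ∀ φ : ℝ → ℝ, ContDiff ℝ ∞ φ → HasCompactSupport φ →
    ∫ x, deriv φ x • f x = -∫ x, φ x • g x

lemma L2.integrable_smul (f : L2) {φ : ℝ → ℝ} (hφ : Continuous φ) (hc : HasCompactSupport φ) :
    Integrable (fun x => φ x • f x) :=
  (((Lp.memLp f).locallyIntegrable (by norm_num))).integrable_smul_left_of_hasCompactSupport hφ hc

/-- The pairs `(f, f')` with `f ∈ H¹(ℝ)`. -/
def weakDerivGraph : Submodule ℂ (L2 × L2) where
  carrier := {p | HasWeakDeriv p.1 p.2}
  zero_mem' := by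
    intro φ hφ hc
    have h : ∀ ψ : ℝ → ℝ, ∫ x, ψ x • ((0 : L2) : ℝ → ℂ) x = 0 := by
      intro ψ
      apply integral_eq_zero_of_ae
      filter_upwards [Lp.coeFn_zero ℂ 2 (volume : Measure ℝ)] with x hx
      simp only [hx, Pi.zero_apply, smul_zero]
    simp only [Prod.fst_zero, Prod.snd_zero, h, neg_zero]
  add_mem' := by
    rintro ⟨f, g⟩ ⟨f', g'⟩ h h' φ hφ hc
    have key : ∀ (u v : L2) (ψ : ℝ → ℝ), Continuous ψ → HasCompactSupport ψ →
        ∫ x, ψ x • (u + v : L2) x = (∫ x, ψ x • u x) + ∫ x, ψ x • v x := by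
      intro u v ψ h1 h2
      rw [← integral_add (L2.integrable_smul u h1 h2) (L2.integrable_smul v h1 h2)]
      apply integral_congr_ae
      filter_upwards [Lp.coeFn_add u v] with x hx
      simp only [hx, Pi.add_apply, smul_add]
    have e := h φ hφ hc
    have e' := h' φ hφ hc
    simp only [Prod.mk_add_mk] at *
    rw [key _ _ _ (hφ.continuous_deriv (by simp)) hc.deriv, key _ _ _ hφ.continuous hc, e, e']
    ring
  smul_mem' := by
    rintro c ⟨f, g⟩ h φ hφ hc
    have key : ∀ (u : L2) (ψ : ℝ → ℝ),
        ∫ x, ψ x • (c • u : L2) x = c * ∫ x, ψ x • u x := by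
      intro u ψ
      rw [← integral_const_mul]
      apply integral_congr_ae
      filter_upwards [Lp.coeFn_smul c u] with x hx
      simp only [hx, Pi.smul_apply, smul_eq_mul, Complex.real_smul]
      ring
    have e := h φ hφ hc
    simp only [Prod.smul_mk] at *
    rw [key, key, e]
    ring

/-- A weak derivative is unique, so that `weakDerivGraph` is the graph of an operator. -/
lemma weakDerivGraph_unique (p : L2 × L2) (hp : p ∈ weakDerivGraph) (h0 : p.1 = 0) : p.2 = 0 := by
  obtain ⟨f, g⟩ := p
  simp only at h0
  subst h0
  rw [Lp.eq_zero_iff_ae_eq_zero]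
  apply ae_eq_zero_of_integral_contDiff_smul_eq_zero
    ((Lp.memLp g).locallyIntegrable (by norm_num))
  intro φ hφ hc
  have e := hp φ hφ hc
  have h : ∫ x, deriv φ x • ((0 : L2) : ℝ → ℂ) x = 0 := by
    apply integral_eq_zero_of_ae
    filter_upwards [Lp.coeFn_zero ℂ 2 (volume : Measure ℝ)] with x hx
    simp only [hx, Pi.zero_apply, smul_zero]
  simp only [h] at e
  simpa using e.symm

/-- The operator `∂ₓ` in `L²(ℝ)` with domain `H¹(ℝ)`. -/
def weakDeriv : L2 →ₗ.[ℂ] L2 := weakDerivGraph.toLinearPMap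

/-- `weakDeriv` takes the value that its name says. -/
lemma mem_graph_weakDeriv (f g : L2) : (f, g) ∈ weakDeriv.graph ↔ HasWeakDeriv f g := by
  rw [weakDeriv, Submodule.toLinearPMap_graph_eq _ weakDerivGraph_unique]
  rfl

/-- Multiplication by the function `m` in `L²(ℝ)`, on its maximal domain (which is all of `L²(ℝ)`
if `m` is continuous and bounded). -/
def mulOp (m : ℝ → ℝ) : L2 →ₗ.[ℂ] L2 where
  domain :=
    { carrier := {f | MemLp (fun x => (m x : ℂ) * f x) 2 volume}
      zero_mem' := by
        refine (MemLp.zero (p := 2) (ε := ℂ)).ae_eq ?_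
        filter_upwards [Lp.coeFn_zero ℂ 2 (volume : Measure ℝ)] with x hx
        simp only [hx, Pi.zero_apply, mul_zero]
      add_mem' := by
        intro f g hf hg
        refine (MemLp.add hf hg).ae_eq ?_
        filter_upwards [Lp.coeFn_add f g] with x hx
        simp only [hx, Pi.add_apply, mul_add]
      smul_mem' := by
        intro c f hf
        refine (MemLp.const_smul hf c).ae_eq ?_
        filter_upwards [Lp.coeFn_smul c f] with x hx
        simp only [hx, Pi.smul_apply, smul_eq_mul]
        ring }
  toFun :=
    { toFun := fun f => MemLp.toLp (fun x => (m x : ℂ) * f.1 x) f.2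
      map_add' := by
        rintro ⟨f, hf⟩ ⟨g, hg⟩
        rw [← MemLp.toLp_add]
        apply MemLp.toLp_congr
        filter_upwards [Lp.coeFn_add f g] with x hx
        simp only [AddMemClass.mk_add_mk, hx, Pi.add_apply, mul_add]
      map_smul' := by
        rintro c ⟨f, hf⟩
        rw [RingHom.id_apply, ← MemLp.toLp_const_smul]
        apply MemLp.toLp_congr
        filter_upwards [Lp.coeFn_smul c f] with x hx
        simp only [hx, Pi.smul_apply, smul_eq_mul, SetLike.mk_smul_mk]
        ring }

/-- The operator matrix `[[0, B], [A, 0]]` with domain `dom A ⊕ dom B`. -/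
def offDiag (A B : L2 →ₗ.[ℂ] L2) : Spinor →ₗ.[ℂ] Spinor where
  domain :=
    { carrier := {Ψ | Ψ.fst ∈ A.domain ∧ Ψ.snd ∈ B.domain}
      zero_mem' := ⟨A.domain.zero_mem, B.domain.zero_mem⟩
      add_mem' := fun h h' => ⟨A.domain.add_mem h.1 h'.1, B.domain.add_mem h.2 h'.2⟩
      smul_mem' := fun c _ h => ⟨A.domain.smul_mem c h.1, B.domain.smul_mem c h.2⟩ }
  toFun :=
    { toFun := fun Ψ => WithLp.toLp 2 (B ⟨Ψ.1.snd, Ψ.2.2⟩, A ⟨Ψ.1.fst, Ψ.2.1⟩)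
      map_add' := by
        intro x y
        rw [← WithLp.toLp_add, Prod.mk_add_mk, ← LinearPMap.map_add, ← LinearPMap.map_add]
        rfl
      map_smul' := by
        intro c x
        rw [RingHom.id_apply, ← WithLp.toLp_smul, Prod.smul_mk, ← LinearPMap.map_smul,
          ← LinearPMap.map_smul]
        rfl }

/-- The Dirac operator `D_ε = m(x) σ_x - i ε ∂ₓ σ_y = [[0, m - ε ∂ₓ], [m + ε ∂ₓ, 0]]` in
`L²(ℝ; ℂ²)`, with domain `H¹(ℝ; ℂ²)` if `m` is continuous and bounded and `ε ≠ 0`. -/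
def diracOp (m : ℝ → ℝ) (ε : ℝ) : Spinor →ₗ.[ℂ] Spinor :=
  offDiag (mulOp m + (ε : ℂ) • weakDeriv) (mulOp m - (ε : ℂ) • weakDeriv)

/-- The inclusion `u ↦ (u, 0)` of the upper component. -/
def inUpper : L2 →ₗ[ℂ] Spinor :=
  (WithLp.linearEquiv 2 ℂ (L2 × L2)).symm.toLinearMap ∘ₗ LinearMap.inl ℂ L2 L2

/-- The inclusion `v ↦ (0, v)` of the lower component. -/
def inLower : L2 →ₗ[ℂ] Spinor :=
  (WithLp.linearEquiv 2 ℂ (L2 × L2)).symm.toLinearMap ∘ₗ LinearMap.inr ℂ L2 L2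

/-- The upper left entry of an operator on spinors: `u ↦ (T (u, 0))₁`, where `(u, 0) ∈ dom T`. -/
def upperEntry (T : Spinor →ₗ.[ℂ] Spinor) : L2 →ₗ.[ℂ] L2 where
  domain := T.domain.comap inUpper
  toFun :=
    { toFun := fun u => (T ⟨inUpper u.1, u.2⟩).fst
      map_add' := fun u v => by
        rw [← WithLp.add_fst, ← LinearPMap.map_add]
        congr 2
        exact Subtype.ext (map_add inUpper u.1 v.1)
      map_smul' := fun c u => by
        rw [RingHom.id_apply, ← WithLp.smul_fst, ← LinearPMap.map_smul]
        congr 2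
        exact Subtype.ext (map_smul inUpper c u.1) }

/-- The lower right entry of an operator on spinors: `v ↦ (T (0, v))₂`, where `(0, v) ∈ dom T`. -/
def lowerEntry (T : Spinor →ₗ.[ℂ] Spinor) : L2 →ₗ.[ℂ] L2 where
  domain := T.domain.comap inLower
  toFun :=
    { toFun := fun v => (T ⟨inLower v.1, v.2⟩).snd
      map_add' := fun u v => by
        rw [← WithLp.add_snd, ← LinearPMap.map_add]
        congr 2
        exact Subtype.ext (map_add inLower u.1 v.1)
      map_smul' := fun c u => by
        rw [RingHom.id_apply, ← WithLp.smul_snd, ← LinearPMap.map_smul]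
        congr 2
        exact Subtype.ext (map_smul inLower c u.1) }

/-- The Dirac operator with mass profile `m = tanh`. -/
def tanhDirac (ε : ℝ) : Spinor →ₗ.[ℂ] Spinor := diracOp Real.tanh ε

/-- The squared Dirac operator `D_ε²` with mass profile `m = tanh`. -/
def tanhDiracSq (ε : ℝ) : Spinor →ₗ.[ℂ] Spinor := sq (tanhDirac ε)

/-- `λ_k⁽⁺⁾ = 1 - (1 - ε k)²` -/
def lamPlus (ε : ℝ) (k : ℕ) : ℝ := 1 - (1 - ε * k) ^ 2

/-- `λ_k⁽⁻⁾ = 1 - (1 - ε (k + 1))²` -/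
def lamMinus (ε : ℝ) (k : ℕ) : ℝ := 1 - (1 - ε * (k + 1)) ^ 2

end DiracTanh

end

/-! With A_c = c tanh + ε∂ and B_c = c tanh − ε∂ = A_c*, the Dirac operator is the matrix [[0, B_1],
[A_1, 0]] and its square is diag(B_1 A_1, A_1 B_1). For a free parameter c > 0 one has B_c A_c = c²
− c(c+ε) sech² − ε²∂² and A_c B_c = c² − c(c−ε) sech² − ε²∂², so A_c B_c is B_{c−ε} A_{c−ε} plus the
constant c² − (c−ε)² (`shape_invariance`). The products AB and BA agree spectrally away from 0
(`AdjPair.nonempty_equiv` for eigenvectors, `AdjPair.bddBelowAt_of_isReg` for resolvents), so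
knowledge about c − ε passes to c. The only new eigenvalue is 0, with kernel spanned by cosh^(−c/ε)
(`finrank_eigen_zero`). This produces the list c² − (c − εk)², εk < c.

The descent ends at 0 < c ≤ ε, where A_c B_c has the repulsive potential c(ε−c) sech². There ‖B_c v‖
≥ c‖v‖ (`norm_le_of_mem_aGraph`) gives the spectral gap, and a virial identity
(`eq_zero_of_repulsive`) excludes all eigenvalues, embedded ones included. The two inductions are
`isReg_diracRel` and `eigen_relComp`. All of [1, ∞) is spectrum because wave packets can be moved
out to +∞, where sech² is negligible (`not_bddBelowAt_of_one_le`).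

Operators are handled through their graphs, as linear relations, so that products carry their
natural domains. Self-adjointness rests on the skew-adjointness of ∂ on H¹ (`weakDeriv_skew`), which
comes from a deficiency argument: u' = ±u has no nonzero solution in L². -/

noncomputable section

namespace DiracTanh

open scoped InnerProductSpace BoundedContinuousFunction

/-! ### Linear relations -/

section Relations

variable {E : Type*} [NormedAddCommGroup E] [NormedSpace ℂ E]

/-- The eigenspace of a linear relation. -/
def eigen (G : Submodule ℂ (E × E)) (z : ℂ) : Submodule ℂ E :=
  G.comap (LinearMap.id.prod (z • LinearMap.id))

lemma mem_eigen {G : Submodule ℂ (E × E)} {z : ℂ} {x : E} : x ∈ eigen G z ↔ (x, z • x) ∈ G :=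
  Iff.rfl

lemma eigenspace_eq (T : E →ₗ.[ℂ] E) (z : ℂ) : eigenspace T z = eigen T.graph z := rfl

/-- `G - z` is bounded below with constant `C⁻¹`. -/
def BddBelowAt (G : Submodule ℂ (E × E)) (z : ℂ) : Prop :=
  ∃ C : ℝ, ∀ x y, (x, y) ∈ G → ‖x‖ ≤ C * ‖y - z • x‖

/-- `G - z` is bounded below and onto. -/
def IsReg (G : Submodule ℂ (E × E)) (z : ℂ) : Prop :=
  BddBelowAt G z ∧ ∀ y, ∃ x, (x, y + z • x) ∈ G

lemma BddBelowAt.exists_pos {G : Submodule ℂ (E × E)} {z : ℂ} (h : BddBelowAt G z) :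
    ∃ C : ℝ, 0 < C ∧ ∀ x y, (x, y) ∈ G → ‖x‖ ≤ C * ‖y - z • x‖ := by
  obtain ⟨C, hC⟩ := h
  refine ⟨max C 1, by positivity, fun x y hxy => (hC x y hxy).trans ?_⟩
  gcongr
  exact le_max_left _ _

lemma BddBelowAt.eigen_eq_bot {G : Submodule ℂ (E × E)} {z : ℂ} (h : BddBelowAt G z) :
    eigen G z = ⊥ := by
  obtain ⟨C, hC⟩ := h
  rw [Submodule.eq_bot_iff]
  intro x hx
  have := hC x _ hx
  simpa using this

/-- The lower bound makes T − z injective and is at the same time the operator bound of the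
algebraic inverse, so neither closedness nor completeness is needed. -/
lemma mem_resolventSet_iff {T : E →ₗ.[ℂ] E} {z : ℂ} :
    z ∈ resolventSet T ↔ IsReg T.graph z := by
  constructor
  · rintro ⟨R, h1, h2⟩
    refine ⟨⟨‖R‖, ?_⟩, fun y => ⟨R y, ?_⟩⟩
    · intro x y hxy
      obtain ⟨u, rfl, rfl⟩ := LinearPMap.mem_graph_iff _ |>.1 hxy
      calc ‖(u : E)‖ = ‖R (T u - z • (u : E))‖ := by rw [h2]
        _ ≤ _ := R.le_opNorm _
    · obtain ⟨h, hy⟩ := h1 y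
      rw [LinearPMap.mem_graph_iff]
      exact ⟨⟨R y, h⟩, rfl, by rw [← sub_eq_iff_eq_add]; exact hy⟩
  · rintro ⟨⟨C, hC⟩, hs⟩
    let f : T.domain →ₗ[ℂ] E := T.toFun - z • T.domain.subtype
    have hf : ∀ x, f x = T x - z • (x : E) := fun x => rfl
    have hb : ∀ x : T.domain, ‖(x : E)‖ ≤ C * ‖f x‖ := fun x => by
      rw [hf]; exact hC _ _ (T.mem_graph x)
    have hbij : Function.Bijective f := by
      constructor
      · rw [injective_iff_map_eq_zero]
        intro x hx
        have := hb x
        rw [hx, norm_zero, mul_zero] at this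
        exact Subtype.ext (norm_le_zero_iff.1 this)
      · intro y
        obtain ⟨x, hx⟩ := hs y
        obtain ⟨u, rfl, hu⟩ := LinearPMap.mem_graph_iff _ |>.1 hx
        exact ⟨u, by rw [hf, hu, add_sub_cancel_right]⟩
    let e := LinearEquiv.ofBijective f hbij
    have he : ∀ y, f (e.symm y) = y := fun y => e.apply_symm_apply y
    refine ⟨(T.domain.subtype ∘ₗ e.symm.toLinearMap).mkContinuous C fun y => ?_, fun y => ?_,
      fun x => ?_⟩
    · have := hb (e.symm y)
      rwa [he] at this
    · exact ⟨(e.symm y).2, he y⟩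
    · exact congrArg Subtype.val (e.symm_apply_apply x)

lemma mem_spectrum_iff {T : E →ₗ.[ℂ] E} {z : ℂ} : z ∈ spectrum T ↔ ¬ IsReg T.graph z := by
  rw [spectrum, Set.mem_compl_iff, mem_resolventSet_iff]

lemma mem_eigenvalues_iff {T : E →ₗ.[ℂ] E} {z : ℂ} :
    z ∈ eigenvalues T ↔ eigen T.graph z ≠ ⊥ := Iff.rfl

lemma eigenvalues_subset_spectrum (T : E →ₗ.[ℂ] E) : eigenvalues T ⊆ spectrum T := by
  intro z hz
  rw [mem_spectrum_iff]
  exact fun h => hz h.1.eigen_eq_bot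

/-- The composition of linear relations: first `G`, then `K`. -/
def relComp (K G : Submodule ℂ (E × E)) : Submodule ℂ (E × E) where
  carrier := {p | ∃ k, (p.1, k) ∈ G ∧ (k, p.2) ∈ K}
  zero_mem' := ⟨0, G.zero_mem, K.zero_mem⟩
  add_mem' := by
    rintro p q ⟨k, h1, h2⟩ ⟨l, h3, h4⟩
    exact ⟨k + l, G.add_mem h1 h3, K.add_mem h2 h4⟩
  smul_mem' := by
    rintro c p ⟨k, h1, h2⟩
    exact ⟨c • k, G.smul_mem c h1, K.smul_mem c h2⟩

lemma mem_relComp {K G : Submodule ℂ (E × E)} {x y : E} :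
    (x, y) ∈ relComp K G ↔ ∃ k, (x, k) ∈ G ∧ (k, y) ∈ K := Iff.rfl

lemma sq_graph (T : E →ₗ.[ℂ] E) : (sq T).graph = relComp T.graph T.graph := by
  ext ⟨x, y⟩
  rw [mem_relComp, LinearPMap.mem_graph_iff]
  constructor
  · rintro ⟨⟨_, u, hu, rfl⟩, rfl, rfl⟩
    exact ⟨T u, T.mem_graph u, T.mem_graph ⟨T u, hu⟩⟩
  · rintro ⟨k, h1, h2⟩
    obtain ⟨u, rfl, rfl⟩ := LinearPMap.mem_graph_iff _ |>.1 h1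
    obtain ⟨v, hv, rfl⟩ := LinearPMap.mem_graph_iff _ |>.1 h2
    have hu : u ∈ T.domain.comap T.toFun := by
      change T u ∈ T.domain
      have hv' : (v : E) = T u := hv
      rw [← hv']
      exact v.2
    refine ⟨⟨u, u, hu, rfl⟩, rfl, ?_⟩
    change T ⟨T u, hu⟩ = T v
    congr 1
    exact Subtype.ext hv.symm

/-- G² − w² = (G + w)(G − w): lower bounds multiply and solutions are found one factor at a time. -/
lemma IsReg.relComp_self {G : Submodule ℂ (E × E)} {w : ℂ} (h : IsReg G w) (h' : IsReg G (-w)) :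
    IsReg (relComp G G) (w ^ 2) := by
  obtain ⟨hb, hs⟩ := h
  obtain ⟨C, hC, hb⟩ := hb.exists_pos
  obtain ⟨⟨C', hb'⟩, hs'⟩ := h'
  refine ⟨⟨C * |C'|, ?_⟩, ?_⟩
  · rintro x y ⟨k, h1, h2⟩
    have e1 := hb x k h1
    have e2 := hb' (k - w • x) (y - w • k) (G.sub_mem h2 (G.smul_mem w h1))
    have e3 : y - w • k - -w • (k - w • x) = y - w ^ 2 • x := by
      module
    rw [e3] at e2
    calc ‖x‖ ≤ C * ‖k - w • x‖ := e1
      _ ≤ C * (C' * ‖y - w ^ 2 • x‖) := by gcongr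
      _ ≤ C * (|C'| * ‖y - w ^ 2 • x‖) := by gcongr; exact le_abs_self _
      _ = _ := by ring
  · intro y
    obtain ⟨k, hk⟩ := hs' y
    obtain ⟨x, hx⟩ := hs k
    refine ⟨x, k + w • x, hx, ?_⟩
    have := G.add_mem hk (G.smul_mem w hx)
    convert this using 1
    ext
    · simp
    · simp only [Prod.snd_add, Prod.smul_snd]
      module

end Relations

/-! ### Self-adjoint relations in Hilbert spaces -/

section Hilbert

variable {E : Type*} [NormedAddCommGroup E] [InnerProductSpace ℂ E]

/-- A relation that is its own adjoint. -/
def IsSA (G : Submodule ℂ (E × E)) : Prop :=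
  ∀ p : E × E, p ∈ G ↔ ∀ q ∈ G, ⟪q.2, p.1⟫_ℂ = ⟪q.1, p.2⟫_ℂ

/-- Closed range argument on the graph, a complete space: q ↦ q.2 − w q.1 is bounded below in the
graph norm, so its range is closed, and `hd` says that the range has trivial orthogonal complement.
-/
lemma surjective_of_bddBelow [CompleteSpace E] {G : Submodule ℂ (E × E)} {w : ℂ}
    (hcl : IsClosed (G : Set (E × E))) (hb : BddBelowAt G w)
    (hd : ∀ v, (∀ q ∈ G, ⟪q.2 - w • q.1, v⟫_ℂ = 0) → v = 0) (f : E) :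
    ∃ x, (x, f + w • x) ∈ G := by
  obtain ⟨C, hC, hb⟩ := hb.exists_pos
  have : CompleteSpace G := hcl.completeSpace_coe
  let L : G →L[ℂ] E := (ContinuousLinearMap.snd ℂ E E - w • ContinuousLinearMap.fst ℂ E E).comp
    G.subtypeL
  have hL : ∀ q : G, L q = q.1.2 - w • q.1.1 := fun q => rfl
  -- The graph norm is a maximum; C bounds the first coordinate and 1 + ‖w‖C the second, and their
  -- sum serves for both.
  have hanti : AntilipschitzWith (Real.toNNReal (C + 1 + ‖w‖ * C)) L := by
    apply AddMonoidHomClass.antilipschitz_of_bound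
    intro q
    have h1 := hb q.1.1 q.1.2 q.2
    rw [← hL] at h1
    have h2 : ‖q.1.2‖ ≤ ‖L q‖ + ‖w‖ * ‖q.1.1‖ := by
      rw [← norm_smul, hL]
      exact norm_le_norm_sub_add _ _
    rw [Real.coe_toNNReal _ (by positivity)]
    have h3 : ‖w‖ * ‖q.1.1‖ ≤ ‖w‖ * (C * ‖L q‖) := by gcongr
    have h0 := norm_nonneg (L q)
    have h4 : 0 ≤ ‖w‖ * (C * ‖L q‖) := by positivity
    have h5 : 0 ≤ C * ‖L q‖ := by positivity
    calc ‖q‖ = max ‖q.1.1‖ ‖q.1.2‖ := rfl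
      _ ≤ (C + 1 + ‖w‖ * C) * ‖L q‖ := by
        apply max_le <;> nlinarith
  have hclosed : IsClosed (L.range : Set E) := by
    exact hanti.isClosed_range L.uniformContinuous
  have htop : L.range = ⊤ := by
    have : CompleteSpace L.range := hclosed.completeSpace_coe
    rw [← Submodule.orthogonal_eq_bot_iff, Submodule.eq_bot_iff]
    intro v hv
    apply hd
    intro q hq
    exact (Submodule.mem_orthogonal _ _).1 hv _ ⟨⟨q, hq⟩, rfl⟩
  have : f ∈ L.range := htop ▸ Submodule.mem_top
  obtain ⟨q, hq⟩ := this
  refine ⟨q.1.1, ?_⟩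
  have e : f + w • q.1.1 = q.1.2 := by
    rw [← hq]
    change q.1.2 - w • q.1.1 + w • q.1.1 = q.1.2
    abel
  rw [e]
  exact q.2

lemma IsSA.isClosed {G : Submodule ℂ (E × E)} (h : IsSA G) : IsClosed (G : Set (E × E)) := by
  have : (G : Set (E × E)) = ⋂ q ∈ G, {p | ⟪q.2, p.1⟫_ℂ = ⟪q.1, p.2⟫_ℂ} := by
    ext p
    simp only [SetLike.mem_coe, Set.mem_iInter, Set.mem_ofPred_eq]
    exact h p
  rw [this]
  exact isClosed_biInter fun q _ => isClosed_eq (by fun_prop) (by fun_prop)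

/-- A vector orthogonal to the range of G − w is an eigenvector of G at the conjugate of w, which
the second bound forbids. -/
lemma IsSA.isReg [CompleteSpace E] {G : Submodule ℂ (E × E)} (h : IsSA G) {w : ℂ}
    (hb : BddBelowAt G w) (hb' : BddBelowAt G (star w)) : IsReg G w := by
  refine ⟨hb, surjective_of_bddBelow h.isClosed hb fun v hv => ?_⟩
  have hmem : (v, star w • v) ∈ G := by
    rw [h]
    intro q hq
    have := hv q hq
    rw [inner_sub_left, inner_smul_left, sub_eq_zero] at this
    rw [this, inner_smul_right]
    rfl
  have := hb'.eigen_eq_bot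
  rw [Submodule.eq_bot_iff] at this
  exact this v hmem

/-- ⟪x, Gx⟫ is real, so the imaginary part of ⟪x, (G − w)x⟫ is −(Im w)‖x‖². -/
lemma IsSA.bddBelowAt_of_im_ne_zero {G : Submodule ℂ (E × E)} (h : IsSA G) {w : ℂ}
    (hw : w.im ≠ 0) : BddBelowAt G w := by
  refine ⟨|w.im|⁻¹, fun x y hxy => ?_⟩
  have h1 := (h _).1 hxy _ hxy
  simp only at h1
  have h2 : (⟪x, y⟫_ℂ).im = 0 := by
    have := congrArg Complex.im (inner_conj_symm (𝕜 := ℂ) x y)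
    rw [Complex.conj_im, h1] at this
    linarith
  have h3 : (⟪x, y - w • x⟫_ℂ).im = - (w.im * ‖x‖ ^ 2) := by
    rw [inner_sub_right, inner_smul_right, inner_self_eq_norm_sq_to_K, Complex.sub_im, h2]
    have : ((RCLike.ofReal ‖x‖ : ℂ)) ^ 2 = ((‖x‖ ^ 2 : ℝ) : ℂ) := by push_cast; rfl
    rw [this, Complex.im_mul_ofReal]
    ring
  have h4 : |w.im| * ‖x‖ ^ 2 ≤ ‖x‖ * ‖y - w • x‖ := by
    calc |w.im| * ‖x‖ ^ 2 = |(⟪x, y - w • x⟫_ℂ).im| := by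
          rw [h3, abs_neg, abs_mul, abs_of_nonneg (sq_nonneg ‖x‖)]
      _ ≤ ‖⟪x, y - w • x⟫_ℂ‖ := Complex.abs_im_le_norm _
      _ ≤ _ := norm_inner_le_norm _ _
  have hpos : 0 < |w.im| := abs_pos.2 hw
  rw [inv_mul_eq_div, le_div_iff₀ hpos]
  rcases (norm_nonneg x).eq_or_lt with h0 | h0
  · rw [← h0]; simp
  · nlinarith

/-- If `W` is the negative adjoint of a skew relation `G₀` and has no eigenvalues `±1`, then `W` is
skew. -/
lemma skew_of_deficiency [CompleteSpace E] {G₀ W : Submodule ℂ (E × E)}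
    (hskew : ∀ p ∈ G₀, ∀ q ∈ G₀, ⟪q.2, p.1⟫_ℂ = -⟪q.1, p.2⟫_ℂ)
    (hW : ∀ p : E × E, p ∈ W ↔ ∀ q ∈ G₀, ⟪q.2, p.1⟫_ℂ = -⟪q.1, p.2⟫_ℂ)
    (h1 : eigen W 1 = ⊥) (h2 : eigen W (-1) = ⊥) :
    ∀ p ∈ W, ∀ q ∈ W, ⟪q.2, p.1⟫_ℂ = -⟪q.1, p.2⟫_ℂ := by
  have hGW : G₀ ≤ W := fun p hp => (hW p).2 fun q hq => hskew p hp q hq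
  have hcl : IsClosed (W : Set (E × E)) := by
    have : (W : Set (E × E)) = ⋂ q ∈ G₀, {p | ⟪q.2, p.1⟫_ℂ = -⟪q.1, p.2⟫_ℂ} := by
      ext p
      simp only [SetLike.mem_coe, Set.mem_iInter, Set.mem_ofPred_eq]
      exact hW p
    rw [this]
    exact isClosed_biInter fun q _ => isClosed_eq (by fun_prop) (by fun_prop)
  let G := G₀.topologicalClosure
  have hG₀G : G₀ ≤ G := G₀.le_topologicalClosure
  have hG : G ≤ W := G₀.topologicalClosure_minimal hGW hcl
  have hs1 : ∀ p ∈ W, ∀ q ∈ G, ⟪q.2, p.1⟫_ℂ = -⟪q.1, p.2⟫_ℂ := by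
    intro p hp q hq
    have hc : IsClosed {q : E × E | ⟪q.2, p.1⟫_ℂ = -⟪q.1, p.2⟫_ℂ} :=
      isClosed_eq (by fun_prop) (by fun_prop)
    have hsub : (G₀ : Set (E × E)) ⊆ {q : E × E | ⟪q.2, p.1⟫_ℂ = -⟪q.1, p.2⟫_ℂ} :=
      fun q hq => (hW p).1 hp q hq
    exact closure_minimal hsub hc hq
  -- Skewness makes x and y orthogonal in real part, whence ‖x + y‖² = ‖x‖² + ‖y‖².
  have hbb : BddBelowAt G (-1) := by
    refine ⟨1, fun x y hxy => ?_⟩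
    have e := hs1 _ (hG hxy) _ hxy
    simp only at e
    have e2 : (⟪x, y⟫_ℂ).re = 0 := by
      have := congrArg Complex.re (inner_conj_symm (𝕜 := ℂ) x y)
      rw [Complex.conj_re, e, Complex.neg_re] at this
      linarith
    have e3 : ‖x + y‖ ^ 2 = ‖x‖ ^ 2 + ‖y‖ ^ 2 := by
      rw [norm_add_sq (𝕜 := ℂ)]
      change _ + 2 * (⟪x, y⟫_ℂ).re + _ = _
      rw [e2]; ring
    have e4 : y - (-1 : ℂ) • x = x + y := by module
    rw [one_mul, e4]
    apply le_of_sq_le_sq _ (norm_nonneg _)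
    rw [e3]
    nlinarith [sq_nonneg ‖y‖]
  -- A vector orthogonal to the range of G + 1 is an eigenvector of W at 1.
  have hsurj := surjective_of_bddBelow (G := G) (w := -1) G₀.isClosed_topologicalClosure hbb (by
    intro v hv
    have : v ∈ eigen W 1 := by
      rw [mem_eigen, hW]
      intro q hq
      have := hv q (hG₀G hq)
      rw [inner_sub_left, inner_smul_left, sub_eq_zero] at this
      simp only [this, one_smul, map_neg, map_one, neg_mul, one_mul]
    rw [h1] at this
    exact this)
  -- Solving (G + 1)x = u + u' in G, the difference of (u, u') and the solution is an eigenvector of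
  -- W at −1, hence zero. So W is the closure of `G₀`.
  have hWG : W ≤ G := by
    rintro ⟨u, u'⟩ hu
    obtain ⟨x, hx⟩ := hsurj (u + u')
    have : u - x ∈ eigen W (-1) := by
      rw [mem_eigen]
      have := W.sub_mem hu (hG hx)
      convert this using 1
      ext
      · rfl
      · simp only [Prod.snd_sub]; module
    rw [h2, Submodule.mem_bot, sub_eq_zero] at this
    subst this
    convert hx using 2
    module
  intro p hp q hq
  exact hs1 p hp q (hWG hq)

/-! ### Adjoint pairs and operator matrices. -/

/-- `B` is the adjoint of `A` and vice versa. -/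
structure AdjPair (A B : Submodule ℂ (E × E)) : Prop where
  right : ∀ p : E × E, p ∈ B ↔ ∀ q ∈ A, ⟪q.2, p.1⟫_ℂ = ⟪q.1, p.2⟫_ℂ
  left : ∀ p : E × E, p ∈ A ↔ ∀ q ∈ B, ⟪q.2, p.1⟫_ℂ = ⟪q.1, p.2⟫_ℂ

namespace AdjPair

variable {A B : Submodule ℂ (E × E)}

lemma symm (h : AdjPair A B) : AdjPair B A := ⟨h.left, h.right⟩

lemma inner_eq (h : AdjPair A B) {u v f g : E} (hu : (u, f) ∈ A) (hv : (v, g) ∈ B) :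
    ⟪f, v⟫_ℂ = ⟪u, g⟫_ℂ := (h.right _).1 hv _ hu

lemma inner_eq' (h : AdjPair A B) {u v f g : E} (hu : (u, f) ∈ A) (hv : (v, g) ∈ B) :
    ⟪v, f⟫_ℂ = ⟪g, u⟫_ℂ := (h.symm.inner_eq hv hu).symm

end AdjPair

/-- The relation of the operator matrix `[[0, B], [A, 0]]`. -/
def diracRel (A B : Submodule ℂ (E × E)) : Submodule ℂ (WithLp 2 (E × E) × WithLp 2 (E × E)) where
  carrier := {p | (p.1.fst, p.2.snd) ∈ A ∧ (p.1.snd, p.2.fst) ∈ B}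
  zero_mem' := ⟨A.zero_mem, B.zero_mem⟩
  add_mem' := fun h h' => ⟨A.add_mem h.1 h'.1, B.add_mem h.2 h'.2⟩
  smul_mem' := fun c _ h => ⟨A.smul_mem c h.1, B.smul_mem c h.2⟩

/-- The relation of the operator matrix `[[A, 0], [0, B]]`. -/
def diagRel (A B : Submodule ℂ (E × E)) : Submodule ℂ (WithLp 2 (E × E) × WithLp 2 (E × E)) where
  carrier := {p | (p.1.fst, p.2.fst) ∈ A ∧ (p.1.snd, p.2.snd) ∈ B}
  zero_mem' := ⟨A.zero_mem, B.zero_mem⟩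
  add_mem' := fun h h' => ⟨A.add_mem h.1 h'.1, B.add_mem h.2 h'.2⟩
  smul_mem' := fun c _ h => ⟨A.smul_mem c h.1, B.smul_mem c h.2⟩

variable {A B : Submodule ℂ (E × E)}

lemma mem_diracRel {p : WithLp 2 (E × E) × WithLp 2 (E × E)} :
    p ∈ diracRel A B ↔ (p.1.fst, p.2.snd) ∈ A ∧ (p.1.snd, p.2.fst) ∈ B := Iff.rfl

lemma relComp_diracRel :
    relComp (diracRel A B) (diracRel A B) = diagRel (relComp B A) (relComp A B) := by
  ext ⟨x, y⟩
  constructor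
  · rintro ⟨k, ⟨h1, h2⟩, h3, h4⟩
    exact ⟨⟨k.snd, h1, h4⟩, k.fst, h2, h3⟩
  · rintro ⟨⟨k, h1, h2⟩, l, h3, h4⟩
    exact ⟨WithLp.toLp 2 (l, k), ⟨h1, h3⟩, h4, h2⟩

/-- For the converse inclusion, test vectors with a single nonzero component separate the two
adjointness conditions. -/
lemma AdjPair.isSA (h : AdjPair A B) : IsSA (diracRel A B) := by
  intro p
  constructor
  · rintro ⟨hA, hB⟩ q ⟨hA', hB'⟩
    rw [WithLp.prod_inner_apply, WithLp.prod_inner_apply]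
    change ⟪q.2.fst, p.1.fst⟫_ℂ + ⟪q.2.snd, p.1.snd⟫_ℂ = ⟪q.1.fst, p.2.fst⟫_ℂ + ⟪q.1.snd, p.2.snd⟫_ℂ
    rw [h.symm.inner_eq hB' hA, h.inner_eq hA' hB, add_comm]
  · intro hp
    constructor
    · rw [h.left]
      intro q hq
      have := hp (WithLp.toLp 2 (0, q.1), WithLp.toLp 2 (q.2, 0)) ⟨A.zero_mem, hq⟩
      simpa [WithLp.prod_inner_apply] using this
    · rw [h.right]
      intro q hq
      have := hp (WithLp.toLp 2 (q.1, 0), WithLp.toLp 2 (0, q.2)) ⟨hq, B.zero_mem⟩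
      simpa [WithLp.prod_inner_apply] using this

lemma IsReg.of_diagRel {z : ℂ} (h : IsReg (diagRel A B) z) : IsReg A z ∧ IsReg B z := by
  obtain ⟨⟨C, hC⟩, hs⟩ := h
  have key : ∀ (a b : E), ‖WithLp.toLp 2 (a, b)‖ = √(‖a‖ ^ 2 + ‖b‖ ^ 2) := fun a b => by
    rw [WithLp.prod_norm_eq_of_L2]
    rfl
  refine ⟨⟨⟨C, fun x y hxy => ?_⟩, fun y => ?_⟩, ⟨⟨C, fun x y hxy => ?_⟩, fun y => ?_⟩⟩
  · have := hC (WithLp.toLp 2 (x, 0)) (WithLp.toLp 2 (y, 0)) ⟨hxy, B.zero_mem⟩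
    rw [← WithLp.toLp_smul, ← WithLp.toLp_sub, Prod.smul_mk, Prod.mk_sub_mk, smul_zero,
      sub_zero, key, key] at this
    simpa [Real.sqrt_sq] using this
  · obtain ⟨x, hx, -⟩ := hs (WithLp.toLp 2 (y, 0))
    exact ⟨x.fst, hx⟩
  · have := hC (WithLp.toLp 2 (0, x)) (WithLp.toLp 2 (0, y)) ⟨A.zero_mem, hxy⟩
    rw [← WithLp.toLp_smul, ← WithLp.toLp_sub, Prod.smul_mk, Prod.mk_sub_mk, smul_zero,
      sub_zero, key, key] at this
    simpa [Real.sqrt_sq] using this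
  · obtain ⟨x, -, hx⟩ := hs (WithLp.toLp 2 (0, y))
    exact ⟨x.snd, hx⟩

/-- Conjugation by diag(1, −1) turns D into −D, hence D − w into −(D + w). -/
lemma IsReg.chiral {w : ℂ} (h : IsReg (diracRel A B) w) : IsReg (diracRel A B) (-w) := by
  obtain ⟨⟨C, hC⟩, hs⟩ := h
  have key : ∀ (a : WithLp 2 (E × E)), ‖a‖ = √(‖a.fst‖ ^ 2 + ‖a.snd‖ ^ 2) := fun a => by
    rw [WithLp.prod_norm_eq_of_L2]
  constructor
  · refine ⟨C, ?_⟩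
    rintro x y ⟨h1, h2⟩
    have := hC (WithLp.toLp 2 (x.fst, -x.snd)) (WithLp.toLp 2 (-y.fst, y.snd))
      ⟨h1, B.neg_mem h2⟩
    rw [key, key] at this
    rw [key x, key (y - -w • x)]
    have e1 : ‖(y - -w • x).fst‖ = ‖-y.fst - w • x.fst‖ := by
      rw [← norm_neg, WithLp.sub_fst, WithLp.smul_fst]
      congr 1
      module
    have e2 : ‖(y - -w • x).snd‖ = ‖y.snd - w • -x.snd‖ := by
      rw [WithLp.sub_snd, WithLp.smul_snd]
      congr 1
      module
    rw [e1, e2]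
    change √(‖x.fst‖ ^ 2 + ‖-x.snd‖ ^ 2) ≤ _ at this
    rw [norm_neg] at this
    exact this
  · intro y
    obtain ⟨x, h1, h2⟩ := hs (WithLp.toLp 2 (-y.fst, y.snd))
    refine ⟨WithLp.toLp 2 (x.fst, -x.snd), ?_, ?_⟩
    · change (x.fst, y.snd + -w • -x.snd) ∈ A
      have e : y.snd + -w • -x.snd = y.snd + w • x.snd := by module
      rw [e]
      exact h1
    · have e : y.fst + -w • x.fst = -(-y.fst + w • x.fst) := by module
      change (-x.snd, y.fst + -w • x.fst) ∈ B
      rw [e]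
      exact B.neg_mem h2

lemma IsReg.relComp_of_diracRel {w : ℂ} (h : IsReg (diracRel A B) w) :
    IsReg (diagRel (relComp B A) (relComp A B)) (w ^ 2) := by
  rw [← relComp_diracRel]
  exact h.relComp_self h.chiral

end Hilbert

/-! ### Norm comparisons for pairs. -/

section Norm

variable {E : Type*} [NormedAddCommGroup E]

lemma norm_fst_le (p : WithLp 2 (E × E)) : ‖p.fst‖ ≤ ‖p‖ := by
  apply le_of_sq_le_sq _ (norm_nonneg _)
  rw [WithLp.prod_norm_sq_eq_of_L2]
  nlinarith [sq_nonneg ‖p.snd‖]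

lemma norm_snd_le (p : WithLp 2 (E × E)) : ‖p.snd‖ ≤ ‖p‖ := by
  apply le_of_sq_le_sq _ (norm_nonneg _)
  rw [WithLp.prod_norm_sq_eq_of_L2]
  nlinarith [sq_nonneg ‖p.fst‖]

lemma norm_le_add (p : WithLp 2 (E × E)) : ‖p‖ ≤ ‖p.fst‖ + ‖p.snd‖ := by
  apply le_of_sq_le_sq _ (by positivity)
  rw [WithLp.prod_norm_sq_eq_of_L2]
  nlinarith [mul_nonneg (norm_nonneg p.fst) (norm_nonneg p.snd)]

end Norm

/-! ### Transfer of bounds and eigenvectors between AB, BA and the Dirac matrix. -/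

section Supersymmetry

variable {E : Type*} [NormedAddCommGroup E] [InnerProductSpace ℂ E] {A B : Submodule ℂ (E × E)}

/-- A bound on the lower component controls the upper component. -/
lemma AdjPair.bddBelowAt_of_snd (h : AdjPair A B) {w : ℝ} (hw : w ≠ 0) {M : ℝ} (hM : 0 ≤ M)
    (hb : ∀ x y, (x, y) ∈ diracRel A B → ‖x.snd‖ ≤ M * ‖y - (w : ℂ) • x‖) :
    BddBelowAt (diracRel A B) w := by
  have hw' : 0 < |w| := abs_pos.2 hw
  refine ⟨(1 + M + |w| * M ^ 2) / |w| + 1 + M, fun x y hxy => ?_⟩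
  have hv := hb x y hxy
  obtain ⟨hA, hB⟩ := hxy
  simp only at hA hB
  set N := ‖y - (w : ℂ) • x‖ with hN
  have hN0 : 0 ≤ N := norm_nonneg _
  have hF : ‖y.fst - (w : ℂ) • x.fst‖ ≤ N := norm_fst_le (y - (w : ℂ) • x)
  have hG : ‖y.snd - (w : ℂ) • x.snd‖ ≤ N := norm_snd_le (y - (w : ℂ) • x)
  -- Pair the second row of (D − w)x with the lower component and the first row with the upper one;
  -- adjointness cancels the terms containing A and B.
  have e : (w : ℂ) * ⟪x.fst, x.fst⟫_ℂ = ⟪y.snd - (w : ℂ) • x.snd, x.snd⟫_ℂ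
      + (w : ℂ) * ⟪x.snd, x.snd⟫_ℂ - ⟪x.fst, y.fst - (w : ℂ) • x.fst⟫_ℂ := by
    rw [inner_sub_left, inner_sub_right, inner_smul_left, inner_smul_right, h.inner_eq hA hB,
      Complex.conj_ofReal]
    ring
  have e2 : |w| * ‖x.fst‖ ^ 2 ≤ N * (M * N) + |w| * (M * N) ^ 2 + ‖x.fst‖ * N := by
    have e3 : ‖(w : ℂ) * ⟪x.fst, x.fst⟫_ℂ‖ = |w| * ‖x.fst‖ ^ 2 := by
      rw [norm_mul, Complex.norm_real, Real.norm_eq_abs, inner_self_eq_norm_sq_to_K]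
      simp
    have e4 : ‖(w : ℂ) * ⟪x.snd, x.snd⟫_ℂ‖ = |w| * ‖x.snd‖ ^ 2 := by
      rw [norm_mul, Complex.norm_real, Real.norm_eq_abs, inner_self_eq_norm_sq_to_K]
      simp
    rw [← e3, e]
    refine (norm_sub_le _ _).trans (add_le_add ((norm_add_le _ _).trans (add_le_add ?_ ?_)) ?_)
    · exact (norm_inner_le_norm _ _).trans (mul_le_mul hG hv (norm_nonneg _) hN0)
    · rw [e4]
      gcongr
    · refine (norm_inner_le_norm _ _).trans ?_
      gcongr
  have e5 : ‖x.fst‖ ≤ ((1 + M + |w| * M ^ 2) / |w| + 1) * N := by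
    have hq : 0 ≤ (1 + M + |w| * M ^ 2) / |w| * N := by positivity
    rcases le_or_gt ‖x.fst‖ N with h1 | h1
    · linarith
    · have h2 : |w| * ‖x.fst‖ ≤ (1 + M + |w| * M ^ 2) * N := by
        have h3 : |w| * ‖x.fst‖ * ‖x.fst‖ ≤ (1 + M + |w| * M ^ 2) * N * ‖x.fst‖ := by
          have h4 : (M + |w| * M ^ 2) * N * N ≤ (M + |w| * M ^ 2) * N * ‖x.fst‖ := by gcongr
          nlinarith
        exact le_of_mul_le_mul_right h3 (hN0.trans_lt h1)
      have h5 : ‖x.fst‖ ≤ (1 + M + |w| * M ^ 2) / |w| * N := by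
        rw [div_mul_eq_mul_div, le_div_iff₀ hw']
        linarith
      linarith
  calc ‖x‖ ≤ ‖x.fst‖ + ‖x.snd‖ := norm_le_add x
    _ ≤ ((1 + M + |w| * M ^ 2) / |w| + 1) * N + M * N := add_le_add e5 hv
    _ = _ := by ring

/-- Duality argument. With v the lower component of x, solve (AB − w²)l = v and put k = Bl. Then
‖v‖² = ⟪k, F⟫ + w⟪l, G⟫, where F and G are the components of (D − w)x, and ‖l‖, ‖k‖ are controlled
by ‖v‖. -/
lemma AdjPair.bddBelowAt_of_isReg (h : AdjPair A B) {w : ℝ} (hw : w ≠ 0)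
    (hr : IsReg (relComp A B) ((w : ℂ) ^ 2)) : BddBelowAt (diracRel A B) w := by
  obtain ⟨hb, hs⟩ := hr
  obtain ⟨C, hC, hb⟩ := hb.exists_pos
  -- ‖k‖² = ⟪ABl, l⟫ ≤ (1 + w²C)C‖v‖², and K² dominates this factor without a square root.
  set K := 1 + w ^ 2 * C + C with hK
  have hK0 : 0 < K := by positivity
  refine h.bddBelowAt_of_snd hw (M := K + |w| * C) (by positivity) fun x y hxy => ?_
  obtain ⟨hA, hB⟩ := hxy
  simp only at hA hB
  set N := ‖y - (w : ℂ) • x‖ with hN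
  have hF : ‖y.fst - (w : ℂ) • x.fst‖ ≤ N := norm_fst_le (y - (w : ℂ) • x)
  have hG : ‖y.snd - (w : ℂ) • x.snd‖ ≤ N := norm_snd_le (y - (w : ℂ) • x)
  obtain ⟨l, hl⟩ := hs x.snd
  have hl' := hb _ _ hl
  rw [add_sub_cancel_right] at hl'
  obtain ⟨k, hk1, hk2⟩ := hl
  have hk : ‖k‖ ≤ K * ‖x.snd‖ := by
    apply le_of_sq_le_sq _ (by positivity)
    have e1 : ⟪x.snd + (w : ℂ) ^ 2 • l, l⟫_ℂ = ⟪k, k⟫_ℂ := h.inner_eq hk2 hk1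
    have e2 : ‖⟪k, k⟫_ℂ‖ = ‖k‖ ^ 2 := by
      rw [inner_self_eq_norm_sq_to_K]
      simp
    rw [← e2, ← e1]
    have e3 : ‖x.snd + (w : ℂ) ^ 2 • l‖ ≤ ‖x.snd‖ + w ^ 2 * (C * ‖x.snd‖) := by
      refine (norm_add_le _ _).trans ?_
      rw [norm_smul, norm_pow, Complex.norm_real, Real.norm_eq_abs, sq_abs]
      gcongr
    calc ‖⟪x.snd + (w : ℂ) ^ 2 • l, l⟫_ℂ‖ ≤ _ := norm_inner_le_norm _ _
      _ ≤ (‖x.snd‖ + w ^ 2 * (C * ‖x.snd‖)) * (C * ‖x.snd‖) := by gcongr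
      _ = (1 + w ^ 2 * C) * C * ‖x.snd‖ ^ 2 := by ring
      _ ≤ K ^ 2 * ‖x.snd‖ ^ 2 := by
        gcongr
        have : 0 ≤ w ^ 2 * C := by positivity
        nlinarith
      _ = _ := by ring
  have e : ⟪x.snd, x.snd⟫_ℂ = ⟪k, y.fst - (w : ℂ) • x.fst⟫_ℂ
      + w * ⟪l, y.snd - (w : ℂ) • x.snd⟫_ℂ := by
    have e1 : ⟪x.snd + (w : ℂ) ^ 2 • l, x.snd⟫_ℂ = ⟪k, y.fst⟫_ℂ := h.inner_eq hk2 hB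
    have e2 : ⟪l, y.snd⟫_ℂ = ⟪k, x.fst⟫_ℂ := h.inner_eq' hA hk1
    rw [inner_add_left, inner_smul_left, map_pow, Complex.conj_ofReal] at e1
    rw [inner_sub_right, inner_sub_right, inner_smul_right, inner_smul_right, ← e1, e2]
    ring
  have e2 : ‖⟪x.snd, x.snd⟫_ℂ‖ = ‖x.snd‖ ^ 2 := by
    rw [inner_self_eq_norm_sq_to_K]
    simp
  have e3 : ‖x.snd‖ ^ 2 ≤ K * ‖x.snd‖ * N + |w| * (C * ‖x.snd‖ * N) := by
    rw [← e2, e]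
    refine (norm_add_le _ _).trans (add_le_add ?_ ?_)
    · refine (norm_inner_le_norm _ _).trans ?_
      gcongr
    · rw [norm_mul, Complex.norm_real, Real.norm_eq_abs]
      gcongr
      refine (norm_inner_le_norm _ _).trans ?_
      gcongr
  rcases (norm_nonneg x.snd).eq_or_lt with h0 | h0
  · rw [← h0]
    positivity
  · nlinarith

/-- This is the bottom of the ladder. Eliminating the upper component u gives ‖Bv‖² = ⟪Bv, F⟫ + w⟪v,
G⟫ + w²‖v‖² with F, G the components of (D − w)x, and w²‖v‖² ≤ (w²/c²)‖Bv‖² is absorbed on the left.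
-/
lemma AdjPair.bddBelowAt_of_coercive (h : AdjPair A B) {w c : ℝ} (hw : w ≠ 0) (hwc : |w| < c)
    (hB : ∀ v k, (v, k) ∈ B → c * ‖v‖ ≤ ‖k‖) : BddBelowAt (diracRel A B) w := by
  have hc : 0 < c := (abs_nonneg w).trans_lt hwc
  refine h.bddBelowAt_of_snd hw (M := (c - |w|)⁻¹) (inv_nonneg.2 (sub_pos.2 hwc).le) ?_
  intro x y hxy
  obtain ⟨hA, hB'⟩ := hxy
  simp only at hA hB'
  set N := ‖y - (w : ℂ) • x‖ with hN
  have hF : ‖y.fst - (w : ℂ) • x.fst‖ ≤ N := norm_fst_le (y - (w : ℂ) • x)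
  have hG : ‖y.snd - (w : ℂ) • x.snd‖ ≤ N := norm_snd_le (y - (w : ℂ) • x)
  have hN0 : 0 ≤ N := norm_nonneg _
  have hv := hB _ _ hB'
  have e : ⟪y.fst, y.fst⟫_ℂ = ⟪y.fst, y.fst - (w : ℂ) • x.fst⟫_ℂ
      + w * ⟪x.snd, y.snd - (w : ℂ) • x.snd⟫_ℂ + (w : ℂ) ^ 2 * ⟪x.snd, x.snd⟫_ℂ := by
    have e2 : ⟪x.snd, y.snd⟫_ℂ = ⟪y.fst, x.fst⟫_ℂ := h.inner_eq' hA hB'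
    rw [inner_sub_right, inner_sub_right, inner_smul_right, inner_smul_right, e2]
    ring
  have e3 : ‖y.fst‖ ^ 2 ≤ ‖y.fst‖ * N + |w| * (‖x.snd‖ * N) + |w| ^ 2 * ‖x.snd‖ ^ 2 := by
    have e2 : ∀ a : E, ‖⟪a, a⟫_ℂ‖ = ‖a‖ ^ 2 := fun a => by
      rw [inner_self_eq_norm_sq_to_K]
      simp
    rw [← e2 y.fst, e]
    refine (norm_add_le _ _).trans (add_le_add ((norm_add_le _ _).trans (add_le_add ?_ ?_)) ?_)
    · refine (norm_inner_le_norm _ _).trans ?_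
      gcongr
    · rw [norm_mul, Complex.norm_real, Real.norm_eq_abs]
      gcongr
      refine (norm_inner_le_norm _ _).trans ?_
      gcongr
    · rw [norm_mul, norm_pow, Complex.norm_real, Real.norm_eq_abs, e2]
  have key : (c - |w|) * ‖y.fst‖ ≤ c * N := by
    rcases (norm_nonneg y.fst).eq_or_lt with h0 | h0
    · rw [← h0, mul_zero]; positivity
    · have h1 : c ^ 2 * ‖y.fst‖ ^ 2 ≤ c ^ 2 * (‖y.fst‖ * N) + |w| * c * (‖y.fst‖ * N)
          + |w| ^ 2 * ‖y.fst‖ ^ 2 := by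
        have i1 : c ^ 2 * (|w| * (‖x.snd‖ * N)) ≤ |w| * c * (‖y.fst‖ * N) := by
          calc c ^ 2 * (|w| * (‖x.snd‖ * N)) = |w| * c * ((c * ‖x.snd‖) * N) := by ring
            _ ≤ _ := by gcongr
        have i2 : c ^ 2 * (|w| ^ 2 * ‖x.snd‖ ^ 2) ≤ |w| ^ 2 * ‖y.fst‖ ^ 2 := by
          calc c ^ 2 * (|w| ^ 2 * ‖x.snd‖ ^ 2) = |w| ^ 2 * (c * ‖x.snd‖) ^ 2 := by ring
            _ ≤ _ := by gcongr
        have i3 := mul_le_mul_of_nonneg_left e3 (sq_nonneg c)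
        linarith
      -- Here c² − w² = (c + |w|)(c − |w|), so the common factor (c + |w|)‖Bv‖ can be cancelled.
      have h2 : (c + |w|) * ‖y.fst‖ * ((c - |w|) * ‖y.fst‖) ≤ (c + |w|) * ‖y.fst‖ * (c * N) := by
        nlinarith
      exact le_of_mul_le_mul_left h2 (by positivity)
  rw [inv_mul_eq_div, le_div_iff₀ (sub_pos.2 hwc)]
  have h3 : (c - |w|) * (c * ‖x.snd‖) ≤ (c - |w|) * ‖y.fst‖ :=
    mul_le_mul_of_nonneg_left hv (sub_pos.2 hwc).le
  have h4 : c * ((c - |w|) * ‖x.snd‖) ≤ c * N := by linarith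
  have := le_of_mul_le_mul_left h4 hc
  linarith

lemma AdjPair.isReg_of_bddBelowAt [CompleteSpace E] (h : AdjPair A B) {w : ℝ}
    (hb : BddBelowAt (diracRel A B) w) : IsReg (diracRel A B) w := by
  refine h.isSA.isReg hb ?_
  rw [← starRingEnd_apply, Complex.conj_ofReal]
  exact hb

lemma AdjPair.isReg_of_im_ne_zero [CompleteSpace E] (h : AdjPair A B) {w : ℂ} (hw : w.im ≠ 0) :
    IsReg (diracRel A B) w := by
  refine h.isSA.isReg (h.isSA.bddBelowAt_of_im_ne_zero hw) (h.isSA.bddBelowAt_of_im_ne_zero ?_)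
  rw [← starRingEnd_apply, Complex.conj_im]
  exact neg_ne_zero.2 hw

/-! ### Eigenspaces of the two supersymmetric partners -/

/-- The pairs `(u, v)` with `A u = v` and `B v = z u`. -/
def eigenPairs (A B : Submodule ℂ (E × E)) (z : ℂ) : Submodule ℂ (E × E) where
  carrier := {p | (p.1, p.2) ∈ A ∧ (p.2, z • p.1) ∈ B}
  zero_mem' := ⟨A.zero_mem, by simp only [Prod.snd_zero, Prod.fst_zero, smul_zero]; exact B.zero_mem⟩
  add_mem' := by
    rintro p q ⟨h1, h2⟩ ⟨h3, h4⟩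
    refine ⟨A.add_mem h1 h3, ?_⟩
    simpa using B.add_mem h2 h4
  smul_mem' := by
    rintro c p ⟨h1, h2⟩
    refine ⟨A.smul_mem c h1, ?_⟩
    have := B.smul_mem c h2
    rwa [Prod.smul_mk, smul_comm] at this

/-- Both eigenspaces are coordinate projections of the space of pairs (u, v) with Au = v, Bv = zu.
Injectivity of each comes from ‖v‖² = z‖u‖². -/
lemma AdjPair.nonempty_equiv (h : AdjPair A B) {z : ℂ} (hz : z ≠ 0) :
    Nonempty (eigen (relComp B A) z ≃ₗ[ℂ] eigen (relComp A B) z) := by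
  let f : eigenPairs A B z →ₗ[ℂ] eigen (relComp B A) z :=
    LinearMap.codRestrict _ (LinearMap.fst ℂ E E ∘ₗ (eigenPairs A B z).subtype)
      (fun p => ⟨p.1.2, p.2.1, p.2.2⟩)
  let g : eigenPairs A B z →ₗ[ℂ] eigen (relComp A B) z :=
    LinearMap.codRestrict _ (LinearMap.snd ℂ E E ∘ₗ (eigenPairs A B z).subtype)
      (fun p => ⟨z • p.1.1, p.2.2, A.smul_mem z p.2.1⟩)
  have hf : Function.Bijective f := by
    constructor
    · rw [injective_iff_map_eq_zero]
      rintro ⟨⟨u, v⟩, h1, h2⟩ hp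
      have hu : u = 0 := congrArg Subtype.val hp
      subst hu
      have := h.inner_eq h1 h2
      rw [inner_zero_left, inner_self_eq_zero] at this
      subst this
      rfl
    · rintro ⟨u, k, h1, h2⟩
      exact ⟨⟨(u, k), h1, h2⟩, rfl⟩
  have hg : Function.Bijective g := by
    constructor
    · rw [injective_iff_map_eq_zero]
      rintro ⟨⟨u, v⟩, h1, h2⟩ hp
      have hv : v = 0 := congrArg Subtype.val hp
      subst hv
      have := h.inner_eq h1 h2
      rw [inner_zero_left, inner_smul_right, eq_comm, mul_eq_zero, inner_self_eq_zero] at this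
      obtain rfl := this.resolve_left hz
      rfl
    · rintro ⟨v, k, h1, h2⟩
      refine ⟨⟨(z⁻¹ • k, v), ?_, ?_⟩, rfl⟩
      · have : (z⁻¹ • k, z⁻¹ • z • v) ∈ A := A.smul_mem z⁻¹ h2
        rwa [smul_smul, inv_mul_cancel₀ hz, one_smul] at this
      · change (v, z • z⁻¹ • k) ∈ B
        rwa [smul_smul, mul_inv_cancel₀ hz, one_smul]
  exact ⟨(LinearEquiv.ofBijective f hf).symm.trans (LinearEquiv.ofBijective g hg)⟩

/-- The eigenvalue is the Rayleigh quotient ‖Au‖²/‖u‖². -/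
lemma AdjPair.exists_nonneg_of_eigen_ne_bot (h : AdjPair A B) {z : ℂ}
    (hz : eigen (relComp B A) z ≠ ⊥) : ∃ r : ℝ, 0 ≤ r ∧ z = r := by
  obtain ⟨u, ⟨k, h1, h2⟩, hu⟩ := Submodule.exists_mem_ne_zero_of_ne_bot hz
  have e : ⟪k, k⟫_ℂ = ⟪u, z • u⟫_ℂ := h.inner_eq h1 h2
  rw [inner_smul_right, inner_self_eq_norm_sq_to_K, inner_self_eq_norm_sq_to_K] at e
  have hu' : (‖u‖ : ℂ) ≠ 0 := by simpa using hu
  refine ⟨‖k‖ ^ 2 / ‖u‖ ^ 2, by positivity, ?_⟩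
  push_cast
  rw [eq_div_iff (pow_ne_zero 2 hu')]
  exact e.symm

/-- ‖Au‖² = ⟪u, BAu⟫, so BA and A have the same kernel. -/
lemma AdjPair.mem_eigen_zero (h : AdjPair A B) {u : E} :
    u ∈ eigen (relComp B A) 0 ↔ (u, 0) ∈ A := by
  rw [mem_eigen, zero_smul, mem_relComp]
  constructor
  · rintro ⟨k, h1, h2⟩
    have e := h.inner_eq h1 h2
    rw [inner_zero_right, inner_self_eq_zero] at e
    rwa [e] at h1
  · intro hu
    exact ⟨0, hu, B.zero_mem⟩

/-- The eigenspaces of a diagonal operator matrix are direct sums. -/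
def eigenDiagRelEquiv (A B : Submodule ℂ (E × E)) (z : ℂ) :
    eigen (diagRel A B) z ≃ₗ[ℂ] eigen A z × eigen B z where
  toFun p := (⟨p.1.fst, p.2.1⟩, ⟨p.1.snd, p.2.2⟩)
  invFun q := ⟨WithLp.toLp 2 (q.1.1, q.2.1), q.1.2, q.2.2⟩
  map_add' _ _ := rfl
  map_smul' _ _ := rfl
  left_inv _ := rfl
  right_inv _ := rfl

lemma eigen_le_eigen_relComp_self (G : Submodule ℂ (E × E)) (w : ℂ) :
    eigen G w ≤ eigen (relComp G G) (w ^ 2) := by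
  intro x hx
  refine ⟨w • x, hx, ?_⟩
  have : (w • x, w • w • x) ∈ G := G.smul_mem w hx
  rwa [smul_smul, ← pow_two] at this

/-- If BAu = w²u, then (wu, Au) is an eigenvector of D at w. For w = 0 this vector vanishes, and (u,
0) takes its place. -/
lemma AdjPair.eigen_diracRel_ne_bot (h : AdjPair A B) {w : ℂ}
    (hw : eigen (relComp B A) (w ^ 2) ≠ ⊥) : eigen (diracRel A B) w ≠ ⊥ := by
  obtain ⟨u, hu, hu0⟩ := Submodule.exists_mem_ne_zero_of_ne_bot hw
  rcases eq_or_ne w 0 with rfl | hw0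
  · rw [zero_pow two_ne_zero, h.mem_eigen_zero] at hu
    refine Submodule.ne_bot_iff _ |>.2 ⟨WithLp.toLp 2 (u, 0), ?_, fun h0 => hu0 ?_⟩
    · rw [mem_eigen, zero_smul]
      exact ⟨hu, B.zero_mem⟩
    · exact congrArg WithLp.fst h0
  · obtain ⟨k, h1, h2⟩ := hu
    refine Submodule.ne_bot_iff _ |>.2 ⟨WithLp.toLp 2 (w • u, k), ⟨?_, ?_⟩, fun h0 => hu0 ?_⟩
    · exact A.smul_mem w h1
    · change (k, w • w • u) ∈ B
      rwa [smul_smul, ← pow_two]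
    · have : w • u = 0 := congrArg WithLp.fst h0
      exact (smul_eq_zero.1 this).resolve_left hw0

end Supersymmetry

/-! ### Multiplication operators -/

lemma memLp_mul (m : ℝ →ᵇ ℝ) {f : ℝ → ℂ} (hf : MemLp f 2) :
    MemLp (fun x => (m x : ℂ) * f x) 2 := by
  refine MemLp.of_le_mul (c := ‖m‖) hf ?_ (Filter.Eventually.of_forall fun x => ?_)
  · exact (Complex.continuous_ofReal.comp m.continuous).aestronglyMeasurable.mul hf.1
  · rw [norm_mul, Complex.norm_real]
    gcongr
    exact m.norm_coe_le_norm x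

/-- Multiplication by a bounded continuous function. -/
def mulL (m : ℝ →ᵇ ℝ) : L2 →L[ℂ] L2 :=
  LinearMap.mkContinuous
    { toFun := fun f => (memLp_mul m (Lp.memLp f)).toLp _
      map_add' := by
        intro f g
        rw [← MemLp.toLp_add]
        apply MemLp.toLp_congr
        filter_upwards [Lp.coeFn_add f g] with x hx
        simp only [hx, Pi.add_apply, mul_add]
      map_smul' := by
        intro c f
        rw [RingHom.id_apply, ← MemLp.toLp_const_smul]
        apply MemLp.toLp_congr
        filter_upwards [Lp.coeFn_smul c f] with x hx
        simp only [hx, Pi.smul_apply, smul_eq_mul]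
        ring } ‖m‖ (by
    intro f
    apply Lp.norm_le_mul_norm_of_ae_le_mul
    filter_upwards [(memLp_mul m (Lp.memLp f)).coeFn_toLp] with x hx
    change ‖(memLp_mul m (Lp.memLp f)).toLp _ x‖ ≤ _
    rw [hx, norm_mul, Complex.norm_real]
    gcongr
    exact m.norm_coe_le_norm x)

lemma coeFn_mulL (m : ℝ →ᵇ ℝ) (f : L2) : mulL m f =ᵐ[volume] fun x => (m x : ℂ) * f x :=
  (memLp_mul m (Lp.memLp f)).coeFn_toLp

lemma mulL_sub (m n : ℝ →ᵇ ℝ) (f : L2) : mulL (m - n) f = mulL m f - mulL n f := by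
  apply Lp.ext
  filter_upwards [coeFn_mulL (m - n) f, coeFn_mulL m f, coeFn_mulL n f,
    Lp.coeFn_sub (mulL m f) (mulL n f)] with x h1 h2 h3 h4
  rw [h1, h4, Pi.sub_apply, h2, h3, BoundedContinuousFunction.sub_apply]
  push_cast
  ring

lemma mulL_mul (m n : ℝ →ᵇ ℝ) (f : L2) : mulL (m * n) f = mulL m (mulL n f) := by
  apply Lp.ext
  filter_upwards [coeFn_mulL (m * n) f, coeFn_mulL m (mulL n f), coeFn_mulL n f] with x h1 h2 h3
  rw [h1, h2, h3, BoundedContinuousFunction.mul_apply]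
  push_cast
  ring

lemma mulL_smul (c : ℝ) (m : ℝ →ᵇ ℝ) (f : L2) : mulL (c • m) f = (c : ℂ) • mulL m f := by
  apply Lp.ext
  filter_upwards [coeFn_mulL (c • m) f, coeFn_mulL m f, Lp.coeFn_smul (c : ℂ) (mulL m f)]
    with x h1 h2 h3
  rw [h1, h3, Pi.smul_apply, h2, BoundedContinuousFunction.smul_apply]
  simp only [smul_eq_mul]
  push_cast
  ring

lemma mulL_one (f : L2) : mulL 1 f = f := by
  apply Lp.ext
  filter_upwards [coeFn_mulL 1 f] with x h1
  rw [h1, BoundedContinuousFunction.coe_one, Pi.one_apply]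
  simp

lemma inner_mulL_left (m : ℝ →ᵇ ℝ) (f g : L2) : ⟪mulL m f, g⟫_ℂ = ⟪f, mulL m g⟫_ℂ := by
  rw [L2.inner_def, L2.inner_def]
  apply integral_congr_ae
  filter_upwards [coeFn_mulL m f, coeFn_mulL m g] with x h1 h2
  rw [h1, h2]
  simp only [RCLike.inner_apply, map_mul, Complex.conj_ofReal]
  ring

lemma integrable_norm_sq (f : L2) : Integrable (fun x => ‖f x‖ ^ 2) :=
  (memLp_two_iff_integrable_sq_norm (Lp.memLp f).1).1 (Lp.memLp f)

lemma integrable_mul_norm_sq (m : ℝ →ᵇ ℝ) (f : L2) : Integrable (fun x => m x * ‖f x‖ ^ 2) :=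
  (integrable_norm_sq f).bdd_mul m.continuous.aestronglyMeasurable
    (Filter.Eventually.of_forall m.norm_coe_le_norm)

lemma inner_mulL_self (m : ℝ →ᵇ ℝ) (f : L2) :
    ⟪f, mulL m f⟫_ℂ = ((∫ x, m x * ‖f x‖ ^ 2 : ℝ) : ℂ) := by
  rw [L2.inner_def, ← integral_complex_ofReal]
  apply integral_congr_ae
  filter_upwards [coeFn_mulL m f] with x h1
  rw [h1]
  simp only [RCLike.inner_apply]
  push_cast
  rw [mul_assoc, Complex.mul_conj, Complex.normSq_eq_norm_sq]
  push_cast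
  ring

lemma norm_sq_eq_integral (f : L2) : ‖f‖ ^ 2 = ∫ x, ‖f x‖ ^ 2 := by
  have h := inner_mulL_self 1 f
  rw [mulL_one, inner_self_eq_norm_sq_to_K] at h
  simp only [BoundedContinuousFunction.coe_one, Pi.one_apply, one_mul] at h
  apply Complex.ofReal_injective
  rw [← h]
  push_cast
  rfl

/-! ### Weak derivatives -/

lemma hasWeakDeriv_toLp {F F' : ℝ → ℂ} (hF : ∀ x, HasDerivAt F (F' x) x) (hc : Continuous F')
    (h : MemLp F 2) (h' : MemLp F' 2) : HasWeakDeriv (h.toLp _) (h'.toLp _) := by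
  intro φ hφ hs
  have hcF : Continuous F := continuous_iff_continuousAt.2 fun x => (hF x).continuousAt
  have e1 : ∫ x, deriv φ x • (h.toLp _) x = ∫ x, F x * ((deriv φ x : ℝ) : ℂ) := by
    apply integral_congr_ae
    filter_upwards [h.coeFn_toLp] with x hx
    rw [hx, Complex.real_smul, mul_comm]
  have e2 : ∫ x, φ x • (h'.toLp _) x = ∫ x, F' x * (φ x : ℂ) := by
    apply integral_congr_ae
    filter_upwards [h'.coeFn_toLp] with x hx
    rw [hx, Complex.real_smul, mul_comm]
  have hφc : Continuous (fun x => (φ x : ℂ)) := Complex.continuous_ofReal.comp hφ.continuous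
  have hφs : HasCompactSupport (fun x => (φ x : ℂ)) :=
    hs.comp_left (g := Complex.ofReal) Complex.ofReal_zero
  have hφ'c : Continuous (fun x => ((deriv φ x : ℝ) : ℂ)) :=
    Complex.continuous_ofReal.comp (hφ.continuous_deriv (by simp))
  have hφ's : HasCompactSupport (fun x => ((deriv φ x : ℝ) : ℂ)) :=
    hs.deriv.comp_left (g := Complex.ofReal) Complex.ofReal_zero
  rw [e1, e2]
  refine integral_mul_deriv_eq_deriv_mul_of_integrable (fun x _ => hF x)
    (fun x _ => ?_) ?_ ?_ ?_
  · exact ((hφ.differentiable (by simp)) x).hasDerivAt.ofReal_comp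
  · exact (hcF.mul hφ'c).integrable_of_hasCompactSupport hφ's.mul_left
  · exact (hc.mul hφc).integrable_of_hasCompactSupport hφs.mul_left
  · exact (hcF.mul hφc).integrable_of_hasCompactSupport hφs.mul_left

lemma memLp_ofReal {φ : ℝ → ℝ} (hφ : Continuous φ) (hc : HasCompactSupport φ) :
    MemLp (fun x => (φ x : ℂ)) 2 :=
  (Complex.continuous_ofReal.comp hφ).memLp_of_hasCompactSupport
    (hc.comp_left (g := Complex.ofReal) Complex.ofReal_zero)

lemma inner_toLp_ofReal {φ : ℝ → ℝ} (h : MemLp (fun x => (φ x : ℂ)) 2) (f : L2) :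
    ⟪(h.toLp _), f⟫_ℂ = ∫ x, φ x • f x := by
  rw [L2.inner_def]
  apply integral_congr_ae
  filter_upwards [h.coeFn_toLp] with x hx
  rw [hx]
  simp only [RCLike.inner_apply, Complex.conj_ofReal, Complex.real_smul]
  ring

/-- The span of the pairs `(φ, φ')` for test functions `φ`. -/
def testGraph : Submodule ℂ (L2 × L2) :=
  Submodule.span ℂ {p | ∃ (φ : ℝ → ℝ) (h : MemLp (fun x => (φ x : ℂ)) 2 volume)
    (h' : MemLp (fun x => ((deriv φ x : ℝ) : ℂ)) 2 volume), ContDiff ℝ ∞ φ ∧ HasCompactSupport φ ∧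
    p = ((h.toLp _), (h'.toLp _))}

/-- The weak derivative is minus the adjoint of the derivative on test functions; this is the form
in which `skew_of_deficiency` takes it. -/
lemma mem_weakDerivGraph_iff (p : L2 × L2) :
    p ∈ weakDerivGraph ↔ ∀ q ∈ testGraph, ⟪q.2, p.1⟫_ℂ = -⟪q.1, p.2⟫_ℂ := by
  constructor
  · intro hp q hq
    induction hq using Submodule.span_induction with
    | mem q hq =>
      obtain ⟨φ, h, h', hφ, hc, rfl⟩ := hq
      rw [inner_toLp_ofReal h, inner_toLp_ofReal h']
      exact hp φ hφ hc
    | zero => simp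
    | add a b _ _ ha hb =>
      rw [Prod.snd_add, Prod.fst_add, inner_add_left, inner_add_left, ha, hb, neg_add]
    | smul c a _ ha =>
      rw [Prod.smul_snd, Prod.smul_fst, inner_smul_left, inner_smul_left, ha, mul_neg]
  · intro hp φ hφ hc
    have h := memLp_ofReal hφ.continuous hc
    have h' := memLp_ofReal (hφ.continuous_deriv (by simp)) hc.deriv
    have := hp ((h.toLp _), (h'.toLp _)) (Submodule.subset_span ⟨φ, h, h', hφ, hc, rfl⟩)
    rwa [inner_toLp_ofReal h, inner_toLp_ofReal h'] at this

lemma testGraph_le : testGraph ≤ weakDerivGraph := by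
  rw [testGraph, Submodule.span_le]
  rintro _ ⟨φ, h, h', hφ, hc, rfl⟩
  refine hasWeakDeriv_toLp (fun x => ?_) ?_ h h'
  · exact ((hφ.differentiable (by simp)) x).hasDerivAt.ofReal_comp
  · exact Complex.continuous_ofReal.comp (hφ.continuous_deriv (by simp))

/-- A test function with vanishing integral is the derivative of a test function. -/
lemma exists_primitive {η : ℝ → ℝ} (hη : ContDiff ℝ ∞ η) (hc : HasCompactSupport η)
    (h0 : ∫ x, η x = 0) : ∃ φ : ℝ → ℝ, ContDiff ℝ ∞ φ ∧ HasCompactSupport φ ∧ deriv φ = η := by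
  obtain ⟨R, hR⟩ := hc.isCompact.isBounded.subset_closedBall (0 : ℝ)
  have hz : ∀ x, R < |x| → η x = 0 := by
    intro x hx
    by_contra hne
    have := hR (subset_tsupport η hne)
    rw [mem_closedBall_zero_iff, Real.norm_eq_abs] at this
    linarith
  have hint : Integrable η := hη.continuous.integrable_of_hasCompactSupport hc
  let φ : ℝ → ℝ := fun x => ∫ t in Set.Iic x, η t
  have hd : ∀ x, HasDerivAt φ (η x) x := by
    intro x
    have h1 : ∀ y, φ y = (∫ t in Set.Iic 0, η t) + ∫ t in (0 : ℝ)..y, η t := by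
      intro y
      rw [intervalIntegral.integral_Iic_sub_Iic hint.integrableOn hint.integrableOn |>.symm]
      ring
    rw [show φ = fun y => (∫ t in Set.Iic 0, η t) + ∫ t in (0 : ℝ)..y, η t from funext h1]
    exact (intervalIntegral.integral_hasDerivAt_right (hη.continuous.intervalIntegrable _ _)
      hη.continuous.aestronglyMeasurable.stronglyMeasurableAtFilter
      hη.continuous.continuousAt).const_add _
  have hde : deriv φ = η := funext fun x => (hd x).deriv
  refine ⟨φ, ?_, ?_, hde⟩
  · rw [contDiff_infty_iff_deriv, hde]
    exact ⟨fun x => (hd x).differentiableAt, hη⟩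
  · apply HasCompactSupport.intro (isCompact_Icc (a := -R) (b := R))
    intro x hx
    rw [Set.mem_Icc, not_and_or, not_le, not_le] at hx
    rcases hx with hx | hx
    · apply setIntegral_eq_zero_of_forall_eq_zero
      intro t ht
      apply hz
      rw [lt_abs]
      right
      have : t ≤ x := ht
      linarith
    · have h2 : φ x + ∫ t in Set.Ioi x, η t = 0 := by
        rw [← h0, ← intervalIntegral.integral_Iic_add_Ioi hint.integrableOn hint.integrableOn]
      have h3 : ∫ t in Set.Ioi x, η t = 0 := by
        apply setIntegral_eq_zero_of_forall_eq_zero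
        intro t ht
        apply hz
        rw [lt_abs]
        left
        have : x < t := ht
        linarith
      linarith

/-- The lemma of du Bois-Reymond. -/
lemma ae_eq_const_of_integral_deriv_smul_eq_zero {h : ℝ → ℂ} (hh : LocallyIntegrable h)
    (h0 : ∀ φ : ℝ → ℝ, ContDiff ℝ ∞ φ → HasCompactSupport φ → ∫ x, deriv φ x • h x = 0) :
    ∃ C : ℂ, ∀ᵐ x, h x = C := by
  let b : ContDiffBump (0 : ℝ) := ⟨1, 2, one_pos, one_lt_two⟩
  set ρ := b.normed volume with hρ
  have hρd : ContDiff ℝ ∞ ρ := b.contDiff_normed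
  have hρc : HasCompactSupport ρ := b.hasCompactSupport_normed
  have hρ1 : ∫ x, ρ x = 1 := b.integral_normed
  have hi : ∀ ψ : ℝ → ℝ, Continuous ψ → HasCompactSupport ψ → Integrable fun x => ψ x • h x :=
    fun ψ h1 h2 => hh.integrable_smul_left_of_hasCompactSupport h1 h2
  set C := ∫ x, ρ x • h x with hC
  refine ⟨C, ?_⟩
  have key : ∀ᵐ x, h x - C = 0 := by
    apply ae_eq_zero_of_integral_contDiff_smul_eq_zero
      (hh.sub (continuous_const.locallyIntegrable))
    intro ψ hψ hψc
    have hψi : Integrable ψ := hψ.continuous.integrable_of_hasCompactSupport hψc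
    have hρi : Integrable ρ := hρd.continuous.integrable_of_hasCompactSupport hρc
    -- Subtracting (∫ψ)ρ from ψ makes the integral vanish, so the difference is the derivative of a
    -- test function. Comparing integrals shows that the constant must be ∫ρh.
    obtain ⟨φ, hφ, hφc, hφd⟩ := exists_primitive (η := fun x => ψ x - (∫ y, ψ y) * ρ x)
      (hψ.sub (contDiff_const.mul hρd)) (hψc.sub hρc.mul_left)
      (by rw [integral_sub hψi (hρi.const_mul _), integral_const_mul, hρ1, mul_one, sub_self])
    have h1 := h0 φ hφ hφc
    rw [hφd] at h1
    have h2 : ∫ x, (ψ x - (∫ y, ψ y) * ρ x) • h x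
        = (∫ x, ψ x • h x) - ((∫ y, ψ y : ℝ) : ℂ) * C := by
      rw [hC, ← integral_const_mul, ← integral_sub (hi ψ hψ.continuous hψc)
        ((hi ρ hρd.continuous hρc).const_mul _)]
      congr 1
      ext x
      simp only [Complex.real_smul]
      push_cast
      ring
    have h3 : ∫ x, ψ x • (h x - C) = (∫ x, ψ x • h x) - ((∫ y, ψ y : ℝ) : ℂ) * C := by
      simp only [smul_sub]
      rw [integral_sub (hi ψ hψ.continuous hψc) (hψi.smul_const C), integral_smul_const,
        Complex.real_smul]
    change ∫ x, ψ x • (h x - C) = 0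
    rw [h3, ← h2, h1]
  filter_upwards [key] with x hx
  exact sub_eq_zero.1 hx

/-- Integrating factor: the weak derivative of wu is wg + w'u = 0. In weak form this amounts to
testing with φw. -/
lemma HasWeakDeriv.ae_mul_eq_const {u g : L2} (h : HasWeakDeriv u g) {w : ℝ → ℝ}
    (hw : ContDiff ℝ ∞ w) (hg : ∀ᵐ x, w x * g x + deriv w x * u x = 0) :
    ∃ C : ℂ, ∀ᵐ x, w x * u x = C := by
  have hloc : LocallyIntegrable (fun x => (w x : ℂ) * u x) := by
    have := ((Lp.memLp u).locallyIntegrable (by norm_num)).continuous_mul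
      (Complex.continuous_ofReal.comp hw.continuous)
    exact this
  refine ae_eq_const_of_integral_deriv_smul_eq_zero hloc fun φ hφ hc => ?_
  have hdw : ContDiff ℝ ∞ (deriv w) := (contDiff_infty_iff_deriv.1 hw).2
  have h1 := h (fun x => φ x * w x) (hφ.mul hw) hc.mul_right
  have hd : ∀ x, deriv (fun x => φ x * w x) x = deriv φ x * w x + φ x * deriv w x := fun x =>
    deriv_fun_mul (hφ.differentiable (by simp) x) (hw.differentiable (by simp) x)
  have i1 : Integrable fun x => (φ x * deriv w x) • u x :=
    L2.integrable_smul u (hφ.continuous.mul hdw.continuous) hc.mul_right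
  have i2 : Integrable fun x => (deriv φ x * w x) • u x :=
    L2.integrable_smul u ((hφ.continuous_deriv (by simp)).mul hw.continuous) hc.deriv.mul_right
  simp only [hd, add_smul] at h1
  rw [integral_add i2 i1] at h1
  have h2 : ∫ x, (φ x * w x) • g x = -∫ x, (φ x * deriv w x) • u x := by
    rw [← integral_neg]
    apply integral_congr_ae
    filter_upwards [hg] with x hx
    simp only [Complex.real_smul]
    push_cast
    linear_combination (φ x : ℂ) * hx
  rw [h2, neg_neg] at h1
  have h3 : ∫ x, deriv φ x • ((w x : ℂ) * u x) = ∫ x, (deriv φ x * w x) • u x := by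
    congr 1
    ext x
    simp only [Complex.real_smul]
    push_cast
    ring
  rw [h3]
  linear_combination h1

lemma const_eq_zero_of_le (u : L2) {C : ℂ} {s : Set ℝ} (hs : MeasurableSet s)
    (hvol : volume s = ⊤) (h : ∀ᵐ x, x ∈ s → ‖C‖ ≤ ‖u x‖) : C = 0 := by
  have h1 : MemLp (fun _ : ℝ => C) 2 (volume.restrict s) := by
    refine ((Lp.memLp u).restrict s).mono aestronglyMeasurable_const ?_
    rwa [ae_restrict_iff' hs]
  rw [memLp_const_iff (by norm_num) (by norm_num)] at h1
  rcases h1 with h1 | h1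
  · exact h1
  · rw [Measure.restrict_apply_univ, hvol] at h1
    exact absurd h1 (lt_irrefl _)

/-- On s the weight is at most 1, so ‖u‖ ≥ ‖C‖ on a set of infinite measure, which is compatible
with L² only for C = 0. -/
lemma ae_eq_zero_of_mul_eq_const {u : L2} {w : ℝ → ℝ} {C : ℂ} {s : Set ℝ} (hs : MeasurableSet s)
    (hvol : volume s = ⊤) (hw : ∀ x, 0 < w x) (hw1 : ∀ x ∈ s, w x ≤ 1)
    (h : ∀ᵐ x, w x * u x = C) : u = 0 := by
  have hC : C = 0 := by
    refine const_eq_zero_of_le u hs hvol ?_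
    filter_upwards [h] with x hx hxs
    rw [← hx, norm_mul, Complex.norm_real, Real.norm_of_nonneg (hw x).le]
    exact mul_le_of_le_one_left (norm_nonneg _) (hw1 x hxs)
  rw [Lp.eq_zero_iff_ae_eq_zero]
  filter_upwards [h] with x hx
  rw [hC, mul_eq_zero, Complex.ofReal_eq_zero] at hx
  exact hx.resolve_left (hw x).ne'

lemma HasWeakDeriv.eq_zero_of_zero {u : L2} (h : HasWeakDeriv u 0) : u = 0 := by
  obtain ⟨C, hC⟩ := h.ae_mul_eq_const (w := fun _ => 1) contDiff_const (by
    filter_upwards [Lp.coeFn_zero ℂ 2 (volume : Measure ℝ)] with x hx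
    rw [hx]
    simp)
  exact ae_eq_zero_of_mul_eq_const MeasurableSet.univ (by simp) (fun _ => one_pos)
    (fun _ _ => le_rfl) hC

/-- The solutions Ceˣ of u' = u are not square integrable at +∞. -/
lemma eigen_weakDerivGraph_one : eigen weakDerivGraph 1 = ⊥ := by
  rw [Submodule.eq_bot_iff]
  intro u hu
  rw [mem_eigen, one_smul] at hu
  have hu' : HasWeakDeriv u u := hu
  have hd : ∀ x : ℝ, deriv (fun x : ℝ => Real.exp (-x)) x = -Real.exp (-x) := fun x => by
    simpa using ((hasDerivAt_neg x).exp).deriv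
  obtain ⟨C, hC⟩ := hu'.ae_mul_eq_const (w := fun x => Real.exp (-x))
    (Real.contDiff_exp.comp contDiff_neg) (by
    refine Filter.Eventually.of_forall fun x => ?_
    rw [hd]
    push_cast
    ring)
  exact ae_eq_zero_of_mul_eq_const (measurableSet_Ioi (a := 0)) (by simp)
    (fun _ => Real.exp_pos _) (fun x hx => Real.exp_le_one_iff.2 (by simpa using hx.le)) hC

lemma eigen_weakDerivGraph_neg_one : eigen weakDerivGraph (-1) = ⊥ := by
  rw [Submodule.eq_bot_iff]
  intro u hu
  rw [mem_eigen, neg_smul, one_smul] at hu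
  have hu' : HasWeakDeriv u (-u) := hu
  obtain ⟨C, hC⟩ := hu'.ae_mul_eq_const (w := Real.exp) Real.contDiff_exp (by
    filter_upwards [Lp.coeFn_neg u] with x hx
    rw [hx, Real.deriv_exp, Pi.neg_apply]
    ring)
  exact ae_eq_zero_of_mul_eq_const (measurableSet_Iio (a := 0)) (by simp)
    (fun _ => Real.exp_pos _) (fun x hx => Real.exp_le_one_iff.2 hx.le) hC

/-- Integration by parts for two arbitrary H¹ functions. The previous two lemmas are the vanishing
of the deficiency spaces. -/
lemma weakDeriv_skew {u u' v v' : L2} (hu : HasWeakDeriv u u') (hv : HasWeakDeriv v v') :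
    ⟪u', v⟫_ℂ = -⟪u, v'⟫_ℂ :=
  skew_of_deficiency (G₀ := testGraph)
    (fun p hp q hq => (mem_weakDerivGraph_iff p).1 (testGraph_le hp) q hq)
    mem_weakDerivGraph_iff eigen_weakDerivGraph_one eigen_weakDerivGraph_neg_one
    (v, v') hv (u, u') hu

/-- The domain of the weak derivative is maximal. -/
lemma hasWeakDeriv_of_skew {v x : L2}
    (h : ∀ u u', HasWeakDeriv u u' → ⟪u', v⟫_ℂ = -⟪u, x⟫_ℂ) : HasWeakDeriv v x :=
  (mem_weakDerivGraph_iff (v, x)).2 fun q hq => h q.1 q.2 (testGraph_le hq)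

lemma HasWeakDeriv.mulL {u u' : L2} (h : HasWeakDeriv u u') {m m' : ℝ →ᵇ ℝ}
    (hm : ContDiff ℝ ∞ m) (hd : ∀ x, HasDerivAt m (m' x) x) :
    HasWeakDeriv (mulL m u) (mulL m u' + mulL m' u) := by
  intro φ hφ hc
  have h1 := h (fun x => φ x * m x) (hφ.mul hm) hc.mul_right
  have hd' : ∀ x, deriv (fun x => φ x * m x) x = deriv φ x * m x + φ x * m' x := fun x => by
    rw [deriv_fun_mul (hφ.differentiable (by simp) x) (hm.differentiable (by simp) x),
      (hd x).deriv]
  have i1 : Integrable fun x => (φ x * m' x) • u x :=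
    L2.integrable_smul u (hφ.continuous.mul m'.continuous) hc.mul_right
  have i2 : Integrable fun x => (deriv φ x * m x) • u x :=
    L2.integrable_smul u ((hφ.continuous_deriv (by simp)).mul m.continuous) hc.deriv.mul_right
  have i3 : Integrable fun x => (φ x * m x) • u' x :=
    L2.integrable_smul u' (hφ.continuous.mul m.continuous) hc.mul_right
  simp only [hd', add_smul] at h1
  rw [integral_add i2 i1] at h1
  have e1 : ∫ x, deriv φ x • (DiracTanh.mulL m u) x = ∫ x, (deriv φ x * m x) • u x := by
    apply integral_congr_ae
    filter_upwards [coeFn_mulL m u] with x hx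
    rw [hx]
    simp only [Complex.real_smul]
    push_cast
    ring
  have e2 : ∫ x, φ x • (DiracTanh.mulL m u' + DiracTanh.mulL m' u : L2) x
      = (∫ x, (φ x * m x) • u' x) + ∫ x, (φ x * m' x) • u x := by
    rw [← integral_add i3 i1]
    apply integral_congr_ae
    filter_upwards [Lp.coeFn_add (DiracTanh.mulL m u') (DiracTanh.mulL m' u), coeFn_mulL m u',
      coeFn_mulL m' u] with x h1 h2 h3
    rw [h1, Pi.add_apply, h2, h3]
    simp only [Complex.real_smul]
    push_cast
    ring
  rw [e1, e2]
  linear_combination h1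

/-! ### The hyperbolic tangent -/

lemma hasDerivAt_tanh (x : ℝ) : HasDerivAt Real.tanh (1 - Real.tanh x ^ 2) x := by
  have h := (Real.hasDerivAt_sinh x).div (Real.hasDerivAt_cosh x) (Real.cosh_pos x).ne'
  have e : Real.tanh = fun y => Real.sinh y / Real.cosh y :=
    funext Real.tanh_eq_sinh_div_cosh
  rw [e]
  refine h.congr_deriv ?_
  have := (Real.cosh_pos x).ne'
  field_simp

lemma contDiff_tanh : ContDiff ℝ ∞ Real.tanh := by
  rw [show Real.tanh = fun y => Real.sinh y / Real.cosh y from funext Real.tanh_eq_sinh_div_cosh]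
  exact Real.contDiff_sinh.div Real.contDiff_cosh fun x => (Real.cosh_pos x).ne'

lemma continuous_tanh : Continuous Real.tanh := contDiff_tanh.continuous

/-- `x ↦ tanh (a x)`. -/
def tanhB (a : ℝ) : ℝ →ᵇ ℝ :=
  BoundedContinuousFunction.ofNormedAddCommGroup (fun x => Real.tanh (a * x))
    (continuous_tanh.comp (continuous_const.mul continuous_id)) 1
    fun _ => (Real.abs_tanh_lt_one _).le

/-- `x ↦ sech² (a x)`. -/
def sechB (a : ℝ) : ℝ →ᵇ ℝ := 1 - tanhB a * tanhB a

lemma tanhB_apply (a x : ℝ) : tanhB a x = Real.tanh (a * x) := rfl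

lemma sechB_apply (a x : ℝ) : sechB a x = 1 - Real.tanh (a * x) ^ 2 := by
  rw [pow_two]
  rfl

lemma sechB_nonneg (a x : ℝ) : 0 ≤ sechB a x := by
  rw [sechB_apply]
  linarith [Real.tanh_sq_lt_one (a * x)]

lemma sechB_le_one (a x : ℝ) : sechB a x ≤ 1 := by
  rw [sechB_apply]
  linarith [sq_nonneg (Real.tanh (a * x))]

lemma hasDerivAt_tanhB (a x : ℝ) : HasDerivAt (tanhB a) ((a • sechB a) x) x := by
  have h : HasDerivAt (fun y => a * y) a x := by simpa using (hasDerivAt_id x).const_mul a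
  refine ((hasDerivAt_tanh (a * x)).comp x h).congr_deriv ?_
  rw [BoundedContinuousFunction.smul_apply, sechB_apply, smul_eq_mul, mul_comm]

lemma contDiff_tanhB (a : ℝ) : ContDiff ℝ ∞ (tanhB a) :=
  contDiff_tanh.comp (contDiff_const.mul contDiff_id)

lemma hasDerivAt_sechB (a x : ℝ) :
    HasDerivAt (sechB a) (((-2 * a) • (tanhB a * sechB a)) x) x := by
  have h := ((hasDerivAt_tanhB a x).mul (hasDerivAt_tanhB a x)).const_sub 1
  refine h.congr_deriv ?_
  simp only [BoundedContinuousFunction.smul_apply, smul_eq_mul,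
    BoundedContinuousFunction.mul_apply]
  ring

lemma contDiff_sechB (a : ℝ) : ContDiff ℝ ∞ (sechB a) :=
  contDiff_const.sub ((contDiff_tanhB a).mul (contDiff_tanhB a))

lemma HasWeakDeriv.tanh {u p : L2} (h : HasWeakDeriv u p) :
    HasWeakDeriv (DiracTanh.mulL (tanhB 1) u)
      (DiracTanh.mulL (tanhB 1) p + DiracTanh.mulL (sechB 1) u) := by
  have := h.mulL (contDiff_tanhB 1) (hasDerivAt_tanhB 1)
  rwa [one_smul] at this

lemma mulL_tanhB_tanhB (u : L2) :
    mulL (tanhB 1) (mulL (tanhB 1) u) = u - mulL (sechB 1) u := by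
  rw [sechB, mulL_sub, mulL_one, mulL_mul, sub_sub_cancel]

lemma HasWeakDeriv.smul {u p : L2} (h : HasWeakDeriv u p) (c : ℂ) :
    HasWeakDeriv (c • u) (c • p) :=
  weakDerivGraph.smul_mem (x := (u, p)) c h

lemma HasWeakDeriv.add {u p v q : L2} (h : HasWeakDeriv u p) (h' : HasWeakDeriv v q) :
    HasWeakDeriv (u + v) (p + q) :=
  weakDerivGraph.add_mem (x := (u, p)) (y := (v, q)) h h'

lemma HasWeakDeriv.sub {u p v q : L2} (h : HasWeakDeriv u p) (h' : HasWeakDeriv v q) :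
    HasWeakDeriv (u - v) (p - q) :=
  weakDerivGraph.sub_mem (x := (u, p)) (y := (v, q)) h h'

/-! ### The first-order operators -/

/-- The graph of `c tanh + δ ∂`. -/
def aGraph (c δ : ℝ) : Submodule ℂ (L2 × L2) :=
  weakDerivGraph.map ((LinearMap.fst ℂ L2 L2).prod
    ((c : ℂ) • (mulL (tanhB 1)).toLinearMap ∘ₗ LinearMap.fst ℂ L2 L2
      + (δ : ℂ) • LinearMap.snd ℂ L2 L2))

lemma mem_aGraph {c δ : ℝ} {u v : L2} :
    (u, v) ∈ aGraph c δ ↔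
      ∃ p, HasWeakDeriv u p ∧ v = (c : ℂ) • mulL (tanhB 1) u + (δ : ℂ) • p := by
  rw [aGraph, Submodule.mem_map]
  constructor
  · rintro ⟨⟨u', p⟩, h, he⟩
    have h1 : u' = u := congrArg Prod.fst he
    subst h1
    exact ⟨p, h, (congrArg Prod.snd he).symm⟩
  · rintro ⟨p, h, rfl⟩
    exact ⟨(u, p), h, rfl⟩

/-- If x is to be c tanh v − δv', then v' must be δ⁻¹(c tanh v − x); maximality of the domain of ∂
confirms that this is the weak derivative. -/
lemma mem_aGraph_neg_of_inner {c δ : ℝ} (hδ : δ ≠ 0) {v x : L2}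
    (h : ∀ q ∈ aGraph c δ, ⟪q.2, v⟫_ℂ = ⟪q.1, x⟫_ℂ) : (v, x) ∈ aGraph c (-δ) := by
  have hδ' : (δ : ℂ) ≠ 0 := by exact_mod_cast hδ
  rw [mem_aGraph]
  refine ⟨(δ : ℂ)⁻¹ • ((c : ℂ) • mulL (tanhB 1) v - x), ?_, ?_⟩
  · apply hasWeakDeriv_of_skew
    intro u u' hu
    have := h _ (mem_aGraph.2 ⟨u', hu, rfl⟩)
    simp only [inner_add_left, inner_smul_left, Complex.conj_ofReal] at this
    rw [inner_smul_right, inner_sub_right, inner_smul_right, ← inner_mulL_left, ← this]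
    field_simp
    ring
  · rw [smul_smul]
    push_cast
    rw [neg_mul, mul_inv_cancel₀ hδ']
    module

/-- tanh is symmetric and ∂ is skew. The second half is the first with δ replaced by −δ. -/
lemma adjPair_aGraph {c δ : ℝ} (hδ : δ ≠ 0) : AdjPair (aGraph c δ) (aGraph c (-δ)) := by
  have key : ∀ u f v g, (u, f) ∈ aGraph c δ → (v, g) ∈ aGraph c (-δ) →
      ⟪f, v⟫_ℂ = ⟪u, g⟫_ℂ := by
    intro u f v g hu hv
    obtain ⟨p, hp, rfl⟩ := mem_aGraph.1 hu
    obtain ⟨q, hq, rfl⟩ := mem_aGraph.1 hv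
    have := weakDeriv_skew hp hq
    simp only [inner_add_left, inner_smul_left, Complex.conj_ofReal, inner_add_right,
      inner_smul_right, this, inner_mulL_left]
    push_cast
    ring
  constructor
  · rintro ⟨v, g⟩
    exact ⟨fun hv q hq => key _ _ _ _ hq hv, mem_aGraph_neg_of_inner hδ⟩
  · rintro ⟨u, f⟩
    constructor
    · intro hu q hq
      have := key _ _ _ _ hu hq
      rw [← inner_conj_symm, ← this, inner_conj_symm]
    · intro h
      have := mem_aGraph_neg_of_inner (neg_ne_zero.2 hδ) h
      rwa [neg_neg] at this

/-- The operator `(c tanh + δ ∂) (c tanh - δ ∂) = c² - c (c - δ) sech² - δ² ∂²`. -/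
lemma mem_relComp_aGraph {c δ : ℝ} (hδ : δ ≠ 0) {u f : L2} :
    (u, f) ∈ relComp (aGraph c δ) (aGraph c (-δ)) ↔
      ∃ p q, HasWeakDeriv u p ∧ HasWeakDeriv p q ∧
        f = (c : ℂ) ^ 2 • u - ((c : ℂ) * (c - δ)) • mulL (sechB 1) u - (δ : ℂ) ^ 2 • q := by
  have hδ' : (δ : ℂ) ≠ 0 := by exact_mod_cast hδ
  rw [mem_relComp]
  constructor
  · rintro ⟨k, h1, h2⟩
    obtain ⟨p, hp, rfl⟩ := mem_aGraph.1 h1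
    obtain ⟨r, hr, rfl⟩ := mem_aGraph.1 h2
    -- Regularity gain: both tanh·u and the intermediate vector lie in H¹, hence so does p, a
    -- combination of the two.
    have hq := ((hp.tanh.smul (c : ℂ)).sub hr).smul (δ : ℂ)⁻¹
    have e : (δ : ℂ)⁻¹ • ((c : ℂ) • mulL (tanhB 1) u -
        ((c : ℂ) • mulL (tanhB 1) u + ((-δ : ℝ) : ℂ) • p)) = p := by
      push_cast
      rw [sub_add_cancel_left, ← neg_smul, neg_neg, smul_smul, inv_mul_cancel₀ hδ', one_smul]
    rw [e] at hq
    refine ⟨p, _, hp, hq, ?_⟩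
    rw [smul_smul, pow_two (δ : ℂ), mul_assoc, mul_inv_cancel₀ hδ', mul_one]
    simp only [map_add, map_smul, mulL_tanhB_tanhB]
    push_cast
    module
  · rintro ⟨p, q, hp, hq, rfl⟩
    refine ⟨_, mem_aGraph.2 ⟨p, hp, rfl⟩, mem_aGraph.2
      ⟨_, (hp.tanh.smul (c : ℂ)).add (hq.smul ((-δ : ℝ) : ℂ)), ?_⟩⟩
    simp only [map_add, map_smul, mulL_tanhB_tanhB]
    push_cast
    module

/-- Shape invariance. -/
lemma shape_invariance {c ε : ℝ} (hε : ε ≠ 0) {u f : L2} :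
    (u, f) ∈ relComp (aGraph c ε) (aGraph c (-ε)) ↔
      (u, f + ((((c - ε) ^ 2 - c ^ 2 : ℝ)) : ℂ) • u) ∈
        relComp (aGraph (c - ε) (-ε)) (aGraph (c - ε) ε) := by
  -- With parameters (c − ε, −ε) the sech² coefficient is (c − ε)((c − ε) + ε) = c(c − ε), the same
  -- as for (c, ε).
  have h := mem_relComp_aGraph (c := c - ε) (neg_ne_zero.2 hε) (u := u)
    (f := f + ((((c - ε) ^ 2 - c ^ 2 : ℝ)) : ℂ) • u)
  rw [neg_neg] at h
  rw [h, mem_relComp_aGraph hε]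
  refine exists_congr fun p => exists_congr fun q => and_congr_right fun _ =>
    and_congr_right fun _ => ?_
  rw [← eq_sub_iff_add_eq]
  have e : ((c - ε : ℝ) : ℂ) ^ 2 • u - (((c - ε : ℝ) : ℂ) * ((c - ε : ℝ) - (-ε : ℝ))) •
      mulL (sechB 1) u - ((-ε : ℝ) : ℂ) ^ 2 • q - ((((c - ε) ^ 2 - c ^ 2 : ℝ)) : ℂ) • u
      = (c : ℂ) ^ 2 • u - ((c : ℂ) * (c - ε)) • mulL (sechB 1) u - (ε : ℂ) ^ 2 • q := by
    push_cast
    module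
  rw [e]

/-! ### Relations that differ by a scalar. -/

section Shift

variable {E : Type*} [NormedAddCommGroup E] [NormedSpace ℂ E] {G G' : Submodule ℂ (E × E)} {s : ℂ}

lemma IsReg.of_shift (h : ∀ x y, (x, y) ∈ G ↔ (x, y + s • x) ∈ G') {z : ℂ}
    (hr : IsReg G' (z + s)) : IsReg G z := by
  obtain ⟨⟨C, hC⟩, hs⟩ := hr
  refine ⟨⟨C, fun x y hxy => ?_⟩, fun y => ?_⟩
  · have := hC x _ ((h x y).1 hxy)
    rwa [show y + s • x - (z + s) • x = y - z • x by module] at this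
  · obtain ⟨x, hx⟩ := hs y
    refine ⟨x, (h _ _).2 ?_⟩
    rwa [show y + z • x + s • x = y + (z + s) • x by module]

lemma eigen_shift (h : ∀ x y, (x, y) ∈ G ↔ (x, y + s • x) ∈ G') (z : ℂ) :
    eigen G z = eigen G' (z + s) := by
  ext x
  rw [mem_eigen, mem_eigen, h, add_smul]

end Shift

/-- Expanding the square, ‖Bv‖² = c²‖v‖² + c(ε−c)∫sech²|v|² + ε²‖v'‖²; the middle term is
nonnegative exactly because c ≤ ε. -/
lemma norm_le_of_mem_aGraph {c ε : ℝ} (hc : 0 < c) (hcε : c ≤ ε) {v k : L2}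
    (h : (v, k) ∈ aGraph c (-ε)) : c * ‖v‖ ≤ ‖k‖ := by
  obtain ⟨p, hp, rfl⟩ := mem_aGraph.1 h
  apply le_of_sq_le_sq _ (norm_nonneg _)
  set s : ℝ := ∫ x, sechB 1 x * ‖v x‖ ^ 2 with hs
  have hs0 : 0 ≤ s := integral_nonneg fun x => mul_nonneg (sechB_nonneg _ _) (sq_nonneg _)
  have e1 := weakDeriv_skew hp hp.tanh
  rw [inner_add_right, inner_mulL_self, ← hs, ← inner_mulL_left] at e1
  -- This integrates (tanh·|v|²)' = sech²|v|² + 2 tanh·Re(v̄v').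
  have e2 : (⟪mulL (tanhB 1) v, p⟫_ℂ).re = - s / 2 := by
    have := congrArg Complex.re e1
    rw [Complex.neg_re, Complex.add_re, Complex.ofReal_re, ← inner_conj_symm, Complex.conj_re]
      at this
    rw [inner_mulL_left]
    linarith
  have e3 : ‖mulL (tanhB 1) v‖ ^ 2 = ‖v‖ ^ 2 - s := by
    have h1 : ⟪mulL (tanhB 1) v, mulL (tanhB 1) v⟫_ℂ = ⟪v, v⟫_ℂ - s := by
      rw [inner_mulL_left, mulL_tanhB_tanhB, inner_sub_right, inner_mulL_self]
    rw [inner_self_eq_norm_sq_to_K, inner_self_eq_norm_sq_to_K] at h1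
    apply Complex.ofReal_injective
    push_cast
    exact h1
  have e4 : ‖(c : ℂ) • mulL (tanhB 1) v + ((-ε : ℝ) : ℂ) • p‖ ^ 2
      = c ^ 2 * ‖v‖ ^ 2 + c * (ε - c) * s + ε ^ 2 * ‖p‖ ^ 2 := by
    rw [norm_add_sq (𝕜 := ℂ), norm_smul, norm_smul, inner_smul_left, inner_smul_right,
      Complex.conj_ofReal, Complex.norm_real, Complex.norm_real, mul_pow, mul_pow, e3]
    change _ + 2 * ((c : ℂ) * (((-ε : ℝ) : ℂ) * ⟪mulL (tanhB 1) v, p⟫_ℂ)).re + _ = _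
    rw [Complex.re_ofReal_mul, Complex.re_ofReal_mul, e2, Real.norm_eq_abs, Real.norm_eq_abs,
      sq_abs, sq_abs]
    ring
  rw [e4]
  have : 0 ≤ c * (ε - c) * s := mul_nonneg (mul_nonneg hc.le (sub_nonneg.2 hcε)) hs0
  nlinarith [sq_nonneg (ε * ‖p‖)]

/-! ### The point spectrum and the resolvent set by induction -/

/-- The expected eigenvalues of the first partner with parameter `c`. -/
def points (ε c : ℝ) : Set ℂ :=
  {z | ∃ k : ℕ, ε * k < c ∧ z = ((c ^ 2 - (c - ε * k) ^ 2 : ℝ) : ℂ)}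

lemma zero_mem_points {ε c : ℝ} (hc : 0 < c) : (0 : ℂ) ∈ points ε c :=
  ⟨0, by simpa using hc, by simp⟩

/-- c² − z is unchanged by the shift, and c − ε(k+1) = (c − ε) − εk: the k-th point for c − ε is the
(k+1)-st for c. -/
lemma mem_points_of_shift {ε c : ℝ} {z : ℂ}
    (h : z + (((c - ε) ^ 2 - c ^ 2 : ℝ) : ℂ) ∈ points ε (c - ε)) : z ∈ points ε c := by
  obtain ⟨k, hk, hz⟩ := h
  refine ⟨k + 1, ?_, ?_⟩
  · push_cast
    linarith
  · rw [← eq_sub_iff_add_eq] at hz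
    rw [hz]
    push_cast
    ring

lemma shift_mem_points {ε c : ℝ} {z : ℂ} (hz : z ≠ 0) (h : z ∈ points ε c) :
    z + (((c - ε) ^ 2 - c ^ 2 : ℝ) : ℂ) ∈ points ε (c - ε) := by
  obtain ⟨k, hk, rfl⟩ := h
  obtain ⟨j, rfl⟩ : ∃ j, k = j + 1 := by
    rcases k with _ | j
    · exact absurd (by simp) hz
    · exact ⟨j, rfl⟩
  refine ⟨j, ?_, ?_⟩
  · push_cast at hk
    linarith
  · push_cast
    ring

lemma eq_zero_of_mem_points {ε c : ℝ} (hε : 0 < ε) (hc : c ≤ ε) {z : ℂ} (h : z ∈ points ε c) :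
    z = 0 := by
  by_contra hz
  obtain ⟨k, hk, -⟩ := shift_mem_points hz h
  have : 0 ≤ ε * (k : ℝ) := by positivity
  linarith

/-- Induction on the number of rungs needed to bring c down to (0, ε]. The base case is coercivity.
In the step, regularity of D_{c−ε} gives that of B_{c−ε}A_{c−ε} by squaring, that of A_cB_c by shape
invariance, and finally the lower bound for D_c. Nonreal w are covered by self-adjointness. -/
lemma isReg_diracRel {ε : ℝ} (hε : 0 < ε) (n : ℕ) : ∀ c : ℝ, 0 < c → c ≤ (n + 1) * ε →
    ∀ w : ℂ, w ^ 2 ∉ points ε c → w ^ 2 ∉ Complex.ofReal '' Set.Ici (c ^ 2) →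
      IsReg (diracRel (aGraph c ε) (aGraph c (-ε))) w := by
  induction n with
  | zero =>
    intro c hc hcn w h1 h2
    have hadj := adjPair_aGraph (c := c) hε.ne'
    by_cases hw : w.im = 0
    · obtain ⟨r, rfl⟩ : ∃ r : ℝ, w = r := ⟨w.re, Complex.ext rfl (by simpa using hw)⟩
      have hr : r ≠ 0 := by
        rintro rfl
        exact h1 (by simpa using zero_mem_points hc)
      have hrc : |r| < c := by
        by_contra hle
        refine h2 ⟨r ^ 2, ?_, by push_cast; rfl⟩
        rw [Set.mem_Ici, ← sq_abs r]
        gcongr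
        exact not_lt.1 hle
      exact hadj.isReg_of_bddBelowAt (hadj.bddBelowAt_of_coercive hr hrc fun v k =>
        norm_le_of_mem_aGraph hc (by simpa using hcn))
    · exact hadj.isReg_of_im_ne_zero hw
  | succ n ih =>
    intro c hc hcn w h1 h2
    rcases le_or_gt c ((n + 1) * ε) with hle | hlt
    · exact ih c hc hle w h1 h2
    have hadj := adjPair_aGraph (c := c) hε.ne'
    by_cases hw : w.im = 0
    · obtain ⟨r, rfl⟩ : ∃ r : ℝ, w = r := ⟨w.re, Complex.ext rfl (by simpa using hw)⟩
      have hr : r ≠ 0 := by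
        rintro rfl
        exact h1 (by simpa using zero_mem_points hc)
      have hεc : 0 < c - ε := by nlinarith [(Nat.cast_nonneg n : (0 : ℝ) ≤ n)]
      -- The shifted value may be negative, so its square root is taken in ℂ; this is why the
      -- induction runs over complex w.
      obtain ⟨w', hw'⟩ := IsAlgClosed.exists_pow_nat_eq
        ((r : ℂ) ^ 2 + (((c - ε) ^ 2 - c ^ 2 : ℝ) : ℂ)) two_pos
      have hreg : IsReg (diracRel (aGraph (c - ε) ε) (aGraph (c - ε) (-ε))) w' := by
        apply ih (c - ε) hεc (by push_cast at hcn; linarith)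
        · rw [hw']
          exact fun h => h1 (mem_points_of_shift h)
        · rw [hw']
          rintro ⟨t, ht, hte⟩
          refine h2 ⟨r ^ 2, ?_, by push_cast; rfl⟩
          have : t = r ^ 2 + ((c - ε) ^ 2 - c ^ 2) := by exact_mod_cast hte
          rw [Set.mem_Ici] at ht ⊢
          linarith
      have h3 := (hreg.relComp_of_diracRel).of_diagRel.1
      rw [hw'] at h3
      have h4 := IsReg.of_shift (fun x y => shape_invariance hε.ne') h3
      exact hadj.isReg_of_bddBelowAt (hadj.bddBelowAt_of_isReg hr h4)
    · exact hadj.isReg_of_im_ne_zero hw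

/-! ### Zero modes -/

lemma contDiff_cosh_rpow (κ : ℝ) : ContDiff ℝ ∞ fun x => Real.cosh x ^ κ :=
  Real.contDiff_cosh.rpow_const_of_ne fun x => (Real.cosh_pos x).ne'

lemma hasDerivAt_cosh_rpow (κ x : ℝ) :
    HasDerivAt (fun x => Real.cosh x ^ κ) (κ * Real.tanh x * Real.cosh x ^ κ) x := by
  refine ((Real.hasDerivAt_cosh x).rpow_const (Or.inl (Real.cosh_pos x).ne')).congr_deriv ?_
  rw [Real.rpow_sub_one (Real.cosh_pos x).ne', Real.tanh_eq_sinh_div_cosh]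
  have := (Real.cosh_pos x).ne'
  field_simp

lemma exp_abs_le_two_mul_cosh (x : ℝ) : Real.exp |x| ≤ 2 * Real.cosh x := by
  rw [← Real.cosh_abs, Real.cosh_eq]
  linarith [Real.exp_pos (-|x|)]

lemma integrable_exp_neg_mul_abs {b : ℝ} (hb : 0 < b) :
    Integrable fun x : ℝ => Real.exp (-b * |x|) := by
  rw [← integrableOn_univ, ← Set.Iic_union_Ioi (a := (0 : ℝ))]
  refine IntegrableOn.union ?_ ?_
  · refine (integrableOn_exp_mul_Iic hb 0).congr_fun (fun x hx => ?_) measurableSet_Iic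
    change Real.exp (b * x) = Real.exp (-b * |x|)
    rw [abs_of_nonpos hx]
    ring_nf
  · refine (integrableOn_exp_mul_Ioi (neg_lt_zero.2 hb) 0).congr_fun (fun x hx => ?_)
      measurableSet_Ioi
    change Real.exp (-b * x) = Real.exp (-b * |x|)
    rw [abs_of_pos hx]

/-- From e^|x| ≤ 2 cosh x one gets cosh^(−2κ) ≤ 2^(2κ) e^(−2κ|x|). -/
lemma memLp_cosh_rpow {κ : ℝ} (hκ : 0 < κ) :
    MemLp (fun x => ((Real.cosh x ^ (-κ) : ℝ) : ℂ)) 2 volume := by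
  have hc : Continuous fun x => Real.cosh x ^ (-κ) := (contDiff_cosh_rpow _).continuous
  have hm : AEStronglyMeasurable (fun x => ((Real.cosh x ^ (-κ) : ℝ) : ℂ)) volume :=
    (Complex.continuous_ofReal.comp hc).aestronglyMeasurable
  rw [memLp_two_iff_integrable_sq_norm hm]
  refine ((integrable_exp_neg_mul_abs (b := 2 * κ) (by positivity)).const_mul
    (2 ^ (2 * κ))).mono' ?_ (Filter.Eventually.of_forall fun x => ?_)
  · exact ((Complex.continuous_ofReal.comp hc).norm.pow 2).aestronglyMeasurable
  · have hp := Real.cosh_pos x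
    rw [Complex.norm_real, Real.norm_eq_abs, Real.norm_eq_abs, sq_abs,
      abs_of_nonneg (sq_nonneg _), ← Real.rpow_natCast, ← Real.rpow_mul hp.le]
    have h1 := exp_abs_le_two_mul_cosh x
    have h2 : (2 * Real.cosh x) ^ (-(2 * κ)) ≤ Real.exp |x| ^ (-(2 * κ)) :=
      Real.rpow_le_rpow_of_nonpos (Real.exp_pos _) h1 (by linarith)
    rw [Real.mul_rpow two_pos.le hp.le, ← Real.exp_mul, Real.rpow_neg two_pos.le] at h2
    have h3 : (0 : ℝ) < 2 ^ (2 * κ) := by positivity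
    have h4 : -κ * ((2 : ℕ) : ℝ) = -(2 * κ) := by push_cast; ring
    have h5 : -(2 * κ) * |x| = |x| * -(2 * κ) := by ring
    rw [h4, h5]
    rwa [inv_mul_le_iff₀ h3] at h2

/-- The equation δu' = −c tanh·u has the integrating factor cosh^(c/δ). -/
lemma mul_eq_const_of_mem_aGraph {c δ : ℝ} (hδ : δ ≠ 0) {u : L2} (h : (u, 0) ∈ aGraph c δ) :
    ∃ C : ℂ, ∀ᵐ x, ((Real.cosh x ^ (c / δ) : ℝ) : ℂ) * u x = C := by
  obtain ⟨p, hp, he⟩ := mem_aGraph.1 h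
  refine hp.ae_mul_eq_const (contDiff_cosh_rpow _) ?_
  have hδ' : (δ : ℂ) ≠ 0 := by exact_mod_cast hδ
  have he' : p = (-(c / δ) : ℂ) • mulL (tanhB 1) u := by
    have h1 : (δ : ℂ)⁻¹ • ((c : ℂ) • mulL (tanhB 1) u + (δ : ℂ) • p) = 0 := by
      rw [← he, smul_zero]
    rw [smul_add, smul_smul, smul_smul, inv_mul_cancel₀ hδ', one_smul] at h1
    rw [neg_smul, eq_neg_iff_add_eq_zero, div_eq_inv_mul, add_comm]
    exact h1
  rw [he']
  filter_upwards [Lp.coeFn_smul (-(c / δ) : ℂ) (mulL (tanhB 1) u), coeFn_mulL (tanhB 1) u]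
    with x h1 h2
  rw [h1, Pi.smul_apply, h2, (hasDerivAt_cosh_rpow (c / δ) x).deriv, tanhB_apply, one_mul]
  push_cast
  rw [smul_eq_mul]
  ring

/-- The only candidate, cosh^(c/ε), grows; its integrating factor is at most 1 on the whole line. -/
lemma eq_zero_of_mem_aGraph_neg {c ε : ℝ} (hc : 0 < c) (hε : 0 < ε) {u : L2}
    (h : (u, 0) ∈ aGraph c (-ε)) : u = 0 := by
  obtain ⟨C, hC⟩ := mul_eq_const_of_mem_aGraph (neg_ne_zero.2 hε.ne') h
  refine ae_eq_zero_of_mul_eq_const MeasurableSet.univ (by simp)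
    (fun x => Real.rpow_pos_of_pos (Real.cosh_pos x) _) (fun x _ => ?_) hC
  apply Real.rpow_le_one_of_one_le_of_nonpos (Real.one_le_cosh x)
  rw [div_neg]
  exact neg_nonpos.2 (by positivity)

/-- By `AdjPair.mem_eigen_zero` this is the kernel of A, and it consists of the multiples of
cosh^(−c/ε), which is in L². -/
lemma finrank_eigen_zero {c ε : ℝ} (hc : 0 < c) (hε : 0 < ε) :
    Module.finrank ℂ (eigen (relComp (aGraph c (-ε)) (aGraph c ε)) 0) = 1 := by
  have hκ : 0 < c / ε := by positivity
  have hε' : (ε : ℂ) ≠ 0 := by exact_mod_cast hε.ne'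
  set g : ℝ → ℂ := fun x => ((Real.cosh x ^ (-(c / ε)) : ℝ) : ℂ) with hg
  have hgL : MemLp g 2 volume := memLp_cosh_rpow hκ
  have hgd : ∀ x, HasDerivAt g (((-(c / ε)) • tanhB 1) x * g x) x := by
    intro x
    have := (hasDerivAt_cosh_rpow (-(c / ε)) x).ofReal_comp
    refine this.congr_deriv ?_
    rw [BoundedContinuousFunction.smul_apply, tanhB_apply, one_mul, smul_eq_mul]
    push_cast
    rfl
  have hgc : Continuous g := continuous_iff_continuousAt.2 fun x => (hgd x).continuousAt
  have hW := hasWeakDeriv_toLp hgd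
    ((Complex.continuous_ofReal.comp ((-(c / ε)) • tanhB 1).continuous).mul hgc) hgL
    (memLp_mul _ hgL)
  have hmem : hgL.toLp _ ∈ eigen (relComp (aGraph c (-ε)) (aGraph c ε)) 0 := by
    rw [(adjPair_aGraph hε.ne').mem_eigen_zero, mem_aGraph]
    refine ⟨_, hW, ?_⟩
    have e : (memLp_mul ((-(c / ε)) • tanhB 1) hgL).toLp _
        = mulL ((-(c / ε)) • tanhB 1) (hgL.toLp _) := by
      apply Lp.ext
      filter_upwards [(memLp_mul ((-(c / ε)) • tanhB 1) hgL).coeFn_toLp,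
        coeFn_mulL ((-(c / ε)) • tanhB 1) (hgL.toLp _), hgL.coeFn_toLp] with x h1 h2 h3
      rw [h1, h2, h3]
    rw [e, mulL_smul, smul_smul]
    push_cast
    rw [mul_neg, mul_div_cancel₀ _ hε', neg_smul, add_neg_cancel]
  rw [finrank_eq_one_iff']
  refine ⟨⟨hgL.toLp _, hmem⟩, fun h0 => ?_, ?_⟩
  · have h1 : hgL.toLp _ = 0 := congrArg Subtype.val h0
    rw [Lp.eq_zero_iff_ae_eq_zero] at h1
    have h2 : ∀ᵐ _ : ℝ, False := by
      filter_upwards [h1, hgL.coeFn_toLp] with x hx hx'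
      rw [hx'] at hx
      have : Real.cosh x ^ (-(c / ε)) = 0 := by simpa [hg] using hx
      exact (Real.rpow_pos_of_pos (Real.cosh_pos x) _).ne' this
    rw [Filter.eventually_false_iff_eq_bot, ae_eq_bot] at h2
    exact NeZero.ne (volume : Measure ℝ) h2
  · rintro ⟨u, hu⟩
    rw [(adjPair_aGraph hε.ne').mem_eigen_zero] at hu
    obtain ⟨C, hC⟩ := mul_eq_const_of_mem_aGraph hε.ne' hu
    refine ⟨C, Subtype.ext ?_⟩
    change C • hgL.toLp _ = u
    apply Lp.ext
    filter_upwards [hC, Lp.coeFn_smul C (hgL.toLp _), hgL.coeFn_toLp] with x h1 h2 h3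
    rw [h2, Pi.smul_apply, h3, ← h1, smul_eq_mul, hg]
    have hp := Real.rpow_pos_of_pos (Real.cosh_pos x) (c / ε)
    have e : ((Real.cosh x ^ (c / ε) : ℝ) : ℂ) * ((Real.cosh x ^ (-(c / ε)) : ℝ) : ℂ) = 1 := by
      rw [Real.rpow_neg (Real.cosh_pos x).le, ← Complex.ofReal_mul, mul_inv_cancel₀ hp.ne',
        Complex.ofReal_one]
    linear_combination (u x) * e

/-! ### The virial argument for repulsive potentials -/

/-- With V = E − κ sech² the equation is ε²u'' = −Vu. The identity integrates the derivative of
tanh(ax)(ε²|u'|² + V|u|²): the terms with u''u' and Vuu' cancel and only the derivatives of tanh(ax)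
and of V remain. The bounded multiplier tanh(ax) replaces the usual x, so no weights are needed. -/
lemma virial_identity {ε κ E : ℝ} {u p q : L2} (hu : HasWeakDeriv u p) (hp : HasWeakDeriv p q)
    (heq : (ε : ℂ) ^ 2 • q = (κ : ℂ) • mulL (sechB 1) u - (E : ℂ) • u) (a : ℝ) :
    a * (ε ^ 2 * (∫ x, sechB a x * ‖p x‖ ^ 2) +
      ∫ x, (sechB a * (E • 1 - κ • sechB 1)) x * ‖u x‖ ^ 2) =
      -(2 * κ) * ∫ x, (tanhB a * (tanhB 1 * sechB 1)) x * ‖u x‖ ^ 2 := by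
  set V : ℝ →ᵇ ℝ := E • 1 - κ • sechB 1 with hV
  have heq' : (ε : ℂ) ^ 2 • q = -mulL V u := by
    rw [heq, hV, mulL_sub, mulL_smul, mulL_smul, mulL_one, neg_sub]
  set G : ℝ →ᵇ ℝ := tanhB a * V with hG
  set G' : ℝ →ᵇ ℝ := a • (sechB a * V) + (2 * κ) • (tanhB a * (tanhB 1 * sechB 1)) with hG'
  have hVs : ContDiff ℝ ∞ V := by
    have h1 : ContDiff ℝ ∞ fun x => E * (1 : ℝ) - κ * sechB 1 x :=
      contDiff_const.sub (contDiff_const.mul (contDiff_sechB 1))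
    exact h1
  have hVd : ∀ x, HasDerivAt V (2 * κ * (tanhB 1 x * sechB 1 x)) x := by
    intro x
    have h1 : HasDerivAt (fun x => E * (1 : ℝ) - κ * sechB 1 x)
        (-(κ * (((-2 * 1 : ℝ) • (tanhB 1 * sechB 1)) x))) x :=
      ((hasDerivAt_sechB 1 x).const_mul κ).const_sub _
    refine h1.congr_deriv ?_
    simp only [BoundedContinuousFunction.smul_apply, BoundedContinuousFunction.mul_apply,
      smul_eq_mul]
    ring
  have hGs : ContDiff ℝ ∞ G := (contDiff_tanhB a).mul hVs
  have hGd : ∀ x, HasDerivAt G (G' x) x := by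
    intro x
    refine ((hasDerivAt_tanhB a x).mul (hVd x)).congr_deriv ?_
    rw [hG']
    simp only [BoundedContinuousFunction.smul_apply, BoundedContinuousFunction.mul_apply,
      BoundedContinuousFunction.add_apply, smul_eq_mul]
    ring
  -- `i1` integrates (tanh(ax)|u'|²)' and `i2` integrates (tanh(ax)V|u|²)'.
  have i1 := weakDeriv_skew hp (hp.mulL (contDiff_tanhB a) (hasDerivAt_tanhB a))
  have i2 := weakDeriv_skew hu (hu.mulL hGs hGd)
  rw [inner_add_right, inner_mulL_self] at i1 i2
  have e1 : ⟪p, mulL G u⟫_ℂ = -((ε : ℂ) ^ 2 * ⟪p, mulL (tanhB a) q⟫_ℂ) := by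
    rw [hG, mulL_mul, ← inner_smul_right, ← map_smul, heq', map_neg, inner_neg_right, neg_neg]
  have e2 : ⟪u, mulL G p⟫_ℂ = -((ε : ℂ) ^ 2 * ⟪q, mulL (tanhB a) p⟫_ℂ) := by
    have : (ε : ℂ) ^ 2 * ⟪q, mulL (tanhB a) p⟫_ℂ = ⟪(ε : ℂ) ^ 2 • q, mulL (tanhB a) p⟫_ℂ := by
      rw [inner_smul_left, map_pow, Complex.conj_ofReal]
    rw [this, heq', inner_neg_left, neg_neg, inner_mulL_left, ← mulL_mul, hG, mul_comm]
  rw [e1, e2] at i2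
  have h1 : ∫ x, (a • sechB a) x * ‖p x‖ ^ 2 = a * ∫ x, sechB a x * ‖p x‖ ^ 2 := by
    rw [← integral_const_mul]
    congr 1
    ext x
    simp only [BoundedContinuousFunction.smul_apply, smul_eq_mul]
    ring
  have h2 : ∫ x, G' x * ‖u x‖ ^ 2 = a * (∫ x, (sechB a * V) x * ‖u x‖ ^ 2) +
      2 * κ * ∫ x, (tanhB a * (tanhB 1 * sechB 1)) x * ‖u x‖ ^ 2 := by
    rw [← integral_const_mul, ← integral_const_mul,
      ← integral_add ((integrable_mul_norm_sq _ u).const_mul _)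
        ((integrable_mul_norm_sq _ u).const_mul _)]
    congr 1
    ext x
    rw [hG']
    simp only [BoundedContinuousFunction.smul_apply, BoundedContinuousFunction.mul_apply,
      BoundedContinuousFunction.add_apply, smul_eq_mul]
    ring
  rw [h1] at i1
  rw [h2] at i2
  apply Complex.ofReal_injective
  push_cast at i1 i2 ⊢
  linear_combination (ε : ℂ) ^ 2 * i1 + i2

lemma tanh_mul_tanh_nonneg {a : ℝ} (ha : 0 ≤ a) (x : ℝ) :
    0 ≤ Real.tanh (a * x) * Real.tanh x := by
  have key : ∀ y : ℝ, 0 ≤ y → 0 ≤ Real.tanh y := fun y hy => by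
    rw [Real.tanh_eq_sinh_div_cosh]
    exact div_nonneg (Real.sinh_nonneg_iff.2 hy) (Real.cosh_pos y).le
  rcases le_total 0 x with h | h
  · exact mul_nonneg (key _ (mul_nonneg ha h)) (key _ h)
  · have h1 := key (a * -x) (mul_nonneg ha (neg_nonneg.2 h))
    have h2 := key (-x) (neg_nonneg.2 h)
    rw [mul_neg, Real.tanh_neg] at h1
    rw [Real.tanh_neg] at h2
    nlinarith

/-- Removes the cutoff from the virial identity: sech²(ax) tends to 1 as a → 0 and stays between 0
and 1. -/
lemma tendsto_integral_sechB {F : ℝ → ℝ} (hF : Integrable F) :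
    Filter.Tendsto (fun n : ℕ => ∫ x, sechB (1 / ((n : ℝ) + 1)) x * F x) Filter.atTop
      (𝓝 (∫ x, F x)) := by
  apply tendsto_integral_of_dominated_convergence (fun x => ‖F x‖)
  · intro n
    exact (sechB _).continuous.aestronglyMeasurable.mul hF.1
  · exact hF.norm
  · intro n
    refine Filter.Eventually.of_forall fun x => ?_
    rw [norm_mul, Real.norm_of_nonneg (sechB_nonneg _ _)]
    exact mul_le_of_le_one_left (norm_nonneg _) (sechB_le_one _ _)
  · refine Filter.Eventually.of_forall fun x => ?_
    have h1 : Continuous fun a : ℝ => (1 - Real.tanh (a * x) ^ 2) * F x :=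
      (continuous_const.sub ((continuous_tanh.comp (continuous_id.mul continuous_const)).pow 2)).mul
        continuous_const
    have h2 := (h1.tendsto 0).comp tendsto_one_div_add_atTop_nhds_zero_nat
    simp only [zero_mul, Real.tanh_zero, ne_eq, OfNat.ofNat_ne_zero, not_false_eq_true, zero_pow,
      sub_zero, one_mul] at h2
    refine h2.congr fun n => ?_
    simp only [Function.comp, sechB_apply]

/-- `-ε² ∂² + κ sech²` with `κ ≥ 0` has no eigenvalues. -/
lemma eq_zero_of_repulsive {ε κ E : ℝ} (hε : ε ≠ 0) (hκ : 0 ≤ κ) {u p q : L2}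
    (hu : HasWeakDeriv u p) (hp : HasWeakDeriv p q)
    (heq : (ε : ℂ) ^ 2 • q = (κ : ℂ) • mulL (sechB 1) u - (E : ℂ) • u) : u = 0 := by
  set V : ℝ →ᵇ ℝ := E • 1 - κ • sechB 1 with hV
  have hi1 : Integrable fun x => ε ^ 2 * ‖p x‖ ^ 2 := (integrable_norm_sq p).const_mul _
  have hi2 : Integrable fun x => V x * ‖u x‖ ^ 2 := integrable_mul_norm_sq V u
  set F : ℝ → ℝ := fun x => ε ^ 2 * ‖p x‖ ^ 2 + V x * ‖u x‖ ^ 2 with hF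
  have hFi : Integrable F := hi1.add hi2
  -- For κ ≥ 0 the right side of the virial identity is nonpositive, as tanh(ax) and tanh x have the
  -- same sign; then a → 0.
  have hle : ∫ x, F x ≤ 0 := by
    refine le_of_tendsto (tendsto_integral_sechB hFi) (Filter.Eventually.of_forall fun n => ?_)
    set a : ℝ := 1 / ((n : ℝ) + 1) with ha
    have ha0 : 0 < a := by positivity
    have hv := virial_identity hu hp heq a
    have hr : 0 ≤ ∫ x, (tanhB a * (tanhB 1 * sechB 1)) x * ‖u x‖ ^ 2 := by
      refine integral_nonneg fun x => mul_nonneg ?_ (sq_nonneg _)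
      simp only [BoundedContinuousFunction.mul_apply]
      rw [← mul_assoc]
      refine mul_nonneg ?_ (sechB_nonneg _ _)
      simpa [tanhB_apply] using tanh_mul_tanh_nonneg ha0.le x
    have e : ∫ x, sechB a x * F x = ε ^ 2 * (∫ x, sechB a x * ‖p x‖ ^ 2) +
        ∫ x, (sechB a * V) x * ‖u x‖ ^ 2 := by
      rw [← integral_const_mul, ← integral_add ((integrable_mul_norm_sq _ p).const_mul _)
        (integrable_mul_norm_sq _ u)]
      congr 1
      ext x
      simp only [hF, BoundedContinuousFunction.mul_apply]
      ring
    rw [← e] at hv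
    have h3 : a * ∫ x, sechB a x * F x ≤ 0 := by
      rw [hv, neg_mul]
      exact neg_nonpos.2 (mul_nonneg (by positivity) hr)
    by_contra hlt
    exact absurd h3 (not_le.2 (mul_pos ha0 (not_le.1 hlt)))
  -- Pairing the equation with u shows that the two parts of ∫F are equal, so 2ε²‖u'‖² ≤ 0.
  have hform : ε ^ 2 * ‖p‖ ^ 2 = ∫ x, V x * ‖u x‖ ^ 2 := by
    have h1 := weakDeriv_skew hu hp
    have h2 : (ε : ℂ) ^ 2 * ⟪p, p⟫_ℂ = ⟪u, mulL V u⟫_ℂ := by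
      rw [h1, mul_neg, ← inner_smul_right, heq, ← inner_neg_right, neg_sub, hV, mulL_sub,
        mulL_smul, mulL_smul, mulL_one]
    rw [inner_mulL_self, inner_self_eq_norm_sq_to_K] at h2
    apply Complex.ofReal_injective
    push_cast at h2 ⊢
    exact h2
  have hsum : ∫ x, F x = 2 * (ε ^ 2 * ‖p‖ ^ 2) := by
    rw [hF, integral_add hi1 hi2, integral_const_mul, ← norm_sq_eq_integral, ← hform]
    ring
  have hp0 : p = 0 := by
    rw [hsum] at hle
    have hε2 : 0 < ε ^ 2 := by positivity
    have : ‖p‖ ^ 2 ≤ 0 := by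
      by_contra hlt
      have := mul_pos hε2 (not_le.1 hlt)
      linarith
    have h0 : ‖p‖ = 0 := by nlinarith [norm_nonneg p]
    exact norm_eq_zero.1 h0
  subst hp0
  exact hu.eq_zero_of_zero

/-- Eigenvalues of A_cB_c are real, and the eigenvalue equation is the repulsive one with κ = c(ε −
c) ≥ 0 and energy E = r − c². -/
lemma eigen_eq_bot_of_le {ε c : ℝ} (hε : 0 < ε) (hc : 0 < c) (hcε : c ≤ ε) (z : ℂ) :
    eigen (relComp (aGraph c ε) (aGraph c (-ε))) z = ⊥ := by
  by_contra hne
  have hadj := (adjPair_aGraph (c := c) hε.ne').symm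
  obtain ⟨r, -, rfl⟩ := hadj.exists_nonneg_of_eigen_ne_bot hne
  apply hne
  rw [Submodule.eq_bot_iff]
  intro u hu
  rw [mem_eigen, mem_relComp_aGraph hε.ne'] at hu
  obtain ⟨p, q, hp, hq, he⟩ := hu
  refine eq_zero_of_repulsive (κ := c * (ε - c)) (E := r - c ^ 2) hε.ne'
    (mul_nonneg hc.le (sub_nonneg.2 hcε)) hp hq ?_
  have he' : (ε : ℂ) ^ 2 • q = (c : ℂ) ^ 2 • u - ((c : ℂ) * (c - ε)) • mulL (sechB 1) u
      - (r : ℂ) • u := by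
    rw [he]
    abel
  rw [he']
  push_cast
  module

/-- The same induction as for the resolvent set. A nonzero eigenvalue passes from B_cA_c to A_cB_c
and by shape invariance to B_{c−ε}A_{c−ε}; zero is accounted for by the zero mode. In the base case
nothing else is left. -/
lemma eigen_relComp {ε : ℝ} (hε : 0 < ε) (n : ℕ) : ∀ c : ℝ, 0 < c → c ≤ (n + 1) * ε → ∀ z : ℂ,
    (z ∈ points ε c →
      Module.finrank ℂ (eigen (relComp (aGraph c (-ε)) (aGraph c ε)) z) = 1) ∧
    (z ∉ points ε c → eigen (relComp (aGraph c (-ε)) (aGraph c ε)) z = ⊥) := by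
  induction n with
  | zero =>
    intro c hc hcn z
    have hcε : c ≤ ε := by simpa using hcn
    refine ⟨fun hz => ?_, fun hz => ?_⟩
    · rw [eq_zero_of_mem_points hε hcε hz]
      exact finrank_eigen_zero hc hε
    · have hz0 : z ≠ 0 := by
        rintro rfl
        exact hz (zero_mem_points hc)
      obtain ⟨e⟩ := (adjPair_aGraph (c := c) hε.ne').nonempty_equiv hz0
      have hb := eigen_eq_bot_of_le hε hc hcε z
      rw [← Submodule.subsingleton_iff_eq_bot] at hb ⊢
      exact e.toEquiv.subsingleton
  | succ n ih =>
    intro c hc hcn z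
    rcases le_or_gt c ((n + 1) * ε) with hle | hlt
    · exact ih c hc hle z
    have hεc : 0 < c - ε := by nlinarith [(Nat.cast_nonneg n : (0 : ℝ) ≤ n)]
    have hih := ih (c - ε) hεc (by push_cast at hcn; linarith)
      (z + (((c - ε) ^ 2 - c ^ 2 : ℝ) : ℂ))
    rw [← eigen_shift (fun x y => shape_invariance (c := c) hε.ne')] at hih
    refine ⟨fun hz => ?_, fun hz => ?_⟩
    · rcases eq_or_ne z 0 with rfl | hz0
      · exact finrank_eigen_zero hc hε
      obtain ⟨e⟩ := (adjPair_aGraph (c := c) hε.ne').nonempty_equiv hz0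
      rw [e.finrank_eq]
      exact hih.1 (shift_mem_points hz0 hz)
    · have hz0 : z ≠ 0 := by
        rintro rfl
        exact hz (zero_mem_points hc)
      obtain ⟨e⟩ := (adjPair_aGraph (c := c) hε.ne').nonempty_equiv hz0
      have hb := hih.2 fun h => hz (mem_points_of_shift h)
      rw [← Submodule.subsingleton_iff_eq_bot] at hb ⊢
      exact e.toEquiv.subsingleton

/-! ### Singular sequences -/

/-- A crude rate suffices: where the packets live, x ≥ 1/b, the potential is O(b), the same order as
the error from the envelope. -/
lemma sechB_one_le {x : ℝ} (hx : 0 < x) : sechB 1 x ≤ 2 / x := by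
  have h1 : sechB 1 x = 1 / Real.cosh x ^ 2 := by
    rw [sechB_apply, one_mul, Real.tanh_eq_sinh_div_cosh]
    have := (Real.cosh_pos x).ne'
    field_simp
    linarith [Real.cosh_sq x]
  have h2 := exp_abs_le_two_mul_cosh x
  rw [abs_of_pos hx] at h2
  have h3 := Real.add_one_le_exp x
  have h4 := Real.one_le_cosh x
  rw [h1, div_le_div_iff₀ (by positivity) hx]
  nlinarith

/-- The wave packet `e^{ikx} ψ(b x - 3)`. -/
def packet (k b : ℝ) (ψ : ℝ → ℂ) (x : ℝ) : ℂ :=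
  Complex.exp (Complex.I * k * x) * ψ (b * x - 3)

lemma norm_packet (k b : ℝ) (ψ : ℝ → ℂ) (x : ℝ) : ‖packet k b ψ x‖ = ‖ψ (b * x - 3)‖ := by
  have : Complex.I * k * x = ((k * x : ℝ) : ℂ) * Complex.I := by
    push_cast
    ring
  rw [packet, norm_mul, this, Complex.norm_exp_ofReal_mul_I, one_mul]

lemma continuous_packet (k b : ℝ) {ψ : ℝ → ℂ} (h : Continuous ψ) : Continuous (packet k b ψ) := by
  unfold packet
  fun_prop

/-- The offset 3 exceeds the support radius 2, so the packet lies in [1/b, 5/b] and escapes to +∞ as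
b → 0. -/
lemma packet_eq_zero {k b : ℝ} (hb : 0 < b) {ψ : ℝ → ℂ} (h : ∀ y, 2 < |y| → ψ y = 0) {x : ℝ}
    (hx : x ∉ Set.Icc (1 / b) (5 / b)) : packet k b ψ x = 0 := by
  rw [packet, h, mul_zero]
  rw [Set.mem_Icc, not_and_or, not_le, not_le, lt_div_iff₀ hb, div_lt_iff₀ hb] at hx
  rw [lt_abs]
  rcases hx with hx | hx
  · right; linarith
  · left; linarith

lemma memLp_packet {k b : ℝ} (hb : 0 < b) {ψ : ℝ → ℂ} (hc : Continuous ψ)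
    (h : ∀ y, 2 < |y| → ψ y = 0) : MemLp (packet k b ψ) 2 volume :=
  (continuous_packet k b hc).memLp_of_hasCompactSupport
    (HasCompactSupport.intro isCompact_Icc fun _ hx => packet_eq_zero hb h hx)

/-- The derivative is again a packet, with profile ikψ + bψ', so second derivatives come by
iteration. -/
lemma hasDerivAt_packet (k b : ℝ) {ψ ψ' : ℝ → ℂ} (h : ∀ y, HasDerivAt ψ (ψ' y) y) (x : ℝ) :
    HasDerivAt (packet k b ψ) (packet k b (fun y => Complex.I * k * ψ y + b * ψ' y) x) x := by
  have h1 : HasDerivAt (fun x : ℝ => Complex.exp (Complex.I * k * x))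
      (Complex.exp (Complex.I * k * x) * (Complex.I * k)) x := by
    have := ((hasDerivAt_id x).ofReal_comp.const_mul (Complex.I * k)).cexp
    simpa using this
  have h2 : HasDerivAt (fun x : ℝ => b * x - 3) b x := by
    simpa using ((hasDerivAt_id x).const_mul b).sub_const 3
  have h3 : HasDerivAt (fun x => ψ (b * x - 3)) (b • ψ' (b * x - 3)) x :=
    (h (b * x - 3)).scomp x h2
  refine (h1.mul h3).congr_deriv ?_
  rw [packet, Complex.real_smul]
  ring

/-- A plateau function and its first two derivatives. -/
lemma exists_plateau : ∃ (χ χ₁ χ₂ : ℝ → ℂ) (M : ℝ), (∀ y, HasDerivAt χ (χ₁ y) y) ∧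
    (∀ y, HasDerivAt χ₁ (χ₂ y) y) ∧ Continuous χ₂ ∧ (∀ y, 2 < |y| → χ y = 0) ∧
    (∀ y, 2 < |y| → χ₁ y = 0) ∧ (∀ y, 2 < |y| → χ₂ y = 0) ∧ (∀ y, |y| ≤ 1 → χ y = 1) ∧
    (∀ y, ‖χ y‖ ≤ 1) ∧ (∀ y, ‖χ₁ y‖ ≤ M) ∧ (∀ y, ‖χ₂ y‖ ≤ M) := by
  let β : ContDiffBump (0 : ℝ) := ⟨1, 2, one_pos, one_lt_two⟩
  have hβ : ContDiff ℝ ∞ β := β.contDiff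
  have hβ1 : ContDiff ℝ ∞ (deriv β) := (contDiff_infty_iff_deriv.1 hβ).2
  have hβ2 : ContDiff ℝ ∞ (deriv (deriv β)) := (contDiff_infty_iff_deriv.1 hβ1).2
  have hts : tsupport β = Metric.closedBall 0 2 := β.tsupport_eq
  have hs0 : ∀ y : ℝ, 2 < |y| → y ∉ tsupport β := by
    intro y hy
    rw [hts, mem_closedBall_zero_iff, Real.norm_eq_abs]
    exact not_le.2 hy
  have hs1 : tsupport (deriv β) ⊆ tsupport β := closure_minimal support_deriv_subset isClosed_closure
  obtain ⟨M₁, hM₁⟩ := hβ1.continuous.bounded_above_of_compact_support β.hasCompactSupport.deriv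
  obtain ⟨M₂, hM₂⟩ :=
    hβ2.continuous.bounded_above_of_compact_support β.hasCompactSupport.deriv.deriv
  refine ⟨fun y => (β y : ℂ), fun y => ((deriv β y : ℝ) : ℂ), fun y => ((deriv (deriv β) y : ℝ) : ℂ),
    max M₁ M₂, fun y => ?_, fun y => ?_, ?_, fun y hy => ?_, fun y hy => ?_, fun y hy => ?_,
    fun y hy => ?_, fun y => ?_, fun y => ?_, fun y => ?_⟩
  · exact ((hβ.differentiable (by simp)) y).hasDerivAt.ofReal_comp
  · exact ((hβ1.differentiable (by simp)) y).hasDerivAt.ofReal_comp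
  · exact Complex.continuous_ofReal.comp hβ2.continuous
  · exact Complex.ofReal_eq_zero.2 (image_eq_zero_of_notMem_tsupport (hs0 y hy))
  · exact Complex.ofReal_eq_zero.2 (image_eq_zero_of_notMem_tsupport fun h => hs0 y hy (hs1 h))
  · have : deriv (deriv β) y = 0 := by
      by_contra hne
      exact hs0 y hy (hs1 (support_deriv_subset hne))
    exact Complex.ofReal_eq_zero.2 this
  · have : β y = 1 := β.one_of_mem_closedBall (by
      rw [mem_closedBall_zero_iff, Real.norm_eq_abs]
      exact hy)
    exact Complex.ofReal_eq_one.2 this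
  · rw [Complex.norm_real, Real.norm_of_nonneg β.nonneg]
    exact β.le_one
  · rw [Complex.norm_real]
    exact (hM₁ y).trans (le_max_left _ _)
  · rw [Complex.norm_real]
    exact (hM₂ y).trans (le_max_right _ _)

lemma norm_sq_le_of_ae_bound {f : L2} {a b s : ℝ} (hab : a ≤ b)
    (h : ∀ᵐ x, ‖f x‖ ^ 2 ≤ (Set.Icc a b).indicator (fun _ => s) x) :
    ‖f‖ ^ 2 ≤ (b - a) * s := by
  rw [norm_sq_eq_integral]
  have hi : Integrable ((Set.Icc a b).indicator fun _ : ℝ => s) :=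
    (integrableOn_const (by simp)).integrable_indicator measurableSet_Icc
  refine (integral_mono_ae (integrable_norm_sq f) hi h).trans ?_
  rw [integral_indicator measurableSet_Icc, setIntegral_const, smul_eq_mul,
    Measure.real, Real.volume_Icc, ENNReal.toReal_ofReal (sub_nonneg.2 hab)]

lemma le_norm_sq_of_ae_bound {f : L2} {a b s : ℝ} (hab : a ≤ b)
    (h : ∀ᵐ x, (Set.Icc a b).indicator (fun _ => s) x ≤ ‖f x‖ ^ 2) :
    (b - a) * s ≤ ‖f‖ ^ 2 := by
  rw [norm_sq_eq_integral]
  have hi : Integrable ((Set.Icc a b).indicator fun _ : ℝ => s) :=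
    (integrableOn_const (by simp)).integrable_indicator measurableSet_Icc
  refine le_trans ?_ (integral_mono_ae hi (integrable_norm_sq f) h)
  rw [integral_indicator measurableSet_Icc, setIntegral_const, smul_eq_mul,
    Measure.real, Real.volume_Icc, ENNReal.toReal_ofReal (sub_nonneg.2 hab)]

/-- The modulus is 1 on [2/b, 4/b], an interval of length 2/b, while the error is at most bK on
[1/b, 5/b], of length 4/b, and zero elsewhere. The relative error is therefore O(b). -/
lemma exists_singular_packet {ε : ℝ} (hε : 0 < ε) (k : ℝ) : ∃ K : ℝ, ∀ b : ℝ, 0 < b → b ≤ 1 →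
    ∃ u f : L2, (u, f) ∈ relComp (aGraph 1 (-ε)) (aGraph 1 ε) ∧ 2 / b ≤ ‖u‖ ^ 2 ∧
      ‖f - ((1 + ε ^ 2 * k ^ 2 : ℝ) : ℂ) • u‖ ^ 2 ≤ 4 / b * (b * K) ^ 2 := by
  obtain ⟨χ, χ₁, χ₂, M, hd, hd₁, hc₂, hz, hz₁, hz₂, hone, hle, hM₁, hM₂⟩ := exists_plateau
  have hM0 : 0 ≤ M := (norm_nonneg _).trans (hM₁ 0)
  have hc : Continuous χ := continuous_iff_continuousAt.2 fun x => (hd x).continuousAt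
  have hc₁ : Continuous χ₁ := continuous_iff_continuousAt.2 fun x => (hd₁ x).continuousAt
  -- The first summand bounds the potential, with (1+ε) sech² ≤ 2b(1+ε); the second bounds the terms
  -- in which a derivative hits the envelope, using b ≤ 1.
  refine ⟨2 * (1 + ε) + ε ^ 2 * (2 * |k| + 1) * M, fun b hb hb1 => ?_⟩
  set K := 2 * (1 + ε) + ε ^ 2 * (2 * |k| + 1) * M with hK
  set η₁ : ℝ → ℂ := fun y => Complex.I * k * χ y + b * χ₁ y with hη₁
  set η₁' : ℝ → ℂ := fun y => Complex.I * k * χ₁ y + b * χ₂ y with hη₁'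
  set η₂ : ℝ → ℂ := fun y => Complex.I * k * η₁ y + b * η₁' y with hη₂
  have hη₁d : ∀ y, HasDerivAt η₁ (η₁' y) y := fun y =>
    ((hd y).const_mul _).add ((hd₁ y).const_mul _)
  have hη₁c : Continuous η₁ := by fun_prop
  have hη₂c : Continuous η₂ := by fun_prop
  have hη₁z : ∀ y, 2 < |y| → η₁ y = 0 := fun y hy => by simp [hη₁, hz y hy, hz₁ y hy]
  have hη₂z : ∀ y, 2 < |y| → η₂ y = 0 := fun y hy => by
    simp [hη₂, hη₁', hη₁z y hy, hz₂ y hy, hz₁ y hy]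
  have m0 := memLp_packet (k := k) hb hc hz
  have m1 := memLp_packet (k := k) hb hη₁c hη₁z
  have m2 := memLp_packet (k := k) hb hη₂c hη₂z
  have w1 : HasWeakDeriv (m0.toLp _) (m1.toLp _) :=
    hasWeakDeriv_toLp (hasDerivAt_packet k b hd) (continuous_packet k b hη₁c) m0 m1
  have w2 : HasWeakDeriv (m1.toLp _) (m2.toLp _) :=
    hasWeakDeriv_toLp (hasDerivAt_packet k b hη₁d) (continuous_packet k b hη₂c) m1 m2
  set u := m0.toLp _ with hu
  set q := m2.toLp _ with hq
  have hmem := (mem_relComp_aGraph (c := 1) (neg_ne_zero.2 hε.ne') (u := u)).2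
    ⟨_, _, w1, w2, rfl⟩
  rw [neg_neg] at hmem
  refine ⟨u, _, hmem, ?_, ?_⟩
  · have : 2 / b = (4 / b - 2 / b) * 1 := by ring
    rw [this]
    refine le_norm_sq_of_ae_bound (by gcongr; norm_num) ?_
    filter_upwards [m0.coeFn_toLp] with x hx
    rw [hx, norm_packet]
    by_cases hxm : x ∈ Set.Icc (2 / b) (4 / b)
    · rw [Set.indicator_of_mem hxm, hone]
      · simp
      · rw [Set.mem_Icc, div_le_iff₀ hb, le_div_iff₀ hb] at hxm
        rw [abs_le]
        constructor <;> linarith [hxm.1, hxm.2]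
    · rw [Set.indicator_of_notMem hxm]
      positivity
  · have : 4 / b * (b * K) ^ 2 = (5 / b - 1 / b) * (b * K) ^ 2 := by ring
    rw [this]
    refine norm_sq_le_of_ae_bound (by gcongr; norm_num) ?_
    -- The profile (ik + b∂)²χ without (ik)²χ, whose contribution cancels against the kinetic energy
    -- ε²k².
    set ζ : ℝ → ℂ := fun y => 2 * Complex.I * k * b * χ₁ y + (b : ℂ) ^ 2 * χ₂ y with hζ
    have e : ((1 : ℝ) : ℂ) ^ 2 • u - (((1 : ℝ) : ℂ) * (((1 : ℝ) : ℂ) - ((-ε : ℝ) : ℂ))) •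
        mulL (sechB 1) u - ((-ε : ℝ) : ℂ) ^ 2 • q - ((1 + ε ^ 2 * k ^ 2 : ℝ) : ℂ) • u
        = (-((ε : ℂ) ^ 2 * k ^ 2)) • u + (-(1 + ε : ℂ)) • mulL (sechB 1) u
          + (-(ε : ℂ) ^ 2) • q := by
      push_cast
      module
    rw [e]
    filter_upwards [m0.coeFn_toLp, m2.coeFn_toLp, coeFn_mulL (sechB 1) u,
      Lp.coeFn_add ((-((ε : ℂ) ^ 2 * k ^ 2)) • u + (-(1 + ε : ℂ)) • mulL (sechB 1) u)
        ((-(ε : ℂ) ^ 2) • q),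
      Lp.coeFn_add ((-((ε : ℂ) ^ 2 * k ^ 2)) • u) ((-(1 + ε : ℂ)) • mulL (sechB 1) u),
      Lp.coeFn_smul (-((ε : ℂ) ^ 2 * k ^ 2)) u, Lp.coeFn_smul (-(1 + ε : ℂ)) (mulL (sechB 1) u),
      Lp.coeFn_smul (-(ε : ℂ) ^ 2) q] with x h1 h2 h3 h4 h5 h6 h7 h8
    rw [h4, Pi.add_apply, h5, Pi.add_apply, h6, h7, h8, Pi.smul_apply, Pi.smul_apply,
      Pi.smul_apply, h3, h1, h2]
    have e2 : (-((ε : ℂ) ^ 2 * k ^ 2)) • packet k b χ x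
        + (-(1 + ε : ℂ)) • ((sechB 1 x : ℂ) * packet k b χ x) + (-(ε : ℂ) ^ 2) • packet k b η₂ x
        = -(((1 + ε : ℝ) : ℂ) * (sechB 1 x : ℂ) * packet k b χ x
          + ((ε ^ 2 : ℝ) : ℂ) * packet k b ζ x) := by
      simp only [packet, hη₂, hη₁, hη₁', hζ, smul_eq_mul]
      push_cast
      linear_combination (-(ε : ℂ) ^ 2 * Complex.exp (Complex.I * k * x) * k ^ 2 *
        χ (b * x - 3)) * Complex.I_sq
    rw [e2, norm_neg]
    by_cases hxm : x ∈ Set.Icc (1 / b) (5 / b)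
    · rw [Set.indicator_of_mem hxm]
      have hx0 : 1 / b ≤ x := hxm.1
      have hxp : 0 < x := (by positivity : (0 : ℝ) < 1 / b).trans_le hx0
      have hS : sechB 1 x ≤ 2 * b := by
        refine (sechB_one_le hxp).trans ?_
        rw [div_le_iff₀ hxp]
        rw [div_le_iff₀ hb] at hx0
        linarith
      have hζM : ‖ζ (b * x - 3)‖ ≤ b * ((2 * |k| + 1) * M) := by
        have n1 : ‖(2 * Complex.I * k * b : ℂ)‖ = 2 * |k| * b := by
          simp [abs_of_pos hb]
        have n2 : ‖((b : ℂ) ^ 2)‖ = b ^ 2 := by simp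
        calc ‖ζ (b * x - 3)‖ ≤ 2 * |k| * b * M + b ^ 2 * M := by
              refine (norm_add_le _ _).trans ?_
              rw [norm_mul _ (χ₁ _), norm_mul _ (χ₂ _), n1, n2]
              gcongr
              · exact hM₁ _
              · exact hM₂ _
          _ ≤ 2 * |k| * b * M + b * M := by
              gcongr
              nlinarith
          _ = _ := by ring
      gcongr
      calc ‖((1 + ε : ℝ) : ℂ) * (sechB 1 x : ℂ) * packet k b χ x
            + ((ε ^ 2 : ℝ) : ℂ) * packet k b ζ x‖
          ≤ (1 + ε) * sechB 1 x * ‖χ (b * x - 3)‖ + ε ^ 2 * ‖ζ (b * x - 3)‖ := by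
            refine (norm_add_le _ _).trans ?_
            rw [norm_mul, norm_mul, norm_mul, norm_packet, norm_packet, Complex.norm_real,
              Complex.norm_real, Complex.norm_real, Real.norm_of_nonneg (by positivity),
              Real.norm_of_nonneg (sechB_nonneg _ _), Real.norm_of_nonneg (by positivity)]
        _ ≤ (1 + ε) * (2 * b) * 1 + ε ^ 2 * (b * ((2 * |k| + 1) * M)) := by
            have := sechB_nonneg 1 x
            gcongr
            exact hle _
        _ = b * K := by
            rw [hK]
            ring
    · rw [Set.indicator_of_notMem hxm, packet_eq_zero hb hz hxm, packet_eq_zero hb (fun y hy => by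
        simp [hζ, hz₁ y hy, hz₂ y hy]) hxm]
      simp

lemma not_bddBelowAt_of_one_le {ε : ℝ} (hε : 0 < ε) {z : ℝ} (hz : 1 ≤ z) :
    ¬ BddBelowAt (relComp (aGraph 1 (-ε)) (aGraph 1 ε)) z := by
  intro h
  obtain ⟨C, hC, h⟩ := h.exists_pos
  -- The wave number solves 1 + ε²k² = z; the threshold z = 1 is included with k = 0.
  obtain ⟨K, hK⟩ := exists_singular_packet hε (√(z - 1) / ε)
  have hz' : 1 + ε ^ 2 * (√(z - 1) / ε) ^ 2 = z := by
    rw [div_pow, Real.sq_sqrt (sub_nonneg.2 hz)]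
    field_simp
    ring
  rw [hz'] at hK
  -- A lower bound would force 1 ≤ 2C²K²b², whereas this b makes 2C²K²b < 1 and b ≤ 1.
  set b : ℝ := 1 / (1 + 2 * C ^ 2 * K ^ 2) with hb
  have hD : 0 ≤ 2 * C ^ 2 * K ^ 2 := by positivity
  have hb0 : 0 < b := by positivity
  have hb1 : b ≤ 1 := by
    rw [hb, div_le_one (by positivity)]
    linarith
  obtain ⟨u, f, hmem, h1, h2⟩ := hK b hb0 hb1
  have h3 := h u f hmem
  have h4 : ‖u‖ ^ 2 ≤ C ^ 2 * (4 / b * (b * K) ^ 2) := by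
    calc ‖u‖ ^ 2 ≤ (C * ‖f - (z : ℂ) • u‖) ^ 2 := by gcongr
      _ = C ^ 2 * ‖f - (z : ℂ) • u‖ ^ 2 := by ring
      _ ≤ _ := by gcongr
  have h5 : 2 / b ≤ C ^ 2 * (4 / b * (b * K) ^ 2) := h1.trans h4
  have h6 : C ^ 2 * (4 / b * (b * K) ^ 2) = 2 / b * ((2 * C ^ 2 * K ^ 2) * b * b) := by
    field_simp
    ring
  rw [h6] at h5
  have h7 : 1 ≤ (2 * C ^ 2 * K ^ 2) * b * b :=
    le_of_mul_le_mul_left (by linarith) (show 0 < 2 / b by positivity)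
  have h8 : (2 * C ^ 2 * K ^ 2) * b < 1 := by
    rw [hb, mul_one_div, div_lt_one (by positivity)]
    linarith
  nlinarith

/-! ### The graphs of the Dirac operator, its square and the entries of the square -/

lemma graph_offDiag (A B : L2 →ₗ.[ℂ] L2) : (offDiag A B).graph = diracRel A.graph B.graph := by
  ext ⟨Ψ, Φ⟩
  rw [LinearPMap.mem_graph_iff, mem_diracRel, LinearPMap.mem_graph_iff, LinearPMap.mem_graph_iff]
  constructor
  · rintro ⟨⟨x, hx⟩, rfl, rfl⟩
    exact ⟨⟨⟨x.fst, hx.1⟩, rfl, rfl⟩, ⟨⟨x.snd, hx.2⟩, rfl, rfl⟩⟩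
  · rintro ⟨⟨⟨u, hu⟩, h1, h2⟩, ⟨⟨v, hv⟩, h3, h4⟩⟩
    simp only at h1 h3
    subst h1 h3
    refine ⟨⟨Ψ, hu, hv⟩, rfl, ?_⟩
    change WithLp.toLp 2 (B ⟨Ψ.snd, hv⟩, A ⟨Ψ.fst, hu⟩) = Φ
    rw [h2, h4]
    rfl

lemma mulOp_tanh_domain (u : L2) : u ∈ (mulOp Real.tanh).domain := by
  have := memLp_mul (tanhB 1) (Lp.memLp u)
  simp only [tanhB_apply, one_mul] at this
  exact this

lemma mulOp_tanh_apply (u : (mulOp Real.tanh).domain) :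
    mulOp Real.tanh u = mulL (tanhB 1) u := by
  apply Lp.ext
  filter_upwards [coeFn_mulL (tanhB 1) (u : L2), u.2.coeFn_toLp] with x h1 h2
  rw [h1]
  refine h2.trans ?_
  rw [tanhB_apply, one_mul]

lemma mem_weakDeriv_graph_iff {u p : L2} :
    HasWeakDeriv u p ↔ ∃ h : u ∈ weakDeriv.domain, weakDeriv ⟨u, h⟩ = p := by
  rw [← mem_graph_weakDeriv, LinearPMap.mem_graph_iff]
  constructor
  · rintro ⟨⟨v, hv⟩, h1, h2⟩
    simp only at h1
    subst h1
    exact ⟨hv, h2⟩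
  · rintro ⟨h, h2⟩
    exact ⟨⟨u, h⟩, rfl, h2⟩

lemma graph_mulOp_add (ε : ℝ) :
    (mulOp Real.tanh + (ε : ℂ) • weakDeriv).graph = aGraph 1 ε := by
  ext ⟨u, f⟩
  rw [LinearPMap.mem_graph_iff, mem_aGraph]
  constructor
  · rintro ⟨⟨v, hv⟩, h1, h2⟩
    simp only at h1 h2
    subst h1
    refine ⟨weakDeriv ⟨v, hv.2⟩, mem_weakDeriv_graph_iff.2 ⟨hv.2, rfl⟩, ?_⟩
    rw [← h2, LinearPMap.add_apply, mulOp_tanh_apply, LinearPMap.smul_apply, Complex.ofReal_one,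
      one_smul]
  · rintro ⟨p, hp, rfl⟩
    obtain ⟨h, rfl⟩ := mem_weakDeriv_graph_iff.1 hp
    refine ⟨⟨u, mulOp_tanh_domain u, h⟩, rfl, ?_⟩
    rw [LinearPMap.add_apply, mulOp_tanh_apply, LinearPMap.smul_apply, Complex.ofReal_one,
      one_smul]

lemma graph_mulOp_sub (ε : ℝ) :
    (mulOp Real.tanh - (ε : ℂ) • weakDeriv).graph = aGraph 1 (-ε) := by
  ext ⟨u, f⟩
  rw [LinearPMap.mem_graph_iff, mem_aGraph]
  constructor
  · rintro ⟨⟨v, hv⟩, h1, h2⟩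
    simp only at h1 h2
    subst h1
    refine ⟨weakDeriv ⟨v, hv.2⟩, mem_weakDeriv_graph_iff.2 ⟨hv.2, rfl⟩, ?_⟩
    rw [← h2, LinearPMap.sub_apply, mulOp_tanh_apply, LinearPMap.smul_apply, Complex.ofReal_one,
      one_smul, Complex.ofReal_neg, neg_smul, sub_eq_add_neg]
  · rintro ⟨p, hp, rfl⟩
    obtain ⟨h, rfl⟩ := mem_weakDeriv_graph_iff.1 hp
    refine ⟨⟨u, mulOp_tanh_domain u, h⟩, rfl, ?_⟩
    rw [LinearPMap.sub_apply, mulOp_tanh_apply, LinearPMap.smul_apply, Complex.ofReal_one,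
      one_smul, Complex.ofReal_neg, neg_smul, sub_eq_add_neg]

lemma graph_tanhDirac (ε : ℝ) :
    (tanhDirac ε).graph = diracRel (aGraph 1 ε) (aGraph 1 (-ε)) := by
  rw [tanhDirac, diracOp, graph_offDiag, graph_mulOp_add, graph_mulOp_sub]

/-- The graph of the upper component of the squared Dirac operator. -/
def upperGraph (ε : ℝ) : Submodule ℂ (L2 × L2) := relComp (aGraph 1 (-ε)) (aGraph 1 ε)

/-- The graph of the lower component of the squared Dirac operator. -/
def lowerGraph (ε : ℝ) : Submodule ℂ (L2 × L2) := relComp (aGraph 1 ε) (aGraph 1 (-ε))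

lemma graph_tanhDiracSq (ε : ℝ) :
    (tanhDiracSq ε).graph = diagRel (upperGraph ε) (lowerGraph ε) := by
  rw [tanhDiracSq, sq_graph, graph_tanhDirac, relComp_diracRel]
  rfl

lemma graph_upperEntry {T : Spinor →ₗ.[ℂ] Spinor} {U L : Submodule ℂ (L2 × L2)}
    (h : T.graph = diagRel U L) : (upperEntry T).graph = U := by
  ext ⟨u, f⟩
  rw [LinearPMap.mem_graph_iff]
  constructor
  · rintro ⟨⟨v, hv⟩, h1, h2⟩
    simp only at h1
    subst h1
    have h3 : (inUpper v, T ⟨inUpper v, hv⟩) ∈ diagRel U L := h ▸ T.mem_graph ⟨inUpper v, hv⟩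
    have h4 : (v, (T ⟨inUpper v, hv⟩).fst) ∈ U := h3.1
    rwa [show (T ⟨inUpper v, hv⟩).fst = f from h2] at h4
  · intro hu
    have h3 : (inUpper u, WithLp.toLp 2 (f, 0)) ∈ T.graph := by
      rw [h]
      exact ⟨hu, L.zero_mem⟩
    obtain ⟨⟨v, hv⟩, h1, h2⟩ := LinearPMap.mem_graph_iff _ |>.1 h3
    simp only at h1
    subst h1
    exact ⟨⟨u, hv⟩, rfl, (congrArg WithLp.fst h2 :)⟩

lemma graph_lowerEntry {T : Spinor →ₗ.[ℂ] Spinor} {U L : Submodule ℂ (L2 × L2)}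
    (h : T.graph = diagRel U L) : (lowerEntry T).graph = L := by
  ext ⟨u, f⟩
  rw [LinearPMap.mem_graph_iff]
  constructor
  · rintro ⟨⟨v, hv⟩, h1, h2⟩
    simp only at h1
    subst h1
    have h3 : (inLower v, T ⟨inLower v, hv⟩) ∈ diagRel U L := h ▸ T.mem_graph ⟨inLower v, hv⟩
    have h4 : (v, (T ⟨inLower v, hv⟩).snd) ∈ L := h3.2
    rwa [show (T ⟨inLower v, hv⟩).snd = f from h2] at h4
  · intro hu
    have h3 : (inLower u, WithLp.toLp 2 (0, f)) ∈ T.graph := by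
      rw [h]
      exact ⟨U.zero_mem, hu⟩
    obtain ⟨⟨v, hv⟩, h1, h2⟩ := LinearPMap.mem_graph_iff _ |>.1 h3
    simp only at h1
    subst h1
    exact ⟨⟨u, hv⟩, rfl, (congrArg WithLp.snd h2 :)⟩

/-! ### Discrete and essential spectrum -/

section Discrete

variable {E : Type*} [NormedAddCommGroup E] [NormedSpace ℂ E] {T : E →ₗ.[ℂ] E} {P K : Set ℂ}

/-- An upper bound for the spectrum is enough: the complement of (P \ {z}) ∪ K isolates z. The
components thus need no separate computation of their continuous spectra. -/
lemma discreteSpectrum_eq (hP : P.Finite) (hK : IsClosed K) (hd : Disjoint P K)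
    (hs : spectrum T ⊆ P ∪ K) (he : eigenvalues T = P)
    (hf : ∀ z ∈ P, FiniteDimensional ℂ (eigenspace T z)) : discreteSpectrum T = P := by
  ext z
  constructor
  · rintro ⟨h, -, -⟩
    rwa [he] at h
  · intro hz
    have hz' : z ∈ eigenvalues T := by rwa [he]
    refine ⟨hz', hf z hz, ((P \ {z}) ∪ K)ᶜ, ?_, ?_⟩
    · apply IsOpen.mem_nhds
      · exact ((hP.subset Set.sdiff_subset).isClosed.union hK).isOpen_compl
      · rintro (h | h)
        · exact h.2 rfl
        · exact Set.disjoint_left.1 hd hz h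
    · ext y
      constructor
      · rintro ⟨h1, h2⟩
        by_contra hne
        rcases hs h2 with h | h
        · exact h1 (Or.inl ⟨h, hne⟩)
        · exact h1 (Or.inr h)
      · intro hy
        obtain rfl : y = z := hy
        refine ⟨?_, eigenvalues_subset_spectrum T hz'⟩
        rintro (h | h)
        · exact h.2 rfl
        · exact Set.disjoint_left.1 hd hz h

lemma essentialSpectrum_eq (hd : Disjoint P K) (hs : spectrum T = P ∪ K)
    (h : discreteSpectrum T = P) : essentialSpectrum T = K := by
  rw [essentialSpectrum, hs, h, Set.union_sdiff_left, sdiff_eq_left]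
  exact hd.symm

end Discrete

/-! ### The expected eigenvalues -/

lemma points_one (ε : ℝ) :
    points ε 1 = {z : ℂ | ∃ k : ℕ, ε * k < 1 ∧ z = (lamPlus ε k : ℝ)} := by
  simp only [points, lamPlus, one_pow]

lemma lamPlus_nonneg {ε : ℝ} (hε : 0 < ε) {k : ℕ} (hk : ε * k < 1) : 0 ≤ lamPlus ε k := by
  have : 0 ≤ ε * (k : ℝ) := by positivity
  rw [lamPlus]
  nlinarith

lemma lamPlus_lt_one {ε : ℝ} {k : ℕ} (hk : ε * k < 1) : lamPlus ε k < 1 := by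
  have : 0 < (1 - ε * (k : ℝ)) ^ 2 := by
    have : 0 < 1 - ε * (k : ℝ) := by linarith
    positivity
  rw [lamPlus]
  linarith

lemma lamPlus_zero (ε : ℝ) : lamPlus ε 0 = 0 := by simp [lamPlus]

/-- The numbers 1 − εk are positive in this range, where squaring is injective. -/
lemma lamPlus_injOn {ε : ℝ} (hε : 0 < ε) {j k : ℕ} (hj : ε * j < 1) (hk : ε * k < 1)
    (h : lamPlus ε j = lamPlus ε k) : j = k := by
  rw [lamPlus, lamPlus, sub_right_inj] at h
  have h1 := (pow_left_inj₀ (by linarith) (by linarith) two_ne_zero).1 h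
  have h2 : ε * (j : ℝ) = ε * k := by linarith
  exact_mod_cast mul_left_cancel₀ hε.ne' h2

lemma le_floor_of_lt {ε : ℝ} (hε : 0 < ε) {k : ℕ} (hk : ε * k < 1) : k ≤ ⌊ε⁻¹⌋₊ := by
  apply Nat.le_floor
  rw [← one_div, le_div_iff₀ hε]
  linarith

lemma disjoint_points (ε : ℝ) : Disjoint (points ε 1) (Complex.ofReal '' Set.Ici 1) := by
  rw [Set.disjoint_left, points_one]
  rintro _ ⟨k, hk, rfl⟩ ⟨t, ht, hte⟩
  have : t = lamPlus ε k := by exact_mod_cast hte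
  have h1 := lamPlus_lt_one hk
  rw [Set.mem_Ici] at ht
  linarith

lemma isClosed_ofReal_image {s : Set ℝ} (hs : IsClosed s) : IsClosed (Complex.ofReal '' s) :=
  Complex.isometry_ofReal.isClosedEmbedding.isClosedMap s hs

/-- The numbers `0 ≤ k` with `ε k < 1`, counted. -/
lemma ncard_points {ε : ℝ} (hε : 0 < ε) {m : ℕ} (hm : ∀ k : ℕ, ε * k < 1 ↔ k < m) :
    (points ε 1).ncard = m := by
  have : points ε 1 = (fun k : ℕ => ((lamPlus ε k : ℝ) : ℂ)) '' (Finset.range m : Set ℕ) := by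
    rw [points_one]
    ext z
    simp only [Set.mem_ofPred_eq, Set.mem_image, SetLike.mem_coe, Finset.mem_range, hm, eq_comm]
  rw [this, Set.InjOn.ncard_image, Set.ncard_coe_finset, Finset.card_range]
  intro j hj k hk hjk
  simp only [SetLike.mem_coe, Finset.mem_range, ← hm] at hj hk
  exact lamPlus_injOn hε hj hk (Complex.ofReal_injective hjk)

lemma sq_mem_points_iff {ε : ℝ} (hε : 0 < ε) {w : ℂ} :
    w ^ 2 ∈ points ε 1 ↔ ∃ k : ℕ, ε * k < 1 ∧
      (w = (√(lamPlus ε k) : ℝ) ∨ w = (-√(lamPlus ε k) : ℝ)) := by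
  rw [points_one]
  refine exists_congr fun k => and_congr_right fun hk => ?_
  have : ((lamPlus ε k : ℝ) : ℂ) = ((√(lamPlus ε k) : ℝ) : ℂ) ^ 2 := by
    rw [← Complex.ofReal_pow, Real.sq_sqrt (lamPlus_nonneg hε hk)]
  rw [this, sq_eq_sq_iff_eq_or_eq_neg, Complex.ofReal_neg]

/-- The families of positive and negative roots have m elements each and share only 0, which comes
from k = 0. -/
lemma ncard_sq_mem_points {ε : ℝ} (hε : 0 < ε) {m : ℕ} (hm : ∀ k : ℕ, ε * k < 1 ↔ k < m) :
    {w : ℂ | w ^ 2 ∈ points ε 1}.ncard + 1 = 2 * m := by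
  set g : ℕ → ℂ := fun k => ((√(lamPlus ε k) : ℝ) : ℂ) with hg
  set h : ℕ → ℂ := fun k => ((-√(lamPlus ε k) : ℝ) : ℂ) with hh
  set R : Set ℕ := (Finset.range m : Set ℕ) with hR
  have hRm : ∀ k, k ∈ R ↔ ε * k < 1 := fun k => by rw [hR, hm]; simp
  have hRc : R.ncard = m := by rw [hR, Set.ncard_coe_finset, Finset.card_range]
  have hRf : R.Finite := Finset.finite_toSet _
  have hu : {w : ℂ | w ^ 2 ∈ points ε 1} = g '' R ∪ h '' R := by
    ext w
    rw [Set.mem_ofPred_eq, sq_mem_points_iff hε]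
    constructor
    · rintro ⟨k, hk, rfl | rfl⟩
      · exact Or.inl ⟨k, (hRm k).2 hk, rfl⟩
      · exact Or.inr ⟨k, (hRm k).2 hk, rfl⟩
    · rintro (⟨k, hk, rfl⟩ | ⟨k, hk, rfl⟩)
      · exact ⟨k, (hRm k).1 hk, Or.inl rfl⟩
      · exact ⟨k, (hRm k).1 hk, Or.inr rfl⟩
  have hsq : ∀ j k, j ∈ R → k ∈ R → √(lamPlus ε j) = √(lamPlus ε k) → j = k := by
    intro j k hj hk e
    rw [hRm] at hj hk
    exact lamPlus_injOn hε hj hk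
      ((Real.sqrt_inj (lamPlus_nonneg hε hj) (lamPlus_nonneg hε hk)).1 e)
  have hgi : Set.InjOn g R := fun j hj k hk e => hsq j k hj hk (Complex.ofReal_injective e)
  have hhi : Set.InjOn h R := fun j hj k hk e =>
    hsq j k hj hk (neg_injective (Complex.ofReal_injective e))
  have h0 : 0 ∈ R := (hRm 0).2 (by simp)
  have hinter : g '' R ∩ h '' R = {0} := by
    ext w
    constructor
    · rintro ⟨⟨j, hj, rfl⟩, ⟨k, hk, e⟩⟩
      have e' : -√(lamPlus ε k) = √(lamPlus ε j) := Complex.ofReal_injective e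
      have h1 := Real.sqrt_nonneg (lamPlus ε k)
      have h2 := Real.sqrt_nonneg (lamPlus ε j)
      have h3 : √(lamPlus ε j) = 0 := by linarith
      rw [Set.mem_singleton_iff, hg]
      simp only [h3, Complex.ofReal_zero]
    · rintro rfl
      exact ⟨⟨0, h0, by simp [hg, lamPlus_zero]⟩, ⟨0, h0, by simp [hh, lamPlus_zero]⟩⟩
  have := Set.ncard_union_add_ncard_inter (g '' R) (h '' R) (hRf.image g) (hRf.image h)
  rw [hinter, Set.ncard_singleton, hgi.ncard_image, hhi.ncard_image, hRc, ← hu] at this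
  omega

lemma points_finite {ε : ℝ} (hε : 0 < ε) : (points ε 1).Finite := by
  rw [points_one]
  refine ((Finset.range (⌊ε⁻¹⌋₊ + 1)).finite_toSet.image
    fun k : ℕ => ((lamPlus ε k : ℝ) : ℂ)).subset ?_
  rintro _ ⟨k, hk, rfl⟩
  refine ⟨k, ?_, rfl⟩
  rw [SetLike.mem_coe, Finset.mem_range]
  exact Nat.lt_succ_of_le (le_floor_of_lt hε hk)

lemma sq_mem_points_finite {ε : ℝ} (hε : 0 < ε) : {w : ℂ | w ^ 2 ∈ points ε 1}.Finite := by
  refine ((Finset.range (⌊ε⁻¹⌋₊ + 1)).finite_toSet.image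
    (fun k : ℕ => ((√(lamPlus ε k) : ℝ) : ℂ)) |>.union
    ((Finset.range (⌊ε⁻¹⌋₊ + 1)).finite_toSet.image
    fun k : ℕ => ((-√(lamPlus ε k) : ℝ) : ℂ))).subset ?_
  intro w hw
  obtain ⟨k, hk, h⟩ := (sq_mem_points_iff hε).1 hw
  have hk' : k ∈ ((Finset.range (⌊ε⁻¹⌋₊ + 1) : Finset ℕ) : Set ℕ) := by
    rw [SetLike.mem_coe, Finset.mem_range]
    exact Nat.lt_succ_of_le (le_floor_of_lt hε hk)
  rcases h with rfl | rfl
  · exact Or.inl ⟨k, hk', rfl⟩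
  · exact Or.inr ⟨k, hk', rfl⟩

/-- The two half-lines `|w| ≥ 1` are the square roots of `[1, ∞)`. -/
lemma sq_mem_Ici_iff {w : ℂ} : w ^ 2 ∈ Complex.ofReal '' Set.Ici 1 ↔
    w ∈ Complex.ofReal '' (Set.Iic (-1) ∪ Set.Ici 1) := by
  constructor
  · rintro ⟨t, ht, hte⟩
    have ht0 : 0 ≤ t := zero_le_one.trans ht
    have : ((t : ℝ) : ℂ) = ((√t : ℝ) : ℂ) ^ 2 := by
      rw [← Complex.ofReal_pow, Real.sq_sqrt ht0]
    have h1 : 1 ≤ √t := Real.one_le_sqrt.2 ht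
    rw [this, sq_eq_sq_iff_eq_or_eq_neg] at hte
    rcases hte with h | h
    · exact ⟨√t, Or.inr h1, h⟩
    · refine ⟨-√t, Or.inl (neg_le_neg h1), ?_⟩
      rw [Complex.ofReal_neg, h, neg_neg]
  · rintro ⟨t, ht, rfl⟩
    refine ⟨t ^ 2, ?_, by push_cast; rfl⟩
    rw [Set.mem_Ici]
    rcases ht with ht | ht
    · rw [Set.mem_Iic] at ht
      nlinarith
    · rw [Set.mem_Ici] at ht
      nlinarith

/-! ### The spectra -/

/-- The number of rungs for the inductions started at c = 1. -/
lemma exists_one_le_succ_mul {ε : ℝ} (hε : 0 < ε) : ∃ n : ℕ, (1 : ℝ) ≤ (n + 1) * ε := by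
  obtain ⟨n, hn⟩ := exists_nat_gt ε⁻¹
  refine ⟨n, ?_⟩
  have h1 : ε⁻¹ * ε = 1 := inv_mul_cancel₀ hε.ne'
  nlinarith

lemma finrank_upper {ε : ℝ} (hε : 0 < ε) {z : ℂ} (hz : z ∈ points ε 1) :
    Module.finrank ℂ (eigen (upperGraph ε) z) = 1 := by
  obtain ⟨n, hn⟩ := exists_one_le_succ_mul hε
  exact (eigen_relComp hε n 1 one_pos hn z).1 hz

lemma eigen_upper_eq_bot {ε : ℝ} (hε : 0 < ε) {z : ℂ} (hz : z ∉ points ε 1) :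
    eigen (upperGraph ε) z = ⊥ := by
  obtain ⟨n, hn⟩ := exists_one_le_succ_mul hε
  exact (eigen_relComp hε n 1 one_pos hn z).2 hz

lemma nonempty_equiv_upper_lower {ε : ℝ} (hε : 0 < ε) {z : ℂ} (hz : z ≠ 0) :
    Nonempty (eigen (upperGraph ε) z ≃ₗ[ℂ] eigen (lowerGraph ε) z) :=
  (adjPair_aGraph hε.ne').nonempty_equiv hz

lemma eigen_lower_zero {ε : ℝ} (hε : 0 < ε) : eigen (lowerGraph ε) 0 = ⊥ := by
  rw [Submodule.eq_bot_iff]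
  intro u hu
  exact eq_zero_of_mem_aGraph_neg one_pos hε ((adjPair_aGraph hε.ne').symm.mem_eigen_zero.1 hu)

lemma finrank_lower {ε : ℝ} (hε : 0 < ε) {z : ℂ} (hz0 : z ≠ 0) (hz : z ∈ points ε 1) :
    Module.finrank ℂ (eigen (lowerGraph ε) z) = 1 := by
  obtain ⟨e⟩ := nonempty_equiv_upper_lower hε hz0
  rw [← e.finrank_eq, finrank_upper hε hz]

lemma eigen_lower_eq_bot {ε : ℝ} (hε : 0 < ε) {z : ℂ} (hz : z ∉ points ε 1 \ {0}) :
    eigen (lowerGraph ε) z = ⊥ := by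
  rcases eq_or_ne z 0 with rfl | hz0
  · exact eigen_lower_zero hε
  · have hb := eigen_upper_eq_bot hε fun h => hz ⟨h, hz0⟩
    obtain ⟨e⟩ := nonempty_equiv_upper_lower hε hz0
    rw [← Submodule.subsingleton_iff_eq_bot] at hb ⊢
    exact e.symm.toEquiv.subsingleton

lemma ne_bot_of_finrank_eq_one {E : Type*} [AddCommGroup E] [Module ℂ E] {S : Submodule ℂ E}
    (h : Module.finrank ℂ S = 1) : S ≠ ⊥ := by
  rintro rfl
  rw [finrank_bot] at h
  exact zero_ne_one h

lemma eigenvalues_upper {ε : ℝ} (hε : 0 < ε) :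
    eigenvalues (upperEntry (tanhDiracSq ε)) = points ε 1 := by
  ext z
  rw [mem_eigenvalues_iff, graph_upperEntry (graph_tanhDiracSq ε)]
  constructor
  · intro h
    by_contra hz
    exact h (eigen_upper_eq_bot hε hz)
  · exact fun hz => ne_bot_of_finrank_eq_one (finrank_upper hε hz)

lemma eigenvalues_lower {ε : ℝ} (hε : 0 < ε) :
    eigenvalues (lowerEntry (tanhDiracSq ε)) = points ε 1 \ {0} := by
  ext z
  rw [mem_eigenvalues_iff, graph_lowerEntry (graph_tanhDiracSq ε)]
  constructor
  · intro h
    by_contra hz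
    exact h (eigen_lower_eq_bot hε hz)
  · exact fun hz => ne_bot_of_finrank_eq_one (finrank_lower hε hz.2 hz.1)

lemma finrank_eigenspace_sq {ε : ℝ} (hε : 0 < ε) {z : ℂ} (hz0 : z ≠ 0) (hz : z ∈ points ε 1) :
    Module.finrank ℂ (eigenspace (tanhDiracSq ε) z) = 2 := by
  have h1 := finrank_upper hε hz
  have h2 := finrank_lower hε hz0 hz
  -- Additivity of `finrank` on products requires finite dimension, which a nonzero `finrank`
  -- certifies.
  have := Module.finite_of_finrank_eq_succ h1
  have := Module.finite_of_finrank_eq_succ h2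
  rw [eigenspace_eq, graph_tanhDiracSq, (eigenDiagRelEquiv _ _ z).finrank_eq, Module.finrank_prod,
    h1, h2]

lemma finrank_eigenspace_sq_zero {ε : ℝ} (hε : 0 < ε) :
    Module.finrank ℂ (eigenspace (tanhDiracSq ε) 0) = 1 := by
  have h1 := finrank_upper hε (zero_mem_points one_pos)
  have := Module.finite_of_finrank_eq_succ h1
  rw [eigenspace_eq, graph_tanhDiracSq, (eigenDiagRelEquiv _ _ 0).finrank_eq,
    eigen_lower_zero hε, Module.finrank_prod, h1, finrank_bot]

lemma finiteDimensional_eigenspace_sq {ε : ℝ} (hε : 0 < ε) {z : ℂ} (hz : z ∈ points ε 1) :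
    FiniteDimensional ℂ (eigenspace (tanhDiracSq ε) z) := by
  rcases eq_or_ne z 0 with rfl | hz0
  · exact Module.finite_of_finrank_eq_succ (finrank_eigenspace_sq_zero hε)
  · exact Module.finite_of_finrank_eq_succ (finrank_eigenspace_sq hε hz0 hz)

lemma eigenvalues_sq {ε : ℝ} (hε : 0 < ε) : eigenvalues (tanhDiracSq ε) = points ε 1 := by
  ext z
  constructor
  · intro h
    by_contra hz
    rw [mem_eigenvalues_iff, graph_tanhDiracSq, ← Submodule.nontrivial_iff_ne_bot,
      (eigenDiagRelEquiv _ _ z).toEquiv.nontrivial_congr, eigen_upper_eq_bot hε hz,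
      eigen_lower_eq_bot hε fun h => hz h.1] at h
    exact not_subsingleton _ (inferInstance : Subsingleton ((⊥ : Submodule ℂ L2) ×
      (⊥ : Submodule ℂ L2)))
  · intro hz h
    rcases eq_or_ne z 0 with rfl | hz0
    · exact ne_bot_of_finrank_eq_one (finrank_eigenspace_sq_zero hε) h
    · have h2 := finrank_eigenspace_sq hε hz0 hz
      rw [h, finrank_bot] at h2
      exact two_ne_zero h2.symm

lemma eigenspace_tanhDirac_le (ε : ℝ) (w : ℂ) :
    eigenspace (tanhDirac ε) w ≤ eigenspace (tanhDiracSq ε) (w ^ 2) := by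
  rw [eigenspace_eq, eigenspace_eq, tanhDiracSq, sq_graph]
  exact eigen_le_eigen_relComp_self _ _

lemma eigenvalues_tanhDirac {ε : ℝ} (hε : 0 < ε) :
    eigenvalues (tanhDirac ε) = {w | w ^ 2 ∈ points ε 1} := by
  ext w
  rw [Set.mem_ofPred_eq]
  constructor
  · intro h
    rw [← eigenvalues_sq hε]
    exact fun h0 => h (eq_bot_iff.2 (h0 ▸ eigenspace_tanhDirac_le ε w))
  · intro hw
    rw [mem_eigenvalues_iff, graph_tanhDirac]
    exact (adjPair_aGraph hε.ne').eigen_diracRel_ne_bot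
      (ne_bot_of_finrank_eq_one (finrank_upper hε hw))

lemma isReg_tanhDirac {ε : ℝ} (hε : 0 < ε) {w : ℂ} (h1 : w ^ 2 ∉ points ε 1)
    (h2 : w ^ 2 ∉ Complex.ofReal '' Set.Ici 1) : IsReg (tanhDirac ε).graph w := by
  obtain ⟨n, hn⟩ := exists_one_le_succ_mul hε
  rw [graph_tanhDirac]
  exact isReg_diracRel hε n 1 one_pos hn w h1 (by rwa [one_pow])

lemma isReg_tanhDiracSq_of {ε : ℝ} {w : ℂ} (h : IsReg (tanhDirac ε).graph w) :
    IsReg (tanhDiracSq ε).graph (w ^ 2) := by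
  rw [graph_tanhDirac] at h
  rw [graph_tanhDiracSq]
  exact h.relComp_of_diracRel

lemma isReg_tanhDiracSq {ε : ℝ} (hε : 0 < ε) {z : ℂ} (h1 : z ∉ points ε 1)
    (h2 : z ∉ Complex.ofReal '' Set.Ici 1) : IsReg (tanhDiracSq ε).graph z := by
  obtain ⟨w, rfl⟩ := IsAlgClosed.exists_pow_nat_eq z two_pos
  exact isReg_tanhDiracSq_of (isReg_tanhDirac hε h1 h2)

lemma not_isReg_tanhDiracSq {ε : ℝ} (hε : 0 < ε) {z : ℂ}
    (hz : z ∈ Complex.ofReal '' Set.Ici 1) : ¬ IsReg (tanhDiracSq ε).graph z := by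
  obtain ⟨t, ht, rfl⟩ := hz
  rw [graph_tanhDiracSq]
  exact fun h => not_bddBelowAt_of_one_le hε ht h.of_diagRel.1.1

lemma spectrum_sq {ε : ℝ} (hε : 0 < ε) :
    spectrum (tanhDiracSq ε) = points ε 1 ∪ Complex.ofReal '' Set.Ici 1 := by
  ext z
  constructor
  · intro hz
    rw [mem_spectrum_iff] at hz
    by_contra h
    rw [Set.mem_union, not_or] at h
    exact hz (isReg_tanhDiracSq hε h.1 h.2)
  · rintro (hz | hz)
    · rw [← eigenvalues_sq hε] at hz
      exact eigenvalues_subset_spectrum _ hz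
    · rw [mem_spectrum_iff]
      exact not_isReg_tanhDiracSq hε hz

/-- No singular sequences for D itself are needed: if D − w were regular, so would be D + w and
hence D² − w². -/
lemma spectrum_tanhDirac {ε : ℝ} (hε : 0 < ε) :
    spectrum (tanhDirac ε) =
      {w | w ^ 2 ∈ points ε 1} ∪ Complex.ofReal '' (Set.Iic (-1) ∪ Set.Ici 1) := by
  ext w
  rw [Set.mem_union, Set.mem_ofPred_eq, ← sq_mem_Ici_iff]
  constructor
  · intro hw
    rw [mem_spectrum_iff] at hw
    by_contra h
    rw [not_or] at h
    exact hw (isReg_tanhDirac hε h.1 h.2)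
  · rintro (hw | hw)
    · have : w ∈ eigenvalues (tanhDirac ε) := by rwa [eigenvalues_tanhDirac hε]
      exact eigenvalues_subset_spectrum _ this
    · rw [mem_spectrum_iff]
      exact fun h => not_isReg_tanhDiracSq hε hw (isReg_tanhDiracSq_of h)

lemma spectrum_upper_subset {ε : ℝ} (hε : 0 < ε) :
    spectrum (upperEntry (tanhDiracSq ε)) ⊆ points ε 1 ∪ Complex.ofReal '' Set.Ici 1 := by
  intro z hz
  rw [mem_spectrum_iff, graph_upperEntry (graph_tanhDiracSq ε)] at hz
  by_contra h
  rw [Set.mem_union, not_or] at h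
  have := isReg_tanhDiracSq hε h.1 h.2
  rw [graph_tanhDiracSq] at this
  exact hz this.of_diagRel.1

lemma spectrum_lower_subset {ε : ℝ} (hε : 0 < ε) :
    spectrum (lowerEntry (tanhDiracSq ε)) ⊆ points ε 1 ∪ Complex.ofReal '' Set.Ici 1 := by
  intro z hz
  rw [mem_spectrum_iff, graph_lowerEntry (graph_tanhDiracSq ε)] at hz
  by_contra h
  rw [Set.mem_union, not_or] at h
  have := isReg_tanhDiracSq hε h.1 h.2
  rw [graph_tanhDiracSq] at this
  exact hz this.of_diagRel.2

lemma discreteSpectrum_upper {ε : ℝ} (hε : 0 < ε) :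
    discreteSpectrum (upperEntry (tanhDiracSq ε)) = points ε 1 := by
  refine discreteSpectrum_eq (points_finite hε) (isClosed_ofReal_image isClosed_Ici)
    (disjoint_points ε) (spectrum_upper_subset hε) (eigenvalues_upper hε) fun z hz => ?_
  have := finrank_upper hε hz
  rw [eigenspace_eq, graph_upperEntry (graph_tanhDiracSq ε)]
  exact Module.finite_of_finrank_eq_succ this

lemma discreteSpectrum_lower {ε : ℝ} (hε : 0 < ε) :
    discreteSpectrum (lowerEntry (tanhDiracSq ε)) = points ε 1 \ {0} := by
  -- The available inclusion for the lower spectrum still allows 0, so 0 is put into the closed set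
  -- K; it is not an eigenvalue there.
  refine discreteSpectrum_eq (K := Complex.ofReal '' Set.Ici 1 ∪ {0})
    ((points_finite hε).subset Set.sdiff_subset)
    ((isClosed_ofReal_image isClosed_Ici).union isClosed_singleton) ?_ ?_ (eigenvalues_lower hε)
    fun z hz => ?_
  · rw [Set.disjoint_union_right]
    exact ⟨(disjoint_points ε).mono_left Set.sdiff_subset, Set.disjoint_sdiff_left⟩
  · intro z hz
    rcases eq_or_ne z 0 with rfl | hz0
    · exact Or.inr (Or.inr rfl)
    · rcases spectrum_lower_subset hε hz with h | h
      · exact Or.inl ⟨h, hz0⟩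
      · exact Or.inr (Or.inl h)
  · have := finrank_lower hε hz.2 hz.1
    rw [eigenspace_eq, graph_lowerEntry (graph_tanhDiracSq ε)]
    exact Module.finite_of_finrank_eq_succ this

lemma discreteSpectrum_sq {ε : ℝ} (hε : 0 < ε) :
    discreteSpectrum (tanhDiracSq ε) = points ε 1 :=
  discreteSpectrum_eq (points_finite hε) (isClosed_ofReal_image isClosed_Ici)
    (disjoint_points ε) (spectrum_sq hε).subset (eigenvalues_sq hε)
    fun _ hz => finiteDimensional_eigenspace_sq hε hz

lemma disjoint_sq_mem_points (ε : ℝ) : Disjoint {w : ℂ | w ^ 2 ∈ points ε 1}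
    (Complex.ofReal '' (Set.Iic (-1) ∪ Set.Ici 1)) := by
  rw [Set.disjoint_left]
  intro w hw hw'
  exact Set.disjoint_left.1 (disjoint_points ε) hw (sq_mem_Ici_iff.2 hw')

lemma discreteSpectrum_tanhDirac {ε : ℝ} (hε : 0 < ε) :
    discreteSpectrum (tanhDirac ε) = {w | w ^ 2 ∈ points ε 1} := by
  refine discreteSpectrum_eq (sq_mem_points_finite hε)
    (isClosed_ofReal_image (isClosed_Iic.union isClosed_Ici)) (disjoint_sq_mem_points ε)
    (spectrum_tanhDirac hε).subset (eigenvalues_tanhDirac hε) fun w hw => ?_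
  have := finiteDimensional_eigenspace_sq hε hw
  exact Submodule.finiteDimensional_of_le (eigenspace_tanhDirac_le ε w)

end DiracTanh

end

/-! ### The main theorem. -/

open DiracTanh

theorem proposition2p2 (ε : ℝ) (hε : 0 < ε) (N : ℕ) (hN : N = ⌊ε⁻¹⌋₊) :
    -- the discrete eigenvalues of the two components; `k = N` in the first and `k = N - 1` in the
    -- second set are left out only if `ε⁻¹` is an integer
    discreteSpectrum (upperEntry (tanhDiracSq ε)) =
      {z : ℂ | ∃ k : ℕ, k ≤ N ∧ ε * k < 1 ∧ z = (lamPlus ε k : ℝ)} ∧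
    discreteSpectrum (lowerEntry (tanhDiracSq ε)) =
      {z : ℂ | ∃ k : ℕ, k < N ∧ ε * (k + 1) < 1 ∧ z = (lamMinus ε k : ℝ)} ∧
    -- the discrete eigenvalues of the squared operator and of the operator
    discreteSpectrum (tanhDiracSq ε) =
      {z : ℂ | ∃ k : ℕ, k ≤ N ∧ ε * k < 1 ∧ z = (lamPlus ε k : ℝ)} ∧
    discreteSpectrum (tanhDirac ε) =
      {z : ℂ | ∃ k : ℕ, k ≤ N ∧ ε * k < 1 ∧
        (z = (√(lamPlus ε k) : ℝ) ∨ z = (-√(lamPlus ε k) : ℝ))} ∧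
    -- there are no further eigenvalues
    eigenvalues (upperEntry (tanhDiracSq ε)) = discreteSpectrum (upperEntry (tanhDiracSq ε)) ∧
    eigenvalues (lowerEntry (tanhDiracSq ε)) = discreteSpectrum (lowerEntry (tanhDiracSq ε)) ∧
    eigenvalues (tanhDiracSq ε) = discreteSpectrum (tanhDiracSq ε) ∧
    eigenvalues (tanhDirac ε) = discreteSpectrum (tanhDirac ε) ∧
    -- interlacing and the tabulated values
    (∀ k : ℕ, k < N → lamMinus ε k = lamPlus ε (k + 1)) ∧
    (∀ k : ℕ, k ≤ N → lamPlus ε k = k * ε * (2 - k * ε)) ∧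
    (∀ k : ℕ, k < N → lamMinus ε k = (k + 1) * ε * (2 - (k + 1) * ε)) ∧
    -- multiplicities
    lamPlus ε 0 = 0 ∧
    Module.finrank ℂ (eigenspace (tanhDiracSq ε) 0) = 1 ∧
    (∀ z ∈ discreteSpectrum (tanhDiracSq ε), z ≠ 0 →
      Module.finrank ℂ (eigenspace (tanhDiracSq ε) z) = 2) ∧
    -- the number of distinct discrete eigenvalues if `ε⁻¹` is not an integer
    ((∀ n : ℕ, ε⁻¹ ≠ n) →
      (discreteSpectrum (tanhDiracSq ε)).ncard = N + 1 ∧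
      (discreteSpectrum (tanhDirac ε)).ncard = 2 * N + 1) ∧
    -- the threshold case
    (∀ n : ℕ, ε⁻¹ = n →
      N = n ∧ lamPlus ε N = 1 ∧
      (discreteSpectrum (tanhDiracSq ε)).ncard = N ∧
      (discreteSpectrum (tanhDirac ε)).ncard + 1 = 2 * N) ∧
    -- the essential spectra
    essentialSpectrum (tanhDiracSq ε) = Complex.ofReal '' Set.Ici 1 ∧
    essentialSpectrum (tanhDirac ε) = Complex.ofReal '' (Set.Iic (-1) ∪ Set.Ici 1) := by
  subst hN
  -- The bound k ≤ N is implied by εk < 1.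
  have hpts : points ε 1 = {z : ℂ | ∃ k : ℕ, k ≤ ⌊ε⁻¹⌋₊ ∧ ε * k < 1 ∧ z = (lamPlus ε k : ℝ)} := by
    rw [points_one]
    ext z
    exact exists_congr fun k => ⟨fun h => ⟨le_floor_of_lt hε h.1, h⟩, fun h => h.2⟩
  -- Removing 0 removes the index k = 0, and the remaining indices are shifted by one.
  have hlow : points ε 1 \ {0} =
      {z : ℂ | ∃ k : ℕ, k < ⌊ε⁻¹⌋₊ ∧ ε * (k + 1) < 1 ∧ z = (lamMinus ε k : ℝ)} := by
    rw [points_one]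
    ext z
    constructor
    · rintro ⟨⟨k, hk, rfl⟩, h0⟩
      rcases k with _ | k
      · exact absurd (by simp [lamPlus]) h0
      · refine ⟨k, le_floor_of_lt hε hk, by exact_mod_cast hk, ?_⟩
        simp only [lamPlus, lamMinus]
        push_cast
        rfl
    · rintro ⟨k, -, hk, rfl⟩
      have hk' : ε * ((k + 1 : ℕ) : ℝ) < 1 := by exact_mod_cast hk
      have e : lamMinus ε k = lamPlus ε (k + 1) := by
        simp only [lamPlus, lamMinus]
        push_cast
        rfl
      refine ⟨⟨k + 1, hk', by rw [e]⟩, fun h => ?_⟩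
      rw [Set.mem_singleton_iff, e, Complex.ofReal_eq_zero, ← lamPlus_zero ε] at h
      exact Nat.succ_ne_zero k (lamPlus_injOn hε hk' (by simp) h)
  refine ⟨?_, ?_, ?_, ?_, ?_, ?_, ?_, ?_, ?_, ?_, ?_, lamPlus_zero ε,
    finrank_eigenspace_sq_zero hε, ?_, ?_, ?_, ?_, ?_⟩
  · rw [discreteSpectrum_upper hε, hpts]
  · rw [discreteSpectrum_lower hε, hlow]
  · rw [discreteSpectrum_sq hε, hpts]
  · rw [discreteSpectrum_tanhDirac hε]
    ext w
    rw [Set.mem_ofPred_eq, sq_mem_points_iff hε]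
    exact exists_congr fun k => ⟨fun h => ⟨le_floor_of_lt hε h.1, h⟩, fun h => h.2⟩
  · rw [discreteSpectrum_upper hε, eigenvalues_upper hε]
  · rw [discreteSpectrum_lower hε, eigenvalues_lower hε]
  · rw [discreteSpectrum_sq hε, eigenvalues_sq hε]
  · rw [discreteSpectrum_tanhDirac hε, eigenvalues_tanhDirac hε]
  · intro k _
    simp only [lamPlus, lamMinus]
    push_cast
    rfl
  · intro k _
    simp only [lamPlus]
    ring
  · intro k _
    simp only [lamMinus]
    ring
  · intro z hz hz0
    rw [discreteSpectrum_sq hε] at hz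
    exact finrank_eigenspace_sq hε hz0 hz
  · intro hn
    -- Since ε⁻¹ is not an integer, k ≤ N already gives the strict inequality k < ε⁻¹, so all N + 1
    -- indices count.
    have hm : ∀ k : ℕ, ε * k < 1 ↔ k < ⌊ε⁻¹⌋₊ + 1 := by
      intro k
      rw [Nat.lt_succ_iff]
      refine ⟨le_floor_of_lt hε, fun hk => ?_⟩
      have h1 : (k : ℝ) ≤ ε⁻¹ := (Nat.le_floor_iff (by positivity)).1 hk
      have h2 : (k : ℝ) < ε⁻¹ := lt_of_le_of_ne h1 fun h => hn k h.symm
      calc ε * k < ε * ε⁻¹ := by gcongr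
        _ = 1 := mul_inv_cancel₀ hε.ne'
    have h1 := ncard_points hε hm
    have h2 := ncard_sq_mem_points hε hm
    rw [discreteSpectrum_sq hε, discreteSpectrum_tanhDirac hε]
    omega
  · intro n hn
    have hfl : ⌊ε⁻¹⌋₊ = n := by rw [hn, Nat.floor_natCast]
    have hεn : ε * n = 1 := by rw [← hn, mul_inv_cancel₀ hε.ne']
    -- At the threshold the index k = n gives εk = 1 and drops out, leaving n indices.
    have hm : ∀ k : ℕ, ε * k < 1 ↔ k < n := by
      intro k
      rw [← hεn, mul_lt_mul_iff_right₀ hε, Nat.cast_lt]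
    rw [hfl, discreteSpectrum_sq hε, discreteSpectrum_tanhDirac hε]
    refine ⟨rfl, ?_, ncard_points hε hm, ncard_sq_mem_points hε hm⟩
    rw [lamPlus, hεn]
    ring
  · exact essentialSpectrum_eq (disjoint_points ε) (spectrum_sq hε) (discreteSpectrum_sq hε)
  · exact essentialSpectrum_eq (disjoint_sq_mem_points ε) (spectrum_tanhDirac hε)
      (discreteSpectrum_tanhDirac hε)
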